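/- Let $b\in\mathbb R$, $c_1>0$, $w^*\in(0,1)$, and let $(W_i)_{i\ge 1}$ be i.i.d. copies of a random variable $W$ with the (truncated) fraction-of-gamma distribution $$\mathbb P(W\ge x)=Z_{w^*}(1-x)^{-b}e^{-x/(c_1(1-x))},\qquad x\in[w^*,1),$$ where $Z_{w^*}$ is the normalising constant for which $\mathbb P(W\ge w^*)=1$ (the parameters being such that this is the tail of a probability distribution). Set $\theta:=1+\mathbb E[W]$. Consider the weighted recursive tree with these vertex-weights: it starts with the single vertex $1$, and for each $n\ge1$ the new vertex $n+1$ is attached, conditionally on the weights and on the tree on $\{1,\dots,n\}$, to vertex $i\in\{1,\dots,n\}$ with probability $W_i/\sum_{j=1}^n W_j$. Let $\mathcal Z_n(i)$ be the in-degree (number of children) of vertex $i$ in the tree on $\{1,\dots,n\}$. Fix $k\in\mathbb N$ and $c\in(0,\theta/(\theta-1))$. Let $(d_i)_{i\in[k]}=(d_i(n))_{i\in[k]}$ be $k$ integer-valued sequences that tend to infinity as $n\to\infty$ and satisfy $d_i\le c\log n$ for all $i\in[k]$ and all sufficiently large $n$. For $n\ge k$ let $v_1,\dots,v_k$ be vertices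 selected uniformly at random without replacement from $\{1,\dots,n\}$, independently of the weights and the tree. Then the event $\{\mathcal Z_n(v_i)\ge d_i \text{ for all } i\in[k]\}$ has positive probability for all sufficiently large $n$, and, conditionally on this event, the tuple $$\left(\frac{\log v_i-(\log n-(1-\theta^{-1})d_i)}{\sqrt{(1-\theta^{-1})^2d_i}}\right)_{i\in[k]}$$ converges in distribution, as $n\to\infty$, to $(M_i)_{i\in[k]}$, where $M_1,\dots,M_k$ are i.i.d. $\mathcal N\big(-1/\sqrt{c_1\theta(\theta-1)},\,1\big)$ random variables. In particular, the mean of the limit variables is negative. -/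

import Mathlib

open MeasureTheory ProbabilityTheory Filter Topology

noncomputable section

namespace WRT

variable {Ω : Type*}

/-- `S_n = W_1 + ⋯ + W_n`, the total weight of the vertices with labels `1, …, n`. -/
def totalWeight (W : ℕ → Ω → ℝ) (n : ℕ) (ω : Ω) : ℝ :=
  ∑ i ∈ Finset.Icc 1 n, W i ω

/-- The σ-algebra generated by all vertex-weights `W_1, W_2, …` and by the edges of the tree on
the vertices `1, …, n`, where `parent j` is the vertex to which vertex `j ≥ 2` is attached. -/
abbrev history (W : ℕ → Ω → ℝ) (parent : ℕ → Ω → ℕ) (n : ℕ) : MeasurableSpace Ω :=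
  (⨆ i : ℕ, ⨆ _ : 1 ≤ i, MeasurableSpace.comap (W i) inferInstance) ⊔
    (⨆ j : ℕ, ⨆ _ : j ∈ Finset.Icc 2 n, MeasurableSpace.comap (parent j) inferInstance)

/-- The weighted recursive tree on the vertices `1, 2, 3, …`: vertex `i ≥ 1` has weight `W i`, the
weights are i.i.d. and almost surely positive, and vertex `n + 1` (for `n ≥ 1`) is attached to a
random vertex `parent (n + 1)`, which is `i ∈ {1, …, n}` with probability `W i / S_n` given the
weights and the tree on `1, …, n`. The values `W 0`, `parent 0`, `parent 1` play no role. -/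
structure IsWRT [MeasurableSpace Ω] (μ : Measure Ω) (W : ℕ → Ω → ℝ)
    (parent : ℕ → Ω → ℕ) : Prop where
  measurable_weight : ∀ i, 1 ≤ i → Measurable (W i)
  measurable_parent : ∀ j, 2 ≤ j → Measurable (parent j)
  indep_weight : iIndepFun (fun i : ℕ => W (i + 1)) μ
  identDistrib_weight : ∀ i, 1 ≤ i → IdentDistrib (W i) (W 1) μ μ
  weight_pos : ∀ i, 1 ≤ i → ∀ᵐ ω ∂μ, 0 < W i ω
  attach : ∀ n, 1 ≤ n → ∀ i ∈ Finset.Icc 1 n,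
    μ[Set.indicator {ω | parent (n + 1) ω = i} (fun _ => (1 : ℝ)) | history W parent n]
      =ᵐ[μ] fun ω => W i ω / totalWeight W n ω

/-- The in-degree of vertex `i` in the tree on the vertices `1, …, n`. -/
def inDegree (parent : ℕ → Ω → ℕ) (n i : ℕ) (ω : Ω) : ℕ :=
  ((Finset.Icc 2 n).filter fun j => parent j ω = i).card

/-- The tail `x ↦ ℙ(W ≥ x)`, `x ∈ [w, 1)`, of the fraction-of-gamma distribution truncated at `w`;
the leading factor is the normalising constant that makes the value at `x = w` equal to `1`. -/
def gammaFractionTail (b c₁ w x : ℝ) : ℝ :=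
  ((1 - w) ^ (-b) * Real.exp (-w / (c₁ * (1 - w))))⁻¹ *
    ((1 - x) ^ (-b) * Real.exp (-x / (c₁ * (1 - x))))

/-- For every `n ≥ k`, the tuple `(v n 0, …, v n (k - 1))` is a uniform sample without replacement
from `{1, …, n}`, independent of all weights and edges of the tree. -/
structure IsUniformSample [MeasurableSpace Ω] (μ : Measure Ω) (W : ℕ → Ω → ℝ)
    (parent : ℕ → Ω → ℕ) {k : ℕ} (v : ℕ → Fin k → Ω → ℕ) : Prop where
  measurable : ∀ n, k ≤ n → ∀ i, Measurable (v n i)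
  law : ∀ n, k ≤ n → μ.map (fun ω i => v n i ω) =
    uniformOn {a : Fin k → ℕ | Function.Injective a ∧ ∀ i, a i ∈ Finset.Icc 1 n}
  indep : ∀ n, k ≤ n → IndepFun (fun ω i => v n i ω)
    (fun ω => ((fun i : ℕ => W (i + 1) ω), (fun j : ℕ => parent (j + 2) ω))) μ

/-- The rescaled label `(log v - (log n - (1 - θ⁻¹) d)) / √((1 - θ⁻¹)² d)`. -/
def rescaledLabel (θ : ℝ) (n : ℕ) (d : ℤ) (v : ℕ) : ℝ :=
  (Real.log v - (Real.log n - (1 - θ⁻¹) * d)) / √((1 - θ⁻¹) ^ 2 * d)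

/-- The event that `v n i` has in-degree at least `d i n` in the tree on `1, …, n`, for all `i`. -/
def highDegreeEvent (parent : ℕ → Ω → ℕ) {k : ℕ} (v : ℕ → Fin k → Ω → ℕ)
    (d : Fin k → ℕ → ℤ) (n : ℕ) : Set Ω :=
  {ω | ∀ i, d i n ≤ (inDegree parent n (v n i ω) ω : ℤ)}

/-- The law of the tuple of rescaled labels under the conditional measure given the high-degree
event. It is a probability measure as soon as that event has positive probability (and is the zero
measure otherwise); as a `FiniteMeasure` it carries the topology of weak convergence. -/
def condLabelLaw [MeasurableSpace Ω] (μ : Measure Ω) (θ : ℝ)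
    (parent : ℕ → Ω → ℕ) {k : ℕ} (v : ℕ → Fin k → Ω → ℕ) (d : Fin k → ℕ → ℤ) (n : ℕ) :
    FiniteMeasure (Fin k → ℝ) :=
  ⟨(μ[|highDegreeEvent parent v d n]).map (fun ω i => rescaledLabel θ n (d i n) (v n i ω)),
    inferInstance⟩

/-- The law of `k` independent `N(m, 1)` random variables. -/
def iidNormal (k : ℕ) (m : ℝ) : FiniteMeasure (Fin k → ℝ) :=
  ⟨Measure.pi fun _ => gaussianReal m 1, inferInstance⟩

end WRT

end

/-! ### Tails of the Poisson distribution as functions of the parameter. -/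

noncomputable section

namespace WRT

section Deterministic

set_option linter.unusedSectionVars false

/-! Write M = θ - 1 = 𝔼[W]. Given the weights, a vertex b of weight u receives vertex m + 1 with
probability u / S_m, which is close to u / (M m). Its in-degree at time n is therefore nearly
Poisson with parameter (u / M) log (n / b), and distinct vertices are nearly independent. Exactly,
the in-degrees of k fixed vertices form a Markov chain given the weights (`IsWRT.integral_degrees`),
and `abs_evol_sub_poisson_le` compares this chain with a Poisson flow in a norm weighted by s ^ z,
used with s = θ. The weighting is essential: the events in question can have polynomially small
probability, so errors have to be small relative to the Chernoff bound θ ^ (-D) n / b and not just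
absolutely.

Sampling the labels amounts to summing over tuples of distinct vertices. Up to a relative error that
is a negative power of n, the Fourier transform of the tuple of log (n / v_i) on the high-degree
event becomes a product of single sums (`norm_sum_injective_sub_prod_le`,
`IsWRT.norm_tupleSum_sub_prod_le`). Each single sum is a Riemann sum for a Laplace transform that is
explicit, namely (1 - iξ)⁻¹ 𝔼[(W / (W + M (1 - iξ))) ^ D] (`integral_exp_mul_poissonMix`,
`norm_charSum_sub_charInt_le`). Labels below n ^ η only receive a crude Chernoff bound, and c < θ /
(θ - 1) is what makes their contribution negligible (`exists_exponents`).

At ξ = 0 the transform is the mass 𝔼[(W / (W + M)) ^ D]. The factor (θ W / (W + M)) ^ D, roughly exp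
(-(M / θ) D (1 - W)), favours W near 1, while the tail exp (-1 / (c₁ (1 - W))) penalises it. The two
balance at 1 - W = κ / √D with κ = √(θ / (c₁ M)). So the mass is at least θ ^ (-D) exp (-C √D), and
since D ≤ c log n the factor exp (-C √D) costs less than any power of n (`tiltMass_ge`,
`eventually_rpow_neg_le_tiltMass`). Under the law of W tilted by this factor, √D (1 - W) tends to κ
in probability (`tendsto_tilt_ratio`).

Given the tilted weight, log (n / v) behaves like a sum of D exponential variables of mean M / (W +
M), and an independent exponential variable that does not matter in the limit. Its mean exceeds (1 -
θ⁻¹) D by about (1 - θ⁻¹) √D κ / θ and its standard deviation is about (1 - θ⁻¹) √D. A central limit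
computation with characteristic functions (`tendsto_charInt_ratio`) gives N(-κ / θ, 1), where κ / θ
= 1 / √(c₁ θ (θ - 1)). The same sum at frequency zero is the probability of the event, up to the
number of tuples. Hence it is eventually positive, and the quotient of the two sums converges to the
Gaussian characteristic function. -/

/-- The probability that a Poisson variable of parameter `l` is at least `d`. -/
def poissonTail (d : ℕ) (l : ℝ) : ℝ :=
  1 - ∑ j ∈ Finset.range d, Real.exp (-l) * (l ^ j / j.factorial)

@[simp] lemma poissonTail_zero (l : ℝ) : poissonTail 0 l = 1 := by simp [poissonTail]

lemma poissonTail_succ (d : ℕ) (l : ℝ) :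
    poissonTail (d + 1) l = poissonTail d l - Real.exp (-l) * (l ^ d / d.factorial) := by
  simp [poissonTail, Finset.sum_range_succ]; ring

lemma poissonTail_at_zero (d : ℕ) : poissonTail d 0 = if d = 0 then 1 else 0 := by
  rcases d with _ | d
  · simp
  · simp [poissonTail, Finset.sum_range_succ']

/-- Differentiating the Poisson weights telescopes. This is the Kolmogorov equation that lets
products of tails serve as a flow for the in-degree chain; for `d = 0` the truncated `d - 1`
correctly gives derivative zero. -/
lemma hasDerivAt_poissonTail (d : ℕ) (l : ℝ) :
    HasDerivAt (poissonTail d) (poissonTail (d - 1) l - poissonTail d l) l := by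
  induction d with
  | zero =>
    have : poissonTail 0 = fun _ => 1 := by ext; simp
    simpa [this] using hasDerivAt_const l (1 : ℝ)
  | succ d ih =>
    have e : poissonTail (d + 1) =
        fun l => poissonTail d l - Real.exp (-l) * (l ^ d / d.factorial) := by
      ext l; exact poissonTail_succ d l
    have h1 : HasDerivAt (fun l : ℝ => Real.exp (-l)) (-Real.exp (-l)) l := by
      simpa using (hasDerivAt_neg l).exp
    have h2 := (hasDerivAt_pow d l).div_const (d.factorial : ℝ)
    rw [e]
    refine HasDerivAt.congr_deriv (ih.sub (h1.mul h2)) ?_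
    rcases d with _ | d
    · simp
    · simp only [Nat.add_sub_cancel, poissonTail_succ, Nat.factorial_succ]
      push_cast
      field_simp
      ring

lemma continuous_poissonTail (d : ℕ) : Continuous (poissonTail d) :=
  continuous_iff_continuousAt.2 fun l => (hasDerivAt_poissonTail d l).continuousAt

lemma poissonTail_nonneg (d : ℕ) {l : ℝ} (hl : 0 ≤ l) : 0 ≤ poissonTail d l := by
  have := Real.sum_le_exp_of_nonneg hl d
  rw [poissonTail, ← Finset.mul_sum, Real.exp_neg, sub_nonneg, inv_mul_le_iff₀ (Real.exp_pos l)]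
  simpa using this

lemma poissonTail_le_one (d : ℕ) {l : ℝ} (hl : 0 ≤ l) : poissonTail d l ≤ 1 := by
  rw [poissonTail, sub_le_self_iff]
  exact Finset.sum_nonneg fun j _ => by positivity

/-- Chernoff's bound, by induction on `d`: after multiplication by exp l, the difference of the two
sides at `d + 1` has as derivative the same quantity at `d`. It is thus monotone, and it is
nonnegative at zero. -/
lemma poissonTail_le (d : ℕ) {s l : ℝ} (hs : 1 ≤ s) (hl : 0 ≤ l) :
    poissonTail d l ≤ (s ^ d)⁻¹ * Real.exp ((s - 1) * l) := by
  induction d generalizing l with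
  | zero =>
    simp only [poissonTail_zero, pow_zero, inv_one, one_mul]
    exact Real.one_le_exp (mul_nonneg (by linarith) hl)
  | succ d ih =>
    have hs0 : 0 < s := by linarith
    let F : ℝ → ℝ := fun l =>
      Real.exp l * ((s ^ (d + 1))⁻¹ * Real.exp ((s - 1) * l) - poissonTail (d + 1) l)
    have hF : ∀ x, HasDerivAt F
        (Real.exp x * ((s ^ d)⁻¹ * Real.exp ((s - 1) * x) - poissonTail d x)) x := by
      intro x
      have h1 : HasDerivAt (fun l : ℝ => Real.exp ((s - 1) * l))
          (Real.exp ((s - 1) * x) * (s - 1)) x := by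
        simpa using ((hasDerivAt_id x).const_mul (s - 1)).exp
      refine HasDerivAt.congr_deriv ((Real.hasDerivAt_exp x).mul
        ((h1.const_mul ((s ^ (d + 1))⁻¹)).sub (hasDerivAt_poissonTail (d + 1) x))) ?_
      simp only [Nat.add_sub_cancel]
      field_simp
      ring
    have hmono : MonotoneOn F (Set.Ici 0) := by
      refine monotoneOn_of_deriv_nonneg (convex_Ici 0)
        (fun x _ => (hF x).continuousAt.continuousWithinAt)
        (fun x _ => (hF x).differentiableAt.differentiableWithinAt) fun x hx => ?_
      rw [interior_Ici] at hx
      rw [(hF x).deriv]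
      exact mul_nonneg (Real.exp_pos x).le (sub_nonneg.2 (ih (le_of_lt hx)))
    have h0 := hmono (Set.self_mem_Ici) (Set.mem_Ici.2 hl) hl
    have h1 : 0 ≤ F 0 := by
      simp only [F, poissonTail_at_zero]
      simp
      positivity
    have h2 := h1.trans h0
    exact sub_nonneg.1 ((mul_nonneg_iff_of_pos_left (Real.exp_pos l)).1 h2)

/-! ### The counting chain as an operator on functions, and its exponential moments. -/

variable {ι : Type*} [Fintype ι] [DecidableEq ι]

/-- One step of the chain on `ι → ℕ` that raises coordinate `i` with probability `p i`. -/
def step (p : ι → ℝ) (G : (ι → ℕ) → ℝ) (z : ι → ℕ) : ℝ :=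
  G z + ∑ i, p i * (G (z + Pi.single i 1) - G z)

/-- The composition of the steps `p 0, …, p (n - 1)`, acting on functions. -/
def evol (p : ℕ → ι → ℝ) : ℕ → ((ι → ℕ) → ℝ) → (ι → ℕ) → ℝ
  | 0, G => G
  | n + 1, G => evol p n (step (p n) G)

lemma step_eq (p : ι → ℝ) (G : (ι → ℕ) → ℝ) (z : ι → ℕ) :
    step p G z = (1 - ∑ i, p i) * G z + ∑ i, p i * G (z + Pi.single i 1) := by
  simp only [step, mul_sub, Finset.sum_sub_distrib, ← Finset.sum_mul]; ring

lemma step_mono {p : ι → ℝ} (h0 : ∀ i, 0 ≤ p i) (h1 : ∑ i, p i ≤ 1) {G H : (ι → ℕ) → ℝ}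
    (h : ∀ z, G z ≤ H z) (z : ι → ℕ) : step p G z ≤ step p H z := by
  rw [step_eq, step_eq]
  refine add_le_add (mul_le_mul_of_nonneg_left (h z) (by linarith)) ?_
  exact Finset.sum_le_sum fun i _ => mul_le_mul_of_nonneg_left (h _) (h0 i)

lemma evol_mono {p : ℕ → ι → ℝ} {n : ℕ} (h0 : ∀ m < n, ∀ i, 0 ≤ p m i)
    (h1 : ∀ m < n, ∑ i, p m i ≤ 1) {G H : (ι → ℕ) → ℝ} (h : ∀ z, G z ≤ H z) (z : ι → ℕ) :
    evol p n G z ≤ evol p n H z := by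
  induction n generalizing G H with
  | zero => exact h z
  | succ n ih =>
    exact ih (fun m hm => h0 m (by omega)) (fun m hm => h1 m (by omega))
      (step_mono (h0 n (by omega)) (h1 n (by omega)) h)

lemma step_sub (p : ι → ℝ) (G H : (ι → ℕ) → ℝ) :
    step p (fun z => G z - H z) = fun z => step p G z - step p H z := by
  ext z
  simp only [step_eq, mul_sub, Finset.sum_sub_distrib]; ring

lemma step_const_mul (p : ι → ℝ) (c : ℝ) (G : (ι → ℕ) → ℝ) :
    step p (fun z => c * G z) = fun z => c * step p G z := by
  ext z
  simp only [step_eq, mul_add, Finset.mul_sum]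
  congr 1
  · ring
  · exact Finset.sum_congr rfl fun i _ => by ring

lemma evol_sub (p : ℕ → ι → ℝ) (n : ℕ) (G H : (ι → ℕ) → ℝ) (z : ι → ℕ) :
    evol p n (fun z => G z - H z) z = evol p n G z - evol p n H z := by
  induction n generalizing G H with
  | zero => rfl
  | succ n ih => simp only [evol, step_sub]; exact ih _ _

lemma evol_const_mul (p : ℕ → ι → ℝ) (n : ℕ) (c : ℝ) (G : (ι → ℕ) → ℝ) (z : ι → ℕ) :
    evol p n (fun z => c * G z) z = c * evol p n G z := by
  induction n generalizing G with
  | zero => rfl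
  | succ n ih => simp only [evol, step_const_mul]; exact ih _

lemma prod_pow_add_single (s : ι → ℝ) (z : ι → ℕ) (i : ι) :
    ∏ j, s j ^ ((z + Pi.single i 1 : ι → ℕ) j) = s i * ∏ j, s j ^ z j := by
  have : ∀ j, s j ^ ((z + Pi.single i 1 : ι → ℕ) j) = s j ^ z j * (if j = i then s i else 1) := by
    intro j
    by_cases h : j = i
    · subst h; simp [pow_succ]
    · simp [h]
  simp only [this, Finset.prod_mul_distrib, Finset.prod_ite_eq', Finset.mem_univ, if_true]
  ring

/-- Exponential weights are eigenfunctions of every step. Exponential moments of the chain are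
therefore explicit products, and weighted error bounds propagate through the chain. -/
lemma step_weight (p s : ι → ℝ) :
    step p (fun z => ∏ j, s j ^ z j) =
      fun z => (1 + ∑ i, p i * (s i - 1)) * ∏ j, s j ^ z j := by
  ext z
  simp only [step, prod_pow_add_single, add_mul, one_mul, Finset.sum_mul]
  congr 1
  exact Finset.sum_congr rfl fun i _ => by ring

lemma evol_weight (p : ℕ → ι → ℝ) (s : ι → ℝ) (n : ℕ) :
    evol p n (fun z => ∏ j, s j ^ z j) 0 = ∏ m ∈ Finset.range n, (1 + ∑ i, p m i * (s i - 1)) := by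
  induction n with
  | zero => simp [evol]
  | succ n ih =>
    rw [evol, step_weight, evol_const_mul, ih, Finset.prod_range_succ, mul_comm]

lemma evol_weight_le {p : ℕ → ι → ℝ} {s : ι → ℝ} {n : ℕ} (h0 : ∀ m < n, ∀ i, 0 ≤ p m i)
    (hs : ∀ i, 1 ≤ s i) :
    evol p n (fun z => ∏ j, s j ^ z j) 0 ≤
      Real.exp (∑ i, (s i - 1) * ∑ m ∈ Finset.range n, p m i) := by
  rw [evol_weight]
  have : ∑ i, (s i - 1) * ∑ m ∈ Finset.range n, p m i =
      ∑ m ∈ Finset.range n, ∑ i, p m i * (s i - 1) := by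
    rw [Finset.sum_comm]
    exact Finset.sum_congr rfl fun i _ => by rw [← Finset.sum_mul, mul_comm]
  rw [this, Real.exp_sum]
  refine Finset.prod_le_prod (fun m hm => ?_) fun m hm => ?_
  · have := Finset.sum_nonneg fun i (_ : i ∈ Finset.univ) =>
      mul_nonneg (h0 m (Finset.mem_range.1 hm) i) (sub_nonneg.2 (hs i))
    linarith
  · rw [add_comm]; exact Real.add_one_le_exp _

/-- The indicator function of `{z | D ≤ z}`. -/
def exceed (D : ι → ℕ) (z : ι → ℕ) : ℝ := if ∀ i, D i ≤ z i then 1 else 0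

lemma exceed_le_weight (D : ι → ℕ) {s : ι → ℝ} (hs : ∀ i, 1 ≤ s i) (z : ι → ℕ) :
    exceed D z ≤ (∏ i, (s i ^ D i)⁻¹) * ∏ i, s i ^ z i := by
  rw [exceed, ← Finset.prod_mul_distrib]
  split_ifs with h
  · refine Finset.one_le_prod fun i _ => ?_
    have h1 : 0 < s i := by linarith [hs i]
    rw [inv_mul_eq_div, one_le_div (by positivity)]
    exact pow_le_pow_right₀ (hs i) (h i)
  · exact Finset.prod_nonneg fun i _ => by
      have h1 : 0 < s i := by linarith [hs i]
      positivity

/-- Chernoff bound for the chain. -/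
lemma evol_exceed_le {p : ℕ → ι → ℝ} {s : ι → ℝ} {n : ℕ} (h0 : ∀ m < n, ∀ i, 0 ≤ p m i)
    (h1 : ∀ m < n, ∑ i, p m i ≤ 1) (hs : ∀ i, 1 ≤ s i) (D : ι → ℕ) :
    evol p n (exceed D) 0 ≤
      ∏ i, ((s i ^ D i)⁻¹ * Real.exp ((s i - 1) * ∑ m ∈ Finset.range n, p m i)) := by
  refine (evol_mono h0 h1 (exceed_le_weight D hs) 0).trans ?_
  rw [evol_const_mul, Finset.prod_mul_distrib, ← Real.exp_sum]
  refine mul_le_mul_of_nonneg_left (evol_weight_le h0 hs) ?_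
  exact Finset.prod_nonneg fun i _ => by
      have h1 : 0 < s i := by linarith [hs i]
      positivity

lemma step_abs_le {p : ι → ℝ} (h0 : ∀ i, 0 ≤ p i) (h1 : ∑ i, p i ≤ 1) {G : (ι → ℕ) → ℝ} {C : ℝ}
    (h : ∀ z, |G z| ≤ C) (z : ι → ℕ) : |step p G z| ≤ C := by
  have hc : ∀ c : ℝ, step p (fun _ => c) z = c := fun c => by simp [step]
  rw [abs_le]
  constructor
  · rw [← hc (-C)]; exact step_mono h0 h1 (fun z => (abs_le.1 (h z)).1) z
  · conv_rhs => rw [← hc C]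
    exact step_mono h0 h1 (fun z => (abs_le.1 (h z)).2) z

/-! ### Poisson approximation of the chain in an exponentially weighted norm. -/

/-- Comparison of one step of the chain with the Poisson flow run for one unit of time. -/
lemma abs_step_sub_flow_le {p δ : ι → ℝ} (hδ : ∀ i, 0 ≤ δ i) {s K : ℝ}
    {g : (ι → ℕ) → ℝ → ℝ}
    (hg : ∀ z t, HasDerivAt (g z) (∑ i, δ i * (g (z + Pi.single i 1) t - g z t)) t)
    (hK : ∀ z, ∀ t ∈ Set.Icc (0 : ℝ) 1, |g z t| ≤ K * ∏ i, s ^ z i) (z : ι → ℕ) :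
    |step p (fun z => g z 0) z - g z 1| ≤
      ((s + 1) * (∑ i, |p i - δ i|) + ((s + 1) * ∑ i, δ i) ^ 2) * (K * ∏ i, s ^ z i) := by
  set B : (ι → ℕ) → ℝ := fun z => K * ∏ i, s ^ z i with hB
  have hBs : ∀ z i, B (z + Pi.single i 1) = s * B z := fun z i => by
    simp only [hB, prod_pow_add_single (fun _ => s)]; ring
  have hdiff : ∀ z i, ∀ t ∈ Set.Icc (0 : ℝ) 1,
      |g (z + Pi.single i 1) t - g z t| ≤ (s + 1) * B z := by
    intro z i t ht
    refine (abs_sub _ _).trans ?_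
    have h1 := hK (z + Pi.single i 1) t ht
    have h2 := hK z t ht
    have h3 := hBs z i
    simp only [hB] at h3 ⊢
    rw [h3] at h1
    linarith
  -- This is the time derivative of the flow. It solves the same linear system, so bounding
  -- differences a second time controls the second derivative.
  set e : (ι → ℕ) → ℝ → ℝ := fun z t => ∑ i, δ i * (g (z + Pi.single i 1) t - g z t) with he
  have hebound : ∀ z, ∀ t ∈ Set.Icc (0 : ℝ) 1, |e z t| ≤ ((s + 1) * ∑ i, δ i) * B z := by
    intro z t ht
    refine (Finset.abs_sum_le_sum_abs _ _).trans ?_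
    rw [mul_comm (s + 1), mul_assoc, Finset.sum_mul]
    refine Finset.sum_le_sum fun i _ => ?_
    rw [abs_mul, abs_of_nonneg (hδ i)]
    exact mul_le_mul_of_nonneg_left (hdiff z i t ht) (hδ i)
  have hed : ∀ t, HasDerivAt (e z) (∑ i, δ i * (e (z + Pi.single i 1) t - e z t)) t := by
    intro t
    refine HasDerivAt.fun_sum fun i _ => ?_
    exact ((hg _ t).sub (hg _ t)).const_mul (δ i)
  have hed' : ∀ t ∈ Set.Icc (0 : ℝ) 1,
      ‖∑ i, δ i * (e (z + Pi.single i 1) t - e z t)‖ ≤ ((s + 1) * ∑ i, δ i) ^ 2 * B z := by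
    intro t ht
    refine (Finset.abs_sum_le_sum_abs _ _).trans ?_
    have : ((s + 1) * ∑ i, δ i) ^ 2 * B z = ∑ i, δ i * ((s + 1) * (((s + 1) * ∑ i, δ i) * B z)) := by
      rw [← Finset.sum_mul]; ring
    rw [this]
    refine Finset.sum_le_sum fun i _ => ?_
    rw [abs_mul, abs_of_nonneg (hδ i)]
    refine mul_le_mul_of_nonneg_left ((abs_sub _ _).trans ?_) (hδ i)
    have h1 := hebound (z + Pi.single i 1) t ht
    have h2 := hebound z t ht
    rw [hBs] at h1
    nlinarith
  have he0 : ∀ t ∈ Set.Icc (0 : ℝ) 1, ‖e z t - e z 0‖ ≤ ((s + 1) * ∑ i, δ i) ^ 2 * B z := by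
    intro t ht
    have := (convex_Icc (0 : ℝ) 1).norm_image_sub_le_of_norm_hasDerivWithin_le
      (fun t _ => (hed t).hasDerivWithinAt) hed' (Set.left_mem_Icc.2 zero_le_one) ht
    refine this.trans ?_
    have h4 : ‖t - 0‖ ≤ 1 := by
      rw [sub_zero, Real.norm_eq_abs, abs_of_nonneg ht.1]; exact ht.2
    have h5 : 0 ≤ ((s + 1) * ∑ i, δ i) ^ 2 * B z :=
      (norm_nonneg _).trans (hed' 0 (Set.left_mem_Icc.2 zero_le_one))
    exact mul_le_of_le_one_right h5 h4
  -- Second-order Taylor bound: the mean value inequality for the flow minus its linearisation at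
  -- time zero.
  have hfin : ‖(g z 1 - 1 * e z 0) - (g z 0 - 0 * e z 0)‖ ≤ ((s + 1) * ∑ i, δ i) ^ 2 * B z := by
    have := (convex_Icc (0 : ℝ) 1).norm_image_sub_le_of_norm_hasDerivWithin_le
      (f := fun t => g z t - t * e z 0) (f' := fun t => e z t - 1 * e z 0)
      (fun t _ => ((hg z t).sub ((hasDerivAt_id t).mul_const (e z 0))).hasDerivWithinAt)
      (fun t ht => by simpa using he0 t ht) (Set.left_mem_Icc.2 zero_le_one)
      (Set.right_mem_Icc.2 zero_le_one)
    simpa using this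
  have hp : |∑ i, (p i - δ i) * (g (z + Pi.single i 1) 0 - g z 0)| ≤
      (s + 1) * (∑ i, |p i - δ i|) * B z := by
    refine (Finset.abs_sum_le_sum_abs _ _).trans ?_
    rw [mul_comm (s + 1), mul_assoc, Finset.sum_mul]
    refine Finset.sum_le_sum fun i _ => ?_
    rw [abs_mul]
    exact mul_le_mul_of_nonneg_left (hdiff z i 0 (Set.left_mem_Icc.2 zero_le_one)) (abs_nonneg _)
  have hsplit : step p (fun z => g z 0) z - g z 1 =
      ∑ i, (p i - δ i) * (g (z + Pi.single i 1) 0 - g z 0) -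
        ((g z 1 - 1 * e z 0) - (g z 0 - 0 * e z 0)) := by
    simp only [step, he, sub_mul, Finset.sum_sub_distrib]
    ring
  rw [hsplit, add_mul]
  exact (abs_sub _ _).trans (add_le_add hp hfin)

lemma hasDerivAt_poissonTail_line (d : ℕ) (L δ t : ℝ) :
    HasDerivAt (fun t => poissonTail d (L + t * δ))
      (δ * (poissonTail (d - 1) (L + t * δ) - poissonTail d (L + t * δ))) t := by
  have h1 : HasDerivAt (fun t : ℝ => L + t * δ) δ t := by
    simpa using ((hasDerivAt_id t).mul_const δ).const_add L
  refine HasDerivAt.congr_deriv (HasDerivAt.comp (h₂ := poissonTail d) t (hasDerivAt_poissonTail d (L + t * δ)) h1) ?_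
  ring

lemma prod_poissonTail_sub_single (D z : ι → ℕ) (L : ι → ℝ) (i : ι) :
    ∏ j, poissonTail (D j - (z + Pi.single i 1 : ι → ℕ) j) (L j) =
      (∏ j ∈ Finset.univ.erase i, poissonTail (D j - z j) (L j)) *
        poissonTail (D i - z i - 1) (L i) := by
  rw [← Finset.prod_erase_mul _ _ (Finset.mem_univ i)]
  congr 1
  · refine Finset.prod_congr rfl fun j hj => ?_
    simp [Finset.ne_of_mem_erase hj]
  · simp [Nat.sub_sub]

/-- Raising coordinate `i` lowers the `i`-th missing count by one, which is how differentiation acts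
on the `i`-th Poisson tail. The product of tails therefore solves the flow equation of the chain. -/
lemma hasDerivAt_prod_poissonTail (D : ι → ℕ) (L δ : ι → ℝ) (z : ι → ℕ) (t : ℝ) :
    HasDerivAt (fun t => ∏ j, poissonTail (D j - z j) (L j + t * δ j))
      (∑ i, δ i * (∏ j, poissonTail (D j - (z + Pi.single i 1 : ι → ℕ) j) (L j + t * δ j) -
        ∏ j, poissonTail (D j - z j) (L j + t * δ j))) t := by
  refine HasDerivAt.congr_deriv (HasDerivAt.fun_finsetProd fun i _ =>
    hasDerivAt_poissonTail_line (D i - z i) (L i) (δ i) t) ?_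
  refine Finset.sum_congr rfl fun i _ => ?_
  rw [prod_poissonTail_sub_single D z (fun j => L j + t * δ j),
    ← Finset.prod_erase_mul Finset.univ (fun j => poissonTail (D j - z j) (L j + t * δ j))
      (Finset.mem_univ i), smul_eq_mul]
  ring

lemma prod_poissonTail_le {D z : ι → ℕ} {L : ι → ℝ} (hL : ∀ i, 0 ≤ L i) {s : ℝ} (hs : 1 ≤ s) :
    ∏ i, poissonTail (D i - z i) (L i) ≤
      ((∏ i, (s ^ D i)⁻¹) * Real.exp ((s - 1) * ∑ i, L i)) * ∏ i, s ^ z i := by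
  have hs0 : 0 < s := by linarith
  rw [Finset.mul_sum, Real.exp_sum, ← Finset.prod_mul_distrib, ← Finset.prod_mul_distrib]
  refine Finset.prod_le_prod (fun i _ => poissonTail_nonneg _ (hL i)) fun i _ => ?_
  refine (poissonTail_le _ hs (hL i)).trans ?_
  rw [mul_right_comm]
  refine mul_le_mul_of_nonneg_right ?_ (Real.exp_pos _).le
  rw [inv_mul_eq_div, le_div_iff₀ (by positivity), inv_mul_le_iff₀ (by positivity), ← pow_add]
  -- Truncated subtraction is harmless here: `D i` is at most the sum of `D i - z i` and `z i` even
  -- when `z i` exceeds `D i`.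
  exact pow_le_pow_right₀ hs (by omega)

lemma abs_step_sub_poisson_le {p δ L : ι → ℝ} (hδ : ∀ i, 0 ≤ δ i) (hL : ∀ i, 0 ≤ L i) {s : ℝ}
    (hs : 1 ≤ s) (D z : ι → ℕ) :
    |step p (fun z => ∏ i, poissonTail (D i - z i) (L i)) z -
        ∏ i, poissonTail (D i - z i) (L i + δ i)| ≤
      ((s + 1) * (∑ i, |p i - δ i|) + ((s + 1) * ∑ i, δ i) ^ 2) *
        (((∏ i, (s ^ D i)⁻¹) * Real.exp ((s - 1) * ∑ i, (L i + δ i))) * ∏ i, s ^ z i) := by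
  have hs0 : 0 < s := by linarith
  have := abs_step_sub_flow_le (p := p) hδ (s := s)
    (K := (∏ i, (s ^ D i)⁻¹) * Real.exp ((s - 1) * ∑ i, (L i + δ i)))
    (g := fun z t => ∏ j, poissonTail (D j - z j) (L j + t * δ j))
    (fun z t => hasDerivAt_prod_poissonTail D L δ z t) ?_ z
  · simpa using this
  · intro z t ht
    have hL' : ∀ i, 0 ≤ L i + t * δ i := fun i => add_nonneg (hL i) (mul_nonneg ht.1 (hδ i))
    rw [abs_of_nonneg (Finset.prod_nonneg fun i _ => poissonTail_nonneg _ (hL' i))]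
    refine (prod_poissonTail_le hL' hs).trans ?_
    refine mul_le_mul_of_nonneg_right (mul_le_mul_of_nonneg_left (Real.exp_le_exp.2 ?_) ?_) ?_
    · refine mul_le_mul_of_nonneg_left (Finset.sum_le_sum fun i _ => ?_) (by linarith)
      exact add_le_add_right (mul_le_of_le_one_left (hδ i) ht.2) _
    · exact Finset.prod_nonneg fun i _ => by positivity
    · exact Finset.prod_nonneg fun i _ => by positivity

lemma evol_abs_le {p : ℕ → ι → ℝ} {n : ℕ} (h0 : ∀ m < n, ∀ i, 0 ≤ p m i)
    (h1 : ∀ m < n, ∑ i, p m i ≤ 1) {G H : (ι → ℕ) → ℝ} (h : ∀ z, |G z| ≤ H z) (z : ι → ℕ) :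
    |evol p n G z| ≤ evol p n H z := by
  rw [abs_le]
  constructor
  · have := evol_mono h0 h1 (fun z => (abs_le.1 (h z)).1) z
    have e := evol_const_mul p n (-1) H z
    simp only [neg_one_mul] at e
    rwa [e] at this
  · exact evol_mono h0 h1 (fun z => (abs_le.1 (h z)).2) z

/-- Poisson approximation for the chain, in a norm with exponential weights. -/
lemma abs_evol_sub_poisson_le {p δ : ℕ → ι → ℝ} {n : ℕ} (h0 : ∀ m < n, ∀ i, 0 ≤ p m i)
    (h1 : ∀ m < n, ∑ i, p m i ≤ 1) (hδ : ∀ m < n, ∀ i, 0 ≤ δ m i) {L : ι → ℝ}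
    (hL : ∀ i, 0 ≤ L i) {s : ℝ} (hs : 1 ≤ s) (D : ι → ℕ) :
    |evol p n (fun z => ∏ i, poissonTail (D i - z i) (L i)) 0 -
        ∏ i, poissonTail (D i) (L i + ∑ m ∈ Finset.range n, δ m i)| ≤
      (∑ m ∈ Finset.range n,
        ((s + 1) * (∑ i, |p m i - δ m i|) + ((s + 1) * ∑ i, δ m i) ^ 2)) *
        ((∏ i, (s ^ D i)⁻¹) * Real.exp ((s - 1) * ∑ i, (L i +
          ∑ m ∈ Finset.range n, δ m i + ∑ m ∈ Finset.range n, |p m i - δ m i|))) := by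
  have hs0 : 0 < s := by linarith
  have hP : 0 ≤ ∏ i, (s ^ D i)⁻¹ := Finset.prod_nonneg fun i _ => by positivity
  induction n generalizing L with
  | zero => simp [evol]
  | succ n ih =>
    have h0' : ∀ m < n, ∀ i, 0 ≤ p m i := fun m hm => h0 m (by omega)
    have h1' : ∀ m < n, ∑ i, p m i ≤ 1 := fun m hm => h1 m (by omega)
    have hδn := hδ n (Nat.lt_succ_self n)
    have hLδ : ∀ i, 0 ≤ L i + δ n i := fun i => add_nonneg (hL i) (hδn i)
    -- The last step acts on the function first and turns the parameters `L` into `L + δ n` up to a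
    -- one-step error. This is why the induction runs over all `L`.
    have ih' := ih h0' h1' (fun m hm => hδ m (by omega)) hLδ
    set r := (s + 1) * (∑ i, |p n i - δ n i|) + ((s + 1) * ∑ i, δ n i) ^ 2 with hr
    have hr0 : 0 ≤ r := by
      have := Finset.sum_nonneg fun i (_ : i ∈ Finset.univ) => abs_nonneg (p n i - δ n i)
      positivity
    have hstep := evol_abs_le h0' h1'
      (fun z => abs_step_sub_poisson_le (p := p n) hδn hL hs D z) 0
    rw [evol_sub] at hstep
    -- The one-step error grows like the exponential weight, and the earlier steps enlarge that
    -- weight only by the exponential of their total rate.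
    have hw : evol p n (fun z => r * (((∏ i, (s ^ D i)⁻¹) *
        Real.exp ((s - 1) * ∑ i, (L i + δ n i))) * ∏ i, s ^ z i)) 0 ≤
        r * ((∏ i, (s ^ D i)⁻¹) * Real.exp ((s - 1) * ∑ i, (L i + δ n i +
          ∑ m ∈ Finset.range n, p m i))) := by
      rw [evol_const_mul, evol_const_mul]
      refine mul_le_mul_of_nonneg_left ?_ hr0
      rw [mul_assoc]
      refine mul_le_mul_of_nonneg_left ?_ hP
      refine (mul_le_mul_of_nonneg_left (evol_weight_le (s := fun _ => s) h0' fun _ => hs)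
        (Real.exp_pos _).le).trans ?_
      rw [← Real.exp_add, ← Finset.mul_sum, ← mul_add, ← Finset.sum_add_distrib]
    have hexp : ∀ X : ι → ℝ, (∀ i, X i ≤ L i + ∑ m ∈ Finset.range (n + 1), δ m i +
        ∑ m ∈ Finset.range (n + 1), |p m i - δ m i|) →
        (∏ i, (s ^ D i)⁻¹) * Real.exp ((s - 1) * ∑ i, X i) ≤
        (∏ i, (s ^ D i)⁻¹) * Real.exp ((s - 1) * ∑ i, (L i +
          ∑ m ∈ Finset.range (n + 1), δ m i + ∑ m ∈ Finset.range (n + 1), |p m i - δ m i|)) := by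
      intro X hX
      refine mul_le_mul_of_nonneg_left (Real.exp_le_exp.2 ?_) hP
      exact mul_le_mul_of_nonneg_left (Finset.sum_le_sum fun i _ => hX i) (by linarith)
    have hX1 := hexp (fun i => L i + δ n i + ∑ m ∈ Finset.range n, p m i) (by
      intro i
      have : ∑ m ∈ Finset.range n, p m i ≤
          ∑ m ∈ Finset.range n, (δ m i + |p m i - δ m i|) :=
        Finset.sum_le_sum fun m _ => by linarith [le_abs_self (p m i - δ m i)]
      rw [Finset.sum_add_distrib] at this
      rw [Finset.sum_range_succ, Finset.sum_range_succ]
      linarith [abs_nonneg (p n i - δ n i)])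
    have hX2 := hexp (fun i => L i + δ n i + ∑ m ∈ Finset.range n, δ m i +
        ∑ m ∈ Finset.range n, |p m i - δ m i|) (by
      intro i
      rw [Finset.sum_range_succ, Finset.sum_range_succ]
      linarith [abs_nonneg (p n i - δ n i)])
    have hsum0 : 0 ≤ ∑ m ∈ Finset.range n,
        ((s + 1) * (∑ i, |p m i - δ m i|) + ((s + 1) * ∑ i, δ m i) ^ 2) :=
      Finset.sum_nonneg fun m _ => by
        have := Finset.sum_nonneg fun i (_ : i ∈ Finset.univ) => abs_nonneg (p m i - δ m i)
        positivity
    have ha := hstep.trans (hw.trans (mul_le_mul_of_nonneg_left hX1 hr0))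
    have hb := ih'.trans (mul_le_mul_of_nonneg_left hX2 hsum0)
    have hc : ∀ i, L i + δ n i + ∑ m ∈ Finset.range n, δ m i =
        L i + ∑ m ∈ Finset.range (n + 1), δ m i := fun i => by
      rw [Finset.sum_range_succ]; ring
    simp only [hc] at hb
    rw [Finset.sum_range_succ (fun m => (s + 1) * (∑ i, |p m i - δ m i|) + _), add_mul]
    refine (abs_sub_le _ _ _).trans ((add_le_add ha hb).trans_eq (add_comm _ _))

/-- A Poisson variable of parameter zero vanishes, so the indicator is the flow at `L = 0`. The
approximation theorem then applies to degree events. -/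
lemma exceed_eq_prod (D z : ι → ℕ) : exceed D z = ∏ i, poissonTail (D i - z i) 0 := by
  simp only [exceed, poissonTail_at_zero, Nat.sub_eq_zero_iff_le]
  by_cases h : ∀ i, D i ≤ z i
  · rw [if_pos h, Finset.prod_congr rfl fun i _ => if_pos (h i)]; simp
  · rw [if_neg h]
    push Not at h
    obtain ⟨i, hi⟩ := h
    exact (Finset.prod_eq_zero (Finset.mem_univ i) (if_neg (not_le.2 hi))).symm

end Deterministic

end WRT

end

/-! ### The in-degrees of fixed vertices as a Markov chain given the weights. -/

noncomputable section

namespace WRT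

section Tree

set_option linter.unusedSectionVars false

variable {Ω : Type*} [mΩ : MeasurableSpace Ω] {μ : Measure Ω} [IsProbabilityMeasure μ]
  {W : ℕ → Ω → ℝ} {parent : ℕ → Ω → ℕ} {k : ℕ}

/-- The σ-algebra generated by all vertex-weights. -/
abbrev weightAlg (W : ℕ → Ω → ℝ) : MeasurableSpace Ω :=
  ⨆ i : ℕ, ⨆ _ : 1 ≤ i, MeasurableSpace.comap (W i) inferInstance

lemma weightAlg_le_history (n : ℕ) : weightAlg W ≤ history W parent n := le_sup_left

lemma IsWRT.weightAlg_le (hT : IsWRT μ W parent) : weightAlg W ≤ mΩ :=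
  iSup₂_le fun i hi => (hT.measurable_weight i hi).comap_le

lemma IsWRT.history_le (hT : IsWRT μ W parent) (n : ℕ) : history W parent n ≤ mΩ :=
  sup_le hT.weightAlg_le <| iSup₂_le fun j hj =>
    (hT.measurable_parent j (Finset.mem_Icc.1 hj).1).comap_le

lemma measurable_weight_weightAlg {i : ℕ} (hi : 1 ≤ i) : Measurable[weightAlg W] (W i) :=
  Measurable.mono (comap_measurable (W i))
    (le_iSup₂ (f := fun i (_ : 1 ≤ i) => MeasurableSpace.comap (W i) inferInstance) i hi) le_rfl

lemma measurable_totalWeight_weightAlg (n : ℕ) : Measurable[weightAlg W] (totalWeight W n) := by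
  unfold totalWeight
  exact Finset.measurable_fun_sum _ fun i hi => measurable_weight_weightAlg (Finset.mem_Icc.1 hi).1

lemma measurable_parent_history {n j : ℕ} (hj : j ∈ Finset.Icc 2 n) :
    Measurable[history W parent n] (parent j) :=
  Measurable.mono (comap_measurable (parent j))
    ((le_iSup₂ (f := fun j (_ : j ∈ Finset.Icc 2 n) =>
      MeasurableSpace.comap (parent j) inferInstance) j hj).trans le_sup_right) le_rfl

lemma inDegree_eq_sum (n i : ℕ) (ω : Ω) :
    inDegree parent n i ω = ∑ j ∈ Finset.Icc 2 n, if parent j ω = i then 1 else 0 := by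
  rw [inDegree, Finset.card_filter]

lemma measurable_inDegree_history (n i : ℕ) :
    Measurable[history W parent n] (inDegree parent n i) := by
  have : inDegree parent n i = fun ω => ∑ j ∈ Finset.Icc 2 n, if parent j ω = i then 1 else 0 := by
    ext ω; exact inDegree_eq_sum n i ω
  rw [this]
  refine Finset.measurable_fun_sum _ fun j hj => ?_
  exact Measurable.ite (measurable_parent_history hj (measurableSet_singleton i))
    measurable_const measurable_const

lemma inDegree_succ {n : ℕ} (hn : 1 ≤ n) (i : ℕ) (ω : Ω) :
    inDegree parent (n + 1) i ω =
      inDegree parent n i ω + if parent (n + 1) ω = i then 1 else 0 := by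
  rw [inDegree_eq_sum, inDegree_eq_sum, Finset.sum_Icc_succ_top (by omega)]

lemma inDegree_one (i : ℕ) (ω : Ω) : inDegree parent 1 i ω = 0 := by
  simp [inDegree]

lemma IsWRT.ae_weight_pos (hT : IsWRT μ W parent) : ∀ᵐ ω ∂μ, ∀ i, 1 ≤ i → 0 < W i ω := by
  rw [ae_all_iff]
  intro i
  by_cases hi : 1 ≤ i
  · filter_upwards [hT.weight_pos i hi] with ω h _ using h
  · exact Eventually.of_forall fun ω h => absurd h hi

lemma totalWeight_pos {ω : Ω} (h : ∀ i, 1 ≤ i → 0 < W i ω) {n : ℕ} (hn : 1 ≤ n) :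
    0 < totalWeight W n ω :=
  Finset.sum_pos (fun i hi => h i (Finset.mem_Icc.1 hi).1) ⟨1, Finset.mem_Icc.2 ⟨le_rfl, hn⟩⟩

/-- Integrating against the event that vertex `n + 1` is attached to `i`. -/
lemma IsWRT.integral_attach_mul (hT : IsWRT μ W parent) {n i : ℕ} (hn : 1 ≤ n)
    (hi : i ∈ Finset.Icc 1 n) {X : Ω → ℝ} (hX : Measurable[history W parent n] X) {C : ℝ}
    (hC : ∀ᵐ ω ∂μ, |X ω| ≤ C) :
    ∫ ω, X ω * Set.indicator {ω | parent (n + 1) ω = i} (fun _ => (1 : ℝ)) ω ∂μ =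
      ∫ ω, X ω * (W i ω / totalWeight W n ω) ∂μ := by
  have hm := hT.history_le n
  have hS : MeasurableSet {ω | parent (n + 1) ω = i} :=
    hT.measurable_parent (n + 1) (by omega) (measurableSet_singleton i)
  have hint : Integrable (Set.indicator {ω | parent (n + 1) ω = i} (fun _ => (1 : ℝ))) μ :=
    (integrable_const 1).indicator hS
  have hXint : Integrable
      (X * Set.indicator {ω | parent (n + 1) ω = i} (fun _ => (1 : ℝ))) μ :=
    hint.bdd_mul (hX.mono hm le_rfl).aestronglyMeasurable hC
  have h1 := condExp_mul_of_stronglyMeasurable_left (m := history W parent n)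
    hX.stronglyMeasurable hXint hint
  calc ∫ ω, X ω * Set.indicator {ω | parent (n + 1) ω = i} (fun _ => (1 : ℝ)) ω ∂μ
      = ∫ ω, (μ[X * Set.indicator {ω | parent (n + 1) ω = i} (fun _ => (1 : ℝ))
          | history W parent n]) ω ∂μ := (integral_condExp hm).symm
    _ = _ := by
      refine integral_congr_ae ?_
      filter_upwards [h1, hT.attach n hn i hi] with ω h1 h2
      rw [h1, Pi.mul_apply, h2]

/-- The prescribed probabilities of attaching to 1, …, n add up to one, so no mass is left for other
values of the parent. -/
lemma IsWRT.ae_parent_mem (hT : IsWRT μ W parent) {n : ℕ} (hn : 1 ≤ n) :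
    ∀ᵐ ω ∂μ, parent (n + 1) ω ∈ Finset.Icc 1 n := by
  have hmeas := hT.measurable_parent (n + 1) (by omega)
  have hS : ∀ i, MeasurableSet {ω | parent (n + 1) ω = i} := fun i =>
    hmeas (measurableSet_singleton i)
  have key : ∀ i ∈ Finset.Icc 1 n,
      ∫ ω, Set.indicator {ω | parent (n + 1) ω = i} (fun _ => (1 : ℝ)) ω ∂μ =
      ∫ ω, W i ω / totalWeight W n ω ∂μ := by
    intro i hi
    have := hT.integral_attach_mul hn hi (X := fun _ => 1) measurable_const
      (C := 1) (Eventually.of_forall fun _ => by simp)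
    simpa using this
  have hint : ∀ i ∈ Finset.Icc 1 n, Integrable (fun ω => W i ω / totalWeight W n ω) μ := by
    intro i hi
    refine Integrable.of_bound (C := 1) ?_ ?_
    · exact (((measurable_weight_weightAlg (Finset.mem_Icc.1 hi).1).div
        (measurable_totalWeight_weightAlg n)).mono hT.weightAlg_le le_rfl).aestronglyMeasurable
    · filter_upwards [hT.ae_weight_pos] with ω h
      have hp := totalWeight_pos h hn
      have hi1 := Finset.mem_Icc.1 hi
      rw [Real.norm_eq_abs, abs_of_nonneg (div_nonneg (h i hi1.1).le hp.le), div_le_one hp]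
      exact Finset.single_le_sum (f := fun i => W i ω)
        (fun j hj => (h j (Finset.mem_Icc.1 hj).1).le) hi
  have hsum : ∑ i ∈ Finset.Icc 1 n, μ.real {ω | parent (n + 1) ω = i} = 1 := by
    have : ∀ i ∈ Finset.Icc 1 n, μ.real {ω | parent (n + 1) ω = i} =
        ∫ ω, W i ω / totalWeight W n ω ∂μ := by
      intro i hi
      rw [← key i hi, integral_indicator_const _ (hS i)]; simp
    rw [Finset.sum_congr rfl this, ← integral_finsetSum _ hint]
    have h1 : ∫ ω, ∑ i ∈ Finset.Icc 1 n, W i ω / totalWeight W n ω ∂μ = ∫ ω, (1 : ℝ) ∂μ := by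
      refine integral_congr_ae ?_
      filter_upwards [hT.ae_weight_pos] with ω h
      have hp := totalWeight_pos h hn
      rw [← Finset.sum_div]
      exact div_self hp.ne'
    rw [h1]; simp
  have hU : μ.real {ω | parent (n + 1) ω ∈ Finset.Icc 1 n} = 1 := by
    rw [← hsum, ← measureReal_biUnion_finset]
    · congr 1; ext ω; simp
    · intro i _ j _ hij
      exact Set.disjoint_left.2 fun ω h1 h2 => hij (h1.symm.trans h2)
    · exact fun i _ => hS i
  have hms : MeasurableSet {ω | parent (n + 1) ω ∈ Finset.Icc 1 n} :=
    hmeas (Finset.measurableSet _)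
  rw [measureReal_def, ENNReal.toReal_eq_one_iff] at hU
  exact (prob_compl_eq_zero_iff hms).2 hU

/-- The conditional probability that vertex `n + 1` is attached to the vertex `a i`. -/
def attachProb (W : ℕ → Ω → ℝ) (a : Fin k → ℕ) (ω : Ω) (n : ℕ) (i : Fin k) : ℝ :=
  if a i ≤ n then W (a i) ω / totalWeight W n ω else 0

lemma attachProb_nonneg {ω : Ω} (h : ∀ i, 1 ≤ i → 0 < W i ω) {a : Fin k → ℕ} (ha : ∀ i, 1 ≤ a i)
    (n : ℕ) (i : Fin k) : 0 ≤ attachProb W a ω n i := by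
  unfold attachProb
  split_ifs with hi
  · exact div_nonneg (h _ (ha i)).le (totalWeight_pos h ((ha i).trans hi)).le
  · exact le_rfl

lemma sum_attachProb_le_one {ω : Ω} (h : ∀ i, 1 ≤ i → 0 < W i ω) {a : Fin k → ℕ}
    (ha : ∀ i, 1 ≤ a i) (hinj : Function.Injective a) (n : ℕ) :
    ∑ i, attachProb W a ω n i ≤ 1 := by
  rcases Nat.eq_zero_or_pos n with rfl | hn
  · have : ∀ i, attachProb W a ω 0 i = 0 := fun i => if_neg (by have := ha i; omega)
    simp [this]
  · have hp := totalWeight_pos h hn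
    have h1 : ∑ i, attachProb W a ω n i =
        (∑ i ∈ Finset.univ.filter (fun i => a i ≤ n), W (a i) ω) / totalWeight W n ω := by
      rw [Finset.sum_div, Finset.sum_filter]; rfl
    rw [h1, div_le_one hp, totalWeight, ← Finset.sum_image (f := fun j => W j ω) hinj.injOn]
    refine Finset.sum_le_sum_of_subset_of_nonneg ?_ fun j hj _ =>
      (h j (Finset.mem_Icc.1 hj).1).le
    intro j hj
    obtain ⟨i, hi, rfl⟩ := Finset.mem_image.1 hj
    exact Finset.mem_Icc.2 ⟨ha i, (Finset.mem_filter.1 hi).2⟩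

lemma measurable_attachProb {a : Fin k → ℕ} (ha : ∀ i, 1 ≤ a i) (n : ℕ) (i : Fin k) :
    Measurable[weightAlg W] (fun ω => attachProb W a ω n i) := by
  unfold attachProb
  split_ifs
  · exact (measurable_weight_weightAlg (ha i)).div (measurable_totalWeight_weightAlg n)
  · exact measurable_const

lemma measurable_step {a : Fin k → ℕ} (ha : ∀ i, 1 ≤ a i) (n : ℕ) {G : (Fin k → ℕ) → Ω → ℝ}
    (hG : ∀ z, Measurable[weightAlg W] (G z)) (z : Fin k → ℕ) :
    Measurable[weightAlg W] (fun ω => step (attachProb W a ω n) (fun z => G z ω) z) := by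
  unfold step
  exact (hG z).add (Finset.measurable_fun_sum _ fun i _ =>
    (measurable_attachProb ha n i).mul ((hG _).sub (hG _)))

lemma measurable_evol {a : Fin k → ℕ} (ha : ∀ i, 1 ≤ a i) (n : ℕ) {G : (Fin k → ℕ) → Ω → ℝ}
    (hG : ∀ z, Measurable[weightAlg W] (G z)) (z : Fin k → ℕ) :
    Measurable[weightAlg W] (fun ω => evol (attachProb W a ω) n (fun z => G z ω) z) := by
  induction n generalizing G with
  | zero => exact hG z
  | succ n ih => exact ih (measurable_step ha n hG)

lemma measurable_comp_countable {m : MeasurableSpace Ω} {G : (Fin k → ℕ) → Ω → ℝ}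
    (hG : ∀ z, Measurable[m] (G z)) {Z : Ω → Fin k → ℕ} (hZ : Measurable[m] Z) :
    Measurable[m] (fun ω => G (Z ω) ω) := by
  have : Measurable (fun q : (Fin k → ℕ) × Ω => G q.1 q.2) :=
    measurable_from_prod_countable_right fun z => hG z
  exact this.comp (hZ.prodMk measurable_id)

/-- The in-degrees of the vertices `a i` in the tree on `1, …, n`. -/
def degrees (parent : ℕ → Ω → ℕ) (a : Fin k → ℕ) (n : ℕ) (ω : Ω) : Fin k → ℕ :=
  fun i => inDegree parent n (a i) ω

lemma measurable_degrees_history (a : Fin k → ℕ) (n : ℕ) :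
    Measurable[history W parent n] (degrees parent a n) :=
  (@measurable_pi_iff _ _ _ (history W parent n) _ _).2 fun i => measurable_inDegree_history n (a i)

/-- By injectivity of `a`, the new vertex raises at most one of the tracked degrees, and
conditioning on the history replaces the indicator of each rise by its probability. The test
function may depend on the weights, so the averaged function is again of the same kind and the step
can be iterated. -/
lemma IsWRT.integral_degrees_succ (hT : IsWRT μ W parent) {a : Fin k → ℕ} (ha : ∀ i, 1 ≤ a i)
    (hinj : Function.Injective a) {n : ℕ} (hn : 1 ≤ n) {G : (Fin k → ℕ) → Ω → ℝ}
    (hG : ∀ z, Measurable[weightAlg W] (G z)) {C : ℝ} (hC : ∀ᵐ ω ∂μ, ∀ z, |G z ω| ≤ C) :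
    ∫ ω, G (degrees parent a (n + 1) ω) ω ∂μ =
      ∫ ω, step (attachProb W a ω n) (fun z => G z ω) (degrees parent a n ω) ∂μ := by
  have hGh : ∀ z, Measurable[history W parent n] (G z) := fun z =>
    (hG z).mono (weightAlg_le_history n) le_rfl
  set Z := degrees parent a n with hZ
  have hZm : Measurable[history W parent n] Z := measurable_degrees_history a n
  have hX0m : Measurable[history W parent n] (fun ω => G (Z ω) ω) :=
    measurable_comp_countable hGh hZm
  set X : Fin k → Ω → ℝ := fun i ω => G (Z ω + Pi.single i 1) ω - G (Z ω) ω with hX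
  have hXm : ∀ i, Measurable[history W parent n] (X i) := fun i =>
    (measurable_comp_countable (G := fun z ω => G (z + Pi.single i 1) ω) (fun z => hGh _) hZm).sub
      hX0m
  have hXC : ∀ i, ∀ᵐ ω ∂μ, |X i ω| ≤ 2 * C := fun i => by
    filter_upwards [hC] with ω h
    refine (abs_sub _ _).trans ?_
    linarith [h (Z ω + Pi.single i 1), h (Z ω)]
  have hm := hT.history_le n
  have hint0 : Integrable (fun ω => G (Z ω) ω) μ :=
    Integrable.of_bound (C := C) (hX0m.mono hm le_rfl).aestronglyMeasurable
      (by filter_upwards [hC] with ω h using h _)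
  have hS : ∀ j, MeasurableSet {ω | parent (n + 1) ω = j} := fun j =>
    hT.measurable_parent (n + 1) (by omega) (measurableSet_singleton j)
  have hint1 : ∀ i, Integrable (fun ω => X i ω *
      Set.indicator {ω | parent (n + 1) ω = a i} (fun _ => (1 : ℝ)) ω) μ := fun i =>
    Integrable.bdd_mul ((integrable_const 1).indicator (hS _))
      ((hXm i).mono hm le_rfl).aestronglyMeasurable (hXC i)
  have hint2 : ∀ i, Integrable (fun ω => attachProb W a ω n i * X i ω) μ := fun i => by
    refine Integrable.of_bound (C := 2 * C) (((measurable_attachProb ha n i).mono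
      hT.weightAlg_le le_rfl).mul ((hXm i).mono hm le_rfl)).aestronglyMeasurable ?_
    filter_upwards [hT.ae_weight_pos, hXC i] with ω h1 h2
    have h3 := attachProb_nonneg h1 ha n i
    have h4 : attachProb W a ω n i ≤ 1 :=
      (Finset.single_le_sum (f := fun i => attachProb W a ω n i)
        (fun j _ => attachProb_nonneg h1 ha n j) (Finset.mem_univ i)).trans
        (sum_attachProb_le_one h1 ha hinj n)
    rw [Real.norm_eq_abs, abs_mul, abs_of_nonneg h3]
    exact (mul_le_of_le_one_left (abs_nonneg _) h4).trans h2
  have hL : ∫ ω, G (degrees parent a (n + 1) ω) ω ∂μ = ∫ ω, (G (Z ω) ω + ∑ i, X i ω *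
      Set.indicator {ω | parent (n + 1) ω = a i} (fun _ => (1 : ℝ)) ω) ∂μ := by
    refine integral_congr_ae (Eventually.of_forall fun ω => ?_)
    simp only
    by_cases hex : ∃ i, parent (n + 1) ω = a i
    · obtain ⟨i, hi⟩ := hex
      have h1 : degrees parent a (n + 1) ω = Z ω + Pi.single i 1 := by
        ext j
        simp only [degrees, hZ, Pi.add_apply, inDegree_succ hn, hi, hinj.eq_iff, Pi.single_apply]
        by_cases hij : i = j
        · simp [hij]
        · simp [hij, Ne.symm hij]
      rw [h1, Finset.sum_eq_single i]
      · simp [hi, hX]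
      · intro j _ hj
        rw [Set.indicator_of_notMem, mul_zero]
        simp only [Set.mem_ofPred_eq, hi]
        exact fun h => hj (hinj h).symm
      · simp
    · push Not at hex
      have h1 : degrees parent a (n + 1) ω = Z ω := by
        ext j
        simp [degrees, hZ, inDegree_succ hn, hex j]
      rw [h1, Finset.sum_eq_zero, add_zero]
      intro j _
      rw [Set.indicator_of_notMem, mul_zero]
      exact hex j
  rw [hL, integral_add hint0 (integrable_finsetSum _ fun i _ => hint1 i),
    integral_finsetSum _ fun i _ => hint1 i]
  unfold step
  rw [integral_add hint0 (integrable_finsetSum _ fun i _ => hint2 i),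
    integral_finsetSum _ fun i _ => hint2 i]
  congr 1
  refine Finset.sum_congr rfl fun i _ => ?_
  by_cases hi : a i ≤ n
  · rw [hT.integral_attach_mul hn (Finset.mem_Icc.2 ⟨ha i, hi⟩) (hXm i) (hXC i)]
    refine integral_congr_ae (Eventually.of_forall fun ω => ?_)
    simp only [attachProb, if_pos hi]
    ring
  -- Vertex `a i` is not born yet: its rate is zero by definition, and almost surely nothing
  -- attaches to it.
  · refine integral_congr_ae ?_
    filter_upwards [hT.ae_parent_mem hn] with ω h
    rw [Set.indicator_of_notMem, attachProb, if_neg hi]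
    · ring
    · simp only [Set.mem_ofPred_eq]
      intro h'
      rw [h'] at h
      exact hi (Finset.mem_Icc.1 h).2

/-- Given the weights, the in-degrees of finitely many vertices evolve as a Markov chain. -/
lemma IsWRT.integral_degrees (hT : IsWRT μ W parent) {a : Fin k → ℕ} (ha : ∀ i, 1 ≤ a i)
    (hinj : Function.Injective a) {n : ℕ} (hn : 1 ≤ n) {G : (Fin k → ℕ) → Ω → ℝ}
    (hG : ∀ z, Measurable[weightAlg W] (G z)) {C : ℝ} (hC : ∀ᵐ ω ∂μ, ∀ z, |G z ω| ≤ C) :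
    ∫ ω, G (degrees parent a n ω) ω ∂μ =
      ∫ ω, evol (attachProb W a ω) n (fun z => G z ω) 0 ∂μ := by
  induction n, hn using Nat.le_induction generalizing G with
  | base =>
    refine integral_congr_ae (Eventually.of_forall fun ω => ?_)
    have h1 : degrees parent a 1 ω = 0 := by ext i; simp [degrees, inDegree_one]
    -- Step `m` of the chain is the arrival of vertex `m + 1`, so step 0 must be idle. It is,
    -- because every `a i` is at least 1.
    have h2 : ∀ i, attachProb W a ω 0 i = 0 := fun i => if_neg (by have := ha i; omega)
    simp [h1, evol, step, h2]
  | succ n hn ih =>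
    rw [hT.integral_degrees_succ ha hinj hn hG hC]
    refine ih (measurable_step ha n hG) ?_
    filter_upwards [hC, hT.ae_weight_pos] with ω h1 h2 z
    exact step_abs_le (attachProb_nonneg h2 ha n) (sum_attachProb_le_one h2 ha hinj n) h1 z

end Tree

end WRT

end

/-! ### Error bounds for the chain in a fixed weight environment. -/

noncomputable section

namespace WRT

section Weights

/-- `∑ m ≥ 0, m ^ (-9/8)`. -/
def zetaConst : ℝ := ∑' m : ℕ, (m : ℝ) ^ (-(9 / 8) : ℝ)

lemma zetaConst_nonneg : 0 ≤ zetaConst := tsum_nonneg fun m => by positivity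

/-- The exponent 5/4 is split as 9/8 + 1/8: the first part is summable and the second is monotone.
This is the origin of the gain `A ^ (-1/8)` in the later error bounds. -/
lemma sum_Ico_rpow_le {A : ℕ} (hA : 1 ≤ A) (N : ℕ) :
    ∑ m ∈ Finset.Ico A N, (m : ℝ) ^ (-(5 / 4) : ℝ) ≤ zetaConst * (A : ℝ) ^ (-(1 / 8) : ℝ) := by
  have hsum : Summable fun m : ℕ => (m : ℝ) ^ (-(9 / 8) : ℝ) :=
    Real.summable_nat_rpow.2 (by norm_num)
  calc ∑ m ∈ Finset.Ico A N, (m : ℝ) ^ (-(5 / 4) : ℝ)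
      ≤ ∑ m ∈ Finset.Ico A N, (m : ℝ) ^ (-(9 / 8) : ℝ) * (A : ℝ) ^ (-(1 / 8) : ℝ) := by
        refine Finset.sum_le_sum fun m hm => ?_
        have hm' := Finset.mem_Ico.1 hm
        have hA0 : (0 : ℝ) < A := by exact_mod_cast hA
        have hAm : (A : ℝ) ≤ m := by exact_mod_cast hm'.1
        have hm0 : (0 : ℝ) < m := hA0.trans_le hAm
        have : (m : ℝ) ^ (-(5 / 4) : ℝ) =
            (m : ℝ) ^ (-(9 / 8) : ℝ) * (m : ℝ) ^ (-(1 / 8) : ℝ) := by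
          rw [← Real.rpow_add hm0]; norm_num
        rw [this]
        exact mul_le_mul_of_nonneg_left
          (Real.rpow_le_rpow_of_nonpos hA0 hAm (by norm_num)) (by positivity)
    _ ≤ zetaConst * (A : ℝ) ^ (-(1 / 8) : ℝ) := by
        rw [← Finset.sum_mul]
        exact mul_le_mul_of_nonneg_right
          (hsum.sum_le_tsum _ fun m _ => by positivity) (by positivity)

lemma log_succ_sub_log_bounds {m : ℕ} (hm : 1 ≤ m) :
    0 ≤ Real.log ((m + 1 : ℕ) : ℝ) - Real.log m ∧
    Real.log ((m + 1 : ℕ) : ℝ) - Real.log m ≤ 1 / m ∧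
    1 / m - (Real.log ((m + 1 : ℕ) : ℝ) - Real.log m) ≤ 1 / (m : ℝ) ^ 2 := by
  have hm0 : (0 : ℝ) < m := by exact_mod_cast hm
  have e : Real.log ((m + 1 : ℕ) : ℝ) - Real.log m = Real.log (1 + 1 / m) := by
    rw [← Real.log_div (by positivity) hm0.ne']
    congr 1; push_cast; field_simp
  have h1 : 0 < 1 / (m : ℝ) := by positivity
  rw [e]
  refine ⟨Real.log_nonneg (by linarith), ?_, ?_⟩
  · have := Real.log_le_sub_one_of_pos (show (0 : ℝ) < 1 + 1 / m by positivity)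
    linarith
  · have := Real.one_sub_inv_le_log_of_pos (show (0 : ℝ) < 1 + 1 / m by positivity)
    have h2 : 1 / (m : ℝ) - (1 - (1 + 1 / (m : ℝ))⁻¹) ≤ 1 / (m : ℝ) ^ 2 := by
      have : 1 / (m : ℝ) - (1 - (1 + 1 / (m : ℝ))⁻¹) = 1 / (m * (m + 1)) := by
        field_simp; ring
      rw [this]
      exact one_div_le_one_div_of_le (by positivity) (by nlinarith)
    linarith

/-- The attachment rate of a vertex of weight `u` is close to that of its Poisson approximation. -/
lemma abs_rate_sub_le {w M u S : ℝ} (hw : 0 < w) (hM : 0 < M) (hu0 : 0 ≤ u) (hu1 : u ≤ 1) {m : ℕ}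
    (hm : 1 ≤ m) (hS : w * m ≤ S) (hSM : |S - m * M| ≤ (m : ℝ) ^ (3 / 4 : ℝ)) :
    |u / S - u / M * (Real.log ((m + 1 : ℕ) : ℝ) - Real.log m)| ≤
      (1 / w + 1) / M * (m : ℝ) ^ (-(5 / 4) : ℝ) := by
  have hm0 : (0 : ℝ) < m := by exact_mod_cast hm
  have hm1 : (1 : ℝ) ≤ m := by exact_mod_cast hm
  have hS0 : 0 < S := lt_of_lt_of_le (by positivity) hS
  obtain ⟨-, h2, h3⟩ := log_succ_sub_log_bounds hm
  set l := Real.log ((m + 1 : ℕ) : ℝ) - Real.log m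
  -- Two sources of error: the fluctuation of `S`, of order m ^ (3/4) / m² = m ^ (-5/4), and the
  -- replacement of 1 / m by a logarithmic increment, of order m ^ (-2).
  have e : u / S - u / M * l = u * ((1 / S - 1 / (m * M)) + (1 / M) * (1 / m - l)) := by
    field_simp; ring
  have h4 : |1 / S - 1 / (m * M)| ≤ (1 / w) / M * (m : ℝ) ^ (-(5 / 4) : ℝ) := by
    have : 1 / S - 1 / (m * M) = (m * M - S) / (S * (m * M)) := by field_simp
    rw [this, abs_div, abs_sub_comm, abs_of_pos (show 0 < S * (m * M) by positivity),
      div_le_iff₀ (by positivity)]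
    refine hSM.trans ?_
    have e2 : (m : ℝ) ^ (3 / 4 : ℝ) = (m : ℝ) ^ (-(5 / 4) : ℝ) * (m * m) := by
      rw [← sq, ← Real.rpow_natCast, ← Real.rpow_add hm0]; norm_num
    rw [e2]
    have hp : 0 ≤ (m : ℝ) ^ (-(5 / 4) : ℝ) := by positivity
    have : (m : ℝ) * m ≤ 1 / w / M * (S * (m * M)) := by
      have : 1 / w / M * (S * (m * M)) = m * (S / w) := by field_simp
      rw [this]
      exact mul_le_mul_of_nonneg_left (by rw [le_div_iff₀ hw]; linarith) hm0.le
    nlinarith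
  have h5 : |(1 / M) * (1 / m - l)| ≤ 1 / M * (m : ℝ) ^ (-(5 / 4) : ℝ) := by
    rw [abs_of_nonneg (mul_nonneg (by positivity) (by linarith))]
    refine mul_le_mul_of_nonneg_left (h3.trans ?_) (by positivity)
    rw [one_div, ← Real.rpow_natCast, ← Real.rpow_neg hm0.le]
    exact Real.rpow_le_rpow_of_exponent_le hm1 (by norm_num)
  rw [e, abs_mul, abs_of_nonneg hu0]
  calc u * |1 / S - 1 / (m * M) + 1 / M * (1 / m - l)|
      ≤ |1 / S - 1 / (m * M) + 1 / M * (1 / m - l)| :=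
        mul_le_of_le_one_left (abs_nonneg _) hu1
    _ ≤ _ := abs_add_le _ _
    _ ≤ (1 / w) / M * (m : ℝ) ^ (-(5 / 4) : ℝ) + 1 / M * (m : ℝ) ^ (-(5 / 4) : ℝ) :=
        add_le_add h4 h5
    _ = _ := by ring

variable {k : ℕ}

/-- The attachment probabilities in a fixed environment. -/
def rate (u : Fin k → ℝ) (S : ℕ → ℝ) (a : Fin k → ℕ) (m : ℕ) (i : Fin k) : ℝ :=
  if a i ≤ m then u i / S m else 0

/-- The increments of the parameters of the approximating Poisson variables. -/
def logRate (u : Fin k → ℝ) (M : ℝ) (a : Fin k → ℕ) (m : ℕ) (i : Fin k) : ℝ :=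
  if a i ≤ m then u i / M * (Real.log ((m + 1 : ℕ) : ℝ) - Real.log m) else 0

lemma sum_range_ite_le {b N : ℕ} (f : ℕ → ℝ) :
    ∑ m ∈ Finset.range N, (if b ≤ m then f m else 0) = ∑ m ∈ Finset.Ico b N, f m := by
  rw [← Finset.sum_filter]
  congr 1; ext m; simp [and_comm]

lemma sum_logRate {u : Fin k → ℝ} {M : ℝ} {a : Fin k → ℕ} {N : ℕ} {i : Fin k} (ha : 1 ≤ a i)
    (haN : a i ≤ N) :
    ∑ m ∈ Finset.range N, logRate u M a m i = u i / M * Real.log (N / a i) := by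
  unfold logRate
  rw [sum_range_ite_le, ← Finset.mul_sum, Finset.sum_Ico_sub (fun m : ℕ => Real.log (m : ℝ)) haN,
    Real.log_div]
  · norm_cast; omega
  · norm_cast; omega

lemma logRate_nonneg {u : Fin k → ℝ} (hu : ∀ i, 0 ≤ u i) {M : ℝ} (hM : 0 < M) {a : Fin k → ℕ}
    (ha : ∀ i, 1 ≤ a i) (m : ℕ) (i : Fin k) : 0 ≤ logRate u M a m i := by
  unfold logRate
  split_ifs with h
  · exact mul_nonneg (div_nonneg (hu i) hM.le) (log_succ_sub_log_bounds ((ha i).trans h)).1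
  · exact le_rfl

/-- Environments in which the partial sums of the weights behave as expected from time `A` on. -/
structure GoodEnv (w M : ℝ) (u : Fin k → ℝ) (S : ℕ → ℝ) (A N : ℕ) : Prop where
  u_nonneg : ∀ i, 0 ≤ u i
  u_le : ∀ i, u i ≤ 1
  le_S : ∀ m, w * m ≤ S m
  dev : ∀ m, A ≤ m → m < N → |S m - m * M| ≤ (m : ℝ) ^ (3 / 4 : ℝ)

/-- A bound for the total error in the attachment rates. -/
def rateConst (w M : ℝ) : ℝ := (1 / w + 1) / M * zetaConst

lemma rateConst_nonneg {w M : ℝ} (hw : 0 < w) (hM : 0 < M) : 0 ≤ rateConst w M :=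
  mul_nonneg (by positivity) zetaConst_nonneg

lemma GoodEnv.sum_abs_le {w M : ℝ} {u : Fin k → ℝ} {S : ℕ → ℝ} {A N : ℕ}
    (hE : GoodEnv w M u S A N) (hw : 0 < w) (hM : 0 < M) (hA : 1 ≤ A) {b : ℕ} (hb : A ≤ b)
    (i : Fin k) :
    ∑ m ∈ Finset.Ico b N, |u i / S m - u i / M * (Real.log ((m + 1 : ℕ) : ℝ) - Real.log m)| ≤
      rateConst w M * (A : ℝ) ^ (-(1 / 8) : ℝ) := by
  calc ∑ m ∈ Finset.Ico b N, |u i / S m - u i / M * (Real.log ((m + 1 : ℕ) : ℝ) - Real.log m)|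
      ≤ ∑ m ∈ Finset.Ico b N, (1 / w + 1) / M * (m : ℝ) ^ (-(5 / 4) : ℝ) := by
        refine Finset.sum_le_sum fun m hm => ?_
        have hm' := Finset.mem_Ico.1 hm
        exact abs_rate_sub_le hw hM (hE.u_nonneg i) (hE.u_le i) (by omega) (hE.le_S m)
          (hE.dev m (by omega) hm'.2)
    _ ≤ ∑ m ∈ Finset.Ico A N, (1 / w + 1) / M * (m : ℝ) ^ (-(5 / 4) : ℝ) :=
        Finset.sum_le_sum_of_subset_of_nonneg (Finset.Ico_subset_Ico_left hb)
          fun m _ _ => by positivity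
    _ ≤ _ := by
        rw [← Finset.mul_sum, rateConst, mul_assoc]
        exact mul_le_mul_of_nonneg_left (sum_Ico_rpow_le hA N) (by positivity)

lemma rpow_neg_le_one {A : ℕ} (hA : 1 ≤ A) : (A : ℝ) ^ (-(1 / 8) : ℝ) ≤ 1 :=
  Real.rpow_le_one_of_one_le_of_nonpos (by exact_mod_cast hA) (by norm_num)

lemma GoodEnv.sum_abs_rate_sub_le {w M : ℝ} {u : Fin k → ℝ} {S : ℕ → ℝ} {A N : ℕ}
    (hE : GoodEnv w M u S A N) (hw : 0 < w) (hM : 0 < M) (hA : 1 ≤ A) {a : Fin k → ℕ}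
    {i : Fin k} (ha : A ≤ a i) :
    ∑ m ∈ Finset.range N, |rate u S a m i - logRate u M a m i| ≤
      rateConst w M * (A : ℝ) ^ (-(1 / 8) : ℝ) := by
  refine le_trans (le_of_eq ?_) (hE.sum_abs_le hw hM hA ha i)
  rw [← sum_range_ite_le]
  refine Finset.sum_congr rfl fun m _ => ?_
  unfold rate logRate
  split_ifs <;> simp

/-- The reason for the Chernoff parameter s = 1 + M: then s - 1 cancels the 1 / M in the Poisson
parameter, and weights at most 1 leave the simple factor `N / b`. -/
lemma GoodEnv.exp_rate_le {w M : ℝ} {u : Fin k → ℝ} {S : ℕ → ℝ} {A N : ℕ}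
    (hE : GoodEnv w M u S A N) (hM : 0 < M) {b : ℕ} (hb : 1 ≤ b) (hbN : b ≤ N) (i : Fin k) :
    Real.exp (M * (u i / M * Real.log (N / b))) ≤ N / b := by
  have hb0 : (0 : ℝ) < b := by exact_mod_cast hb
  have h1 : (1 : ℝ) ≤ N / b := by rw [one_le_div hb0]; exact_mod_cast hbN
  have e : M * (u i / M * Real.log (N / b)) = u i * Real.log (N / b) := by field_simp
  rw [e]
  refine (Real.exp_le_exp.2 (mul_le_of_le_one_left (Real.log_nonneg h1) (hE.u_le i))).trans ?_
  rw [Real.exp_log (by linarith)]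

/-- The constant in the Poisson approximation. -/
def approxConst (k : ℕ) (w M : ℝ) : ℝ :=
  ((M + 2) * (k * rateConst w M) + ((M + 2) * (k * (1 / M))) ^ 2 * zetaConst) *
    Real.exp (M * (k * rateConst w M))

/-- Poisson approximation of the in-degrees of late vertices in a good environment. -/
lemma GoodEnv.abs_evol_sub_le {w M : ℝ} {u : Fin k → ℝ} {S : ℕ → ℝ} {A N : ℕ}
    (hE : GoodEnv w M u S A N) (hw : 0 < w) (hM : 0 < M) (hA : 1 ≤ A) {a : Fin k → ℕ}
    (ha : ∀ i, A ≤ a i) (haN : ∀ i, a i ≤ N) (h0 : ∀ m i, 0 ≤ rate u S a m i)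
    (h1 : ∀ m, ∑ i, rate u S a m i ≤ 1) (D : Fin k → ℕ) :
    |evol (rate u S a) N (exceed D) 0 -
        ∏ i, poissonTail (D i) (u i / M * Real.log (N / a i))| ≤
      approxConst k w M * (A : ℝ) ^ (-(1 / 8) : ℝ) *
        ∏ i, (((1 + M) ^ D i)⁻¹ * (N / a i)) := by
  have ha1 : ∀ i, 1 ≤ a i := fun i => hA.trans (ha i)
  have hδ := logRate_nonneg hE.u_nonneg hM ha1
  have key := abs_evol_sub_poisson_le (p := rate u S a) (δ := logRate u M a) (n := N)
    (fun m _ => h0 m) (fun m _ => h1 m) (fun m _ => hδ m) (L := 0) (fun _ => le_rfl)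
    (s := 1 + M) (by linarith) D
  have hex : (fun z => ∏ i, poissonTail (D i - z i) ((0 : Fin k → ℝ) i)) = exceed D := by
    ext z; simp [exceed_eq_prod]
  rw [hex] at key
  simp only [Pi.zero_apply, zero_add, add_sub_cancel_left] at key
  simp only [fun i => sum_logRate (u := u) (M := M) (ha1 i) (haN i)] at key
  refine key.trans ?_
  set α := (A : ℝ) ^ (-(1 / 8) : ℝ) with hα
  have hα0 : 0 ≤ α := by positivity
  have hR := fun i => hE.sum_abs_rate_sub_le hw hM hA (ha i)
  have hRC := rateConst_nonneg hw hM
  have hsum1 : ∑ m ∈ Finset.range N, ((1 + M + 1) * (∑ i, |rate u S a m i - logRate u M a m i|) +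
      ((1 + M + 1) * ∑ i, logRate u M a m i) ^ 2) ≤
      ((M + 2) * (k * rateConst w M) + ((M + 2) * (k * (1 / M))) ^ 2 * zetaConst) * α := by
    rw [Finset.sum_add_distrib, ← Finset.mul_sum, Finset.sum_comm, add_mul _ _ α]
    refine add_le_add ?_ ?_
    · have : ∑ i, ∑ m ∈ Finset.range N, |rate u S a m i - logRate u M a m i| ≤
          ∑ _i : Fin k, rateConst w M * α := Finset.sum_le_sum fun i _ => hR i
      rw [Finset.sum_const, Finset.card_univ, Fintype.card_fin, nsmul_eq_mul] at this
      calc _ ≤ (1 + M + 1) * (k * (rateConst w M * α)) :=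
            mul_le_mul_of_nonneg_left this (by linarith)
        _ = _ := by ring
    -- Each increment is at most 1 / (M m), so its square is summable; before time `A` all
    -- increments vanish since no tracked vertex is present.
    · have hle : ∀ m ∈ Finset.range N, ((1 + M + 1) * ∑ i, logRate u M a m i) ^ 2 ≤
          if A ≤ m then ((M + 2) * (k * (1 / M))) ^ 2 * (m : ℝ) ^ (-(5 / 4) : ℝ) else 0 := by
        intro m _
        split_ifs with hm
        · have hm1 : 1 ≤ m := hA.trans hm
          have hm0 : (0 : ℝ) < m := by exact_mod_cast hm1
          have hb : ∀ i, logRate u M a m i ≤ 1 / M * (1 / m) := by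
            intro i
            unfold logRate
            split_ifs
            · have := log_succ_sub_log_bounds hm1
              exact mul_le_mul (div_le_div_of_nonneg_right (hE.u_le i) hM.le) this.2.1 this.1
                (by positivity)
            · positivity
          have hs : ∑ i, logRate u M a m i ≤ k * (1 / M) * (1 / m) := by
            refine (Finset.sum_le_sum fun i _ => hb i).trans (le_of_eq ?_)
            simp; ring
          have hs0 : 0 ≤ ∑ i, logRate u M a m i := Finset.sum_nonneg fun i _ => hδ m i
          calc ((1 + M + 1) * ∑ i, logRate u M a m i) ^ 2
              ≤ ((M + 2) * (k * (1 / M) * (1 / m))) ^ 2 := by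
                refine pow_le_pow_left₀ (mul_nonneg (by linarith) hs0) ?_ 2
                exact mul_le_mul (by linarith) hs hs0 (by linarith)
            _ = ((M + 2) * (k * (1 / M))) ^ 2 * (1 / (m : ℝ) ^ 2) := by ring
            _ ≤ _ := by
                refine mul_le_mul_of_nonneg_left ?_ (by positivity)
                rw [one_div, ← Real.rpow_natCast, ← Real.rpow_neg hm0.le]
                exact Real.rpow_le_rpow_of_exponent_le (by exact_mod_cast hm1) (by norm_num)
        · have : ∀ i, logRate u M a m i = 0 := fun i => if_neg (by have := ha i; omega)
          simp [this]
      refine (Finset.sum_le_sum hle).trans ?_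
      rw [sum_range_ite_le, ← Finset.mul_sum, mul_assoc]
      exact mul_le_mul_of_nonneg_left (sum_Ico_rpow_le hA N) (by positivity)
  have hexp : Real.exp (M * ∑ i, (u i / M * Real.log (N / a i) +
      ∑ m ∈ Finset.range N, |rate u S a m i - logRate u M a m i|)) ≤
      Real.exp (M * (k * rateConst w M)) * ∏ i, ((N : ℝ) / a i) := by
    rw [Finset.sum_add_distrib, mul_add, Real.exp_add, mul_comm]
    refine mul_le_mul (Real.exp_le_exp.2 (mul_le_mul_of_nonneg_left ?_ hM.le)) ?_
      (Real.exp_pos _).le (Real.exp_pos _).le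
    · refine (Finset.sum_le_sum fun i _ => (hR i).trans
        (mul_le_of_le_one_right hRC (rpow_neg_le_one hA))).trans (le_of_eq ?_)
      simp
    · rw [Finset.mul_sum, Real.exp_sum]
      exact Finset.prod_le_prod (fun i _ => (Real.exp_pos _).le) fun i _ =>
        hE.exp_rate_le hM (ha1 i) (haN i) i
  have hP : 0 ≤ ∏ i, ((1 + M) ^ D i)⁻¹ := Finset.prod_nonneg fun i _ => by positivity
  refine (mul_le_mul hsum1 (mul_le_mul_of_nonneg_left hexp hP)
    (mul_nonneg hP (Real.exp_pos _).le) ?_).trans (le_of_eq ?_)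
  · have := zetaConst_nonneg
    positivity
  · rw [approxConst, Finset.prod_mul_distrib]; ring

/-- The harmonic sum over `[b, A)`. -/
lemma sum_Ico_one_div_le {b A : ℕ} (hb : 1 ≤ b) :
    ∑ m ∈ Finset.Ico b A, 1 / (m : ℝ) ≤ 1 + Real.log A := by
  have h1 : ∑ m ∈ Finset.Ico b A, 1 / (m : ℝ) ≤ ∑ m ∈ Finset.Icc 1 A, (m : ℝ)⁻¹ := by
    simp only [one_div]
    refine Finset.sum_le_sum_of_subset_of_nonneg ?_ fun m _ _ => by positivity
    intro m hm
    rw [Finset.mem_Ico] at hm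
    exact Finset.mem_Icc.2 ⟨by omega, by omega⟩
  refine h1.trans ?_
  have := harmonic_le_one_add_log A
  rw [harmonic_eq_sum_Icc] at this
  push_cast at this
  exact this

/-- Total rate of a late vertex. -/
lemma GoodEnv.sum_rate_le {w M : ℝ} {u : Fin k → ℝ} {S : ℕ → ℝ} {A N : ℕ}
    (hE : GoodEnv w M u S A N) (hw : 0 < w) (hM : 0 < M) (hA : 1 ≤ A) {b : ℕ} (hb : A ≤ b)
    (hbN : b ≤ N) (i : Fin k) :
    ∑ m ∈ Finset.Ico b N, u i / S m ≤ u i / M * Real.log (N / b) + rateConst w M := by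
  have h1 := hE.sum_abs_le hw hM hA hb i
  have h2 : ∑ m ∈ Finset.Ico b N, u i / S m ≤ ∑ m ∈ Finset.Ico b N,
      (u i / M * (Real.log ((m + 1 : ℕ) : ℝ) - Real.log m) +
        |u i / S m - u i / M * (Real.log ((m + 1 : ℕ) : ℝ) - Real.log m)|) :=
    Finset.sum_le_sum fun m _ => by
      linarith [le_abs_self (u i / S m - u i / M * (Real.log ((m + 1 : ℕ) : ℝ) - Real.log m))]
  rw [Finset.sum_add_distrib, ← Finset.mul_sum,
    Finset.sum_Ico_sub (fun m : ℕ => Real.log (m : ℝ)) hbN, ← Real.log_div] at h2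
  · have h3 := mul_le_of_le_one_right (rateConst_nonneg hw hM) (rpow_neg_le_one hA)
    linarith
  · norm_cast; omega
  · norm_cast; omega

/-- The constant in the upper bounds for degree tails. -/
def boundConst (w M : ℝ) : ℝ := Real.exp (M * (1 / w + rateConst w M))

/-- Upper bound for the probability that vertex `b` has degree at least `D` at time `N`. -/
def degBound (w M σ : ℝ) (A N D b : ℕ) : ℝ :=
  if A ≤ b then boundConst w M * (((1 + M) ^ D)⁻¹ * (N / b))
  else boundConst w M * (((1 + M * σ) ^ D)⁻¹ * ((N : ℝ) ^ σ * (A : ℝ) ^ (M / w)))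

/-- Chernoff's bound with a parameter chosen per coordinate. Late vertices use 1 + M. Early ones use
1 + M σ, which lowers the power of `N` from 1 to σ. Before time `A` only `w * m ≤ S m` is available,
and this costs the factor `A ^ (M / w)`. -/
lemma GoodEnv.evol_le {w M σ : ℝ} {u : Fin k → ℝ} {S : ℕ → ℝ} {A N : ℕ}
    (hE : GoodEnv w M u S A N) (hw : 0 < w) (hM : 0 < M) (hσ0 : 0 ≤ σ) (hσ1 : σ ≤ 1) (hA : 1 ≤ A)
    (hAN : A ≤ N) {a : Fin k → ℕ} (ha : ∀ i, 1 ≤ a i) (haN : ∀ i, a i ≤ N)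
    (h0 : ∀ m i, 0 ≤ rate u S a m i) (h1 : ∀ m, ∑ i, rate u S a m i ≤ 1) (D : Fin k → ℕ) :
    evol (rate u S a) N (exceed D) 0 ≤ ∏ i, degBound w M σ A N (D i) (a i) := by
  have hMσ : 0 ≤ M * σ := by positivity
  have hRC := rateConst_nonneg hw hM
  refine (evol_exceed_le (s := fun i => if A ≤ a i then 1 + M else 1 + M * σ) (fun m _ => h0 m)
    (fun m _ => h1 m) (fun i => ?_) D).trans ?_
  · split_ifs <;> linarith
  refine Finset.prod_le_prod (fun i _ => ?_) fun i _ => ?_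
  · split_ifs <;> positivity
  have hrs : ∑ m ∈ Finset.range N, rate u S a m i = ∑ m ∈ Finset.Ico (a i) N, u i / S m := by
    unfold rate; rw [sum_range_ite_le]
  rw [hrs, degBound]
  by_cases hai : A ≤ a i
  · rw [if_pos hai, if_pos hai, add_sub_cancel_left, mul_left_comm]
    refine mul_le_mul_of_nonneg_left ?_ (by positivity)
    refine (Real.exp_le_exp.2 (mul_le_mul_of_nonneg_left
      (hE.sum_rate_le hw hM hA hai (haN i) i) hM.le)).trans ?_
    rw [mul_add, Real.exp_add, mul_comm]
    refine mul_le_mul (Real.exp_le_exp.2 (mul_le_mul_of_nonneg_left ?_ hM.le))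
      (hE.exp_rate_le hM (ha i) (haN i) i) (Real.exp_pos _).le (Real.exp_pos _).le
    have : 0 < 1 / w := by positivity
    linarith
  · rw [if_neg hai, if_neg hai, add_sub_cancel_left, mul_left_comm]
    refine mul_le_mul_of_nonneg_left ?_ (by positivity)
    push Not at hai
    have hA0 : (0 : ℝ) < A := by exact_mod_cast hA
    have hN0 : (0 : ℝ) < N := by exact_mod_cast (hA.trans hAN)
    have hlogA : 0 ≤ Real.log A := Real.log_nonneg (by exact_mod_cast hA)
    have hlogN : 0 ≤ Real.log N := Real.log_nonneg (by exact_mod_cast hA.trans hAN)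
    have hs1 : ∑ m ∈ Finset.Ico (a i) A, u i / S m ≤ 1 / w * (1 + Real.log A) := by
      refine le_trans ?_ (mul_le_mul_of_nonneg_left (sum_Ico_one_div_le (ha i)) (by positivity))
      rw [Finset.mul_sum]
      refine Finset.sum_le_sum fun m hm => ?_
      have hm1 : 1 ≤ m := (ha i).trans (Finset.mem_Ico.1 hm).1
      have hm0 : (0 : ℝ) < m := by exact_mod_cast hm1
      have hS : 0 < w * m := by positivity
      have : 1 / w * (1 / (m : ℝ)) = 1 / (w * m) := by field_simp
      rw [this]
      exact div_le_div₀ zero_le_one (hE.u_le i) hS (hE.le_S m)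
    have hs2 : ∑ m ∈ Finset.Ico A N, u i / S m ≤ 1 / M * Real.log N + rateConst w M := by
      refine (hE.sum_rate_le hw hM hA le_rfl hAN i).trans (add_le_add_left ?_ _)
      refine mul_le_mul (div_le_div_of_nonneg_right (hE.u_le i) hM.le) ?_ ?_ (by positivity)
      · refine Real.log_le_log (by positivity) (div_le_self hN0.le (by exact_mod_cast hA))
      · exact Real.log_nonneg (by rw [one_le_div hA0]; exact_mod_cast hAN)
    have hs := add_le_add hs1 hs2
    rw [Finset.sum_Ico_consecutive _ hai.le hAN] at hs
    have hfin : M * σ * ∑ m ∈ Finset.Ico (a i) N, u i / S m ≤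
        M * (1 / w + rateConst w M) + (Real.log N * σ + Real.log A * (M / w)) := by
      refine (mul_le_mul_of_nonneg_left hs hMσ).trans ?_
      have e : M * σ * (1 / w * (1 + Real.log A) + (1 / M * Real.log N + rateConst w M)) =
          σ * (M * (1 / w + rateConst w M)) + (Real.log N * σ + σ * (Real.log A * (M / w))) := by
        field_simp; ring
      rw [e]
      have t1 : σ * (M * (1 / w + rateConst w M)) ≤ M * (1 / w + rateConst w M) :=
        mul_le_of_le_one_left (by positivity) hσ1
      have t2 : σ * (Real.log A * (M / w)) ≤ Real.log A * (M / w) :=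
        mul_le_of_le_one_left (by positivity) hσ1
      linarith
    refine (Real.exp_le_exp.2 hfin).trans (le_of_eq ?_)
    rw [Real.exp_add, Real.exp_add, boundConst, Real.rpow_def_of_pos hN0,
      Real.rpow_def_of_pos hA0]

end Weights

end WRT

end

/-! ### Averaging over the weights: joint degree tails of fixed tuples. -/

noncomputable section

namespace WRT

section Tuples

set_option linter.unusedSectionVars false

variable {Ω : Type*} [mΩ : MeasurableSpace Ω] {μ : Measure Ω} [IsProbabilityMeasure μ]
  {W : ℕ → Ω → ℝ} {parent : ℕ → Ω → ℕ} {k : ℕ} {w M : ℝ}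

lemma totalWeight_eq_sum_range (W : ℕ → Ω → ℝ) (m : ℕ) (ω : Ω) :
    totalWeight W m ω = ∑ i ∈ Finset.range m, W (i + 1) ω := by
  rw [totalWeight, Finset.range_eq_Ico, Finset.sum_Ico_add' (fun i => W i ω) 0 m 1]
  rfl

lemma IsWRT.integral_weight (hT : IsWRT μ W parent) {i : ℕ} (hi : 1 ≤ i) :
    ∫ ω, W i ω ∂μ = ∫ ω, W 1 ω ∂μ := (hT.identDistrib_weight i hi).integral_eq

/-- Hoeffding's inequality for the partial sums of the weights. -/
lemma IsWRT.measure_dev_le (hT : IsWRT μ W parent)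
    (hb : ∀ i, 1 ≤ i → ∀ᵐ ω ∂μ, W i ω ∈ Set.Icc 0 1) (hM : M = ∫ ω, W 1 ω ∂μ) {m : ℕ}
    (hm : 1 ≤ m) :
    μ.real {ω | (m : ℝ) ^ (3 / 4 : ℝ) < |totalWeight W m ω - m * M|} ≤
      2 * Real.exp (-√m) := by
  have hm0 : (0 : ℝ) < m := by exact_mod_cast hm
  have hsub : ∀ i : ℕ, HasSubgaussianMGF (fun ω => W (i + 1) ω - M) ((‖(1 : ℝ) - 0‖₊ / 2) ^ 2) μ := by
    intro i
    have := hasSubgaussianMGF_of_mem_Icc (hT.measurable_weight (i + 1) (by omega)).aemeasurable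
      (hb (i + 1) (by omega))
    rwa [hT.integral_weight (by omega), ← hM] at this
  have hind : iIndepFun (fun (i : ℕ) ω => W (i + 1) ω - M) μ :=
    hT.indep_weight.comp (fun _ x => x - M) fun _ => measurable_id.sub_const M
  have hind' : iIndepFun (fun (i : ℕ) ω => -(W (i + 1) ω - M)) μ :=
    hT.indep_weight.comp (fun _ x => -(x - M)) fun _ => (measurable_id.sub_const M).neg
  have e : ∀ ω, ∑ i ∈ Finset.range m, (W (i + 1) ω - M) = totalWeight W m ω - m * M := by
    intro ω; simp [totalWeight_eq_sum_range]
  have e' : ∀ ω, ∑ i ∈ Finset.range m, -(W (i + 1) ω - M) = -(totalWeight W m ω - m * M) := by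
    intro ω; rw [Finset.sum_neg_distrib, e]
  have hε : (0 : ℝ) ≤ (m : ℝ) ^ (3 / 4 : ℝ) := by positivity
  have h1 := HasSubgaussianMGF.measure_sum_range_ge_le_of_iIndepFun hind (n := m)
    (fun i _ => hsub i) hε
  have h2 := HasSubgaussianMGF.measure_sum_range_ge_le_of_iIndepFun hind' (n := m)
    (fun i _ => (hsub i).neg) hε
  have hexp : Real.exp (-((m : ℝ) ^ (3 / 4 : ℝ)) ^ 2 /
      (2 * m * (((‖(1 : ℝ) - 0‖₊ / 2) ^ 2 : NNReal) : ℝ))) ≤ Real.exp (-√m) := by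
    refine Real.exp_le_exp.2 ?_
    have e1 : (((‖(1 : ℝ) - 0‖₊ / 2) ^ 2 : NNReal) : ℝ) = 1 / 4 := by
      push_cast; norm_num
    have e2 : ((m : ℝ) ^ (3 / 4 : ℝ)) ^ 2 = m * √m := by
      rw [← Real.rpow_natCast, ← Real.rpow_mul hm0.le, Real.sqrt_eq_rpow]
      nth_rewrite 2 [← Real.rpow_one (m : ℝ)]
      rw [← Real.rpow_add hm0]; norm_num
    -- Variables in [0, 1] have variance proxy 1/4, so Hoeffding gives exponent -2√m, of which only
    -- half is kept.
    have e3 : -(m * √(m : ℝ)) / (2 * m * (1 / 4)) = -2 * √(m : ℝ) := by field_simp; norm_num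
    rw [e1, e2, e3]
    linarith [Real.sqrt_nonneg (m : ℝ)]
  simp only [e] at h1
  simp only [e'] at h2
  calc _ ≤ μ.real ({ω | (m : ℝ) ^ (3 / 4 : ℝ) ≤ totalWeight W m ω - m * M} ∪
        {ω | (m : ℝ) ^ (3 / 4 : ℝ) ≤ -(totalWeight W m ω - m * M)}) := by
        refine measureReal_mono ?_
        intro ω hω
        rw [Set.mem_ofPred_eq] at hω
        rcases lt_abs.1 hω with h | h
        · exact Or.inl h.le
        · exact Or.inr h.le
    _ ≤ _ := measureReal_union_le _ _
    _ ≤ _ := by linarith [h1.trans hexp, h2.trans hexp]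

/-- The event that some partial sum of the weights deviates from its mean. -/
def badEvent (W : ℕ → Ω → ℝ) (M : ℝ) (A N : ℕ) : Set Ω :=
  ⋃ m ∈ Finset.Ico A N, {ω | (m : ℝ) ^ (3 / 4 : ℝ) < |totalWeight W m ω - m * M|}

lemma IsWRT.measurableSet_badEvent (hT : IsWRT μ W parent) (A N : ℕ) :
    MeasurableSet (badEvent W M A N) := by
  refine Finset.measurableSet_biUnion _ fun m _ => ?_
  have hS := (measurable_totalWeight_weightAlg (W := W) m).mono hT.weightAlg_le le_rfl
  have : Measurable fun ω => |totalWeight W m ω - m * M| := by fun_prop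
  exact measurableSet_lt measurable_const this

lemma IsWRT.measure_badEvent_le (hT : IsWRT μ W parent)
    (hb : ∀ i, 1 ≤ i → ∀ᵐ ω ∂μ, W i ω ∈ Set.Icc 0 1) (hM : M = ∫ ω, W 1 ω ∂μ) {A : ℕ}
    (hA : 1 ≤ A) (N : ℕ) :
    μ.real (badEvent W M A N) ≤ 2 * N * Real.exp (-√A) := by
  refine (measureReal_biUnion_finset_le _ _).trans ?_
  calc _ ≤ ∑ m ∈ Finset.Ico A N, 2 * Real.exp (-√A) := by
        refine Finset.sum_le_sum fun m hm => ?_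
        have hm' := Finset.mem_Ico.1 hm
        refine (hT.measure_dev_le hb hM (hA.trans hm'.1)).trans ?_
        have : √(A : ℝ) ≤ √(m : ℝ) := Real.sqrt_le_sqrt (by exact_mod_cast hm'.1)
        gcongr
    _ ≤ _ := by
        rw [Finset.sum_const, nsmul_eq_mul, Nat.card_Ico, mul_comm (2 : ℝ) N, mul_assoc]
        have h1 : ((N - A : ℕ) : ℝ) ≤ N := by exact_mod_cast Nat.sub_le N A
        exact mul_le_mul_of_nonneg_right h1 (by positivity)

lemma goodEnv_of_notMem {ω : Ω} (h : ∀ i, 1 ≤ i → W i ω ∈ Set.Icc w 1) (hw : 0 < w) {A N : ℕ}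
    (hω : ω ∉ badEvent W M A N) {a : Fin k → ℕ} (ha : ∀ i, 1 ≤ a i) :
    GoodEnv w M (fun i => W (a i) ω) (fun m => totalWeight W m ω) A N where
  u_nonneg i := hw.le.trans (h _ (ha i)).1
  u_le i := (h _ (ha i)).2
  le_S m := by
    rw [totalWeight_eq_sum_range]
    calc w * m = ∑ i ∈ Finset.range m, w := by simp [mul_comm]
      _ ≤ _ := Finset.sum_le_sum fun i _ => (h (i + 1) (by omega)).1
  dev m h1 h2 := by
    by_contra hlt
    push Not at hlt
    exact hω (Set.mem_biUnion (Finset.mem_coe.2 (Finset.mem_Ico.2 ⟨h1, h2⟩)) hlt)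

/-- The probability that `a i` has in-degree at least `D i` at time `N`, for all `i`. -/
def degTail (μ : Measure Ω) (parent : ℕ → Ω → ℕ) (N : ℕ) (D a : Fin k → ℕ) : ℝ :=
  μ.real {ω | ∀ i, D i ≤ inDegree parent N (a i) ω}

/-- The approximation to the probability that a vertex which has had time `t` on the logarithmic
scale to collect edges has degree at least `D`. -/
def poissonMix (μ : Measure Ω) (V : Ω → ℝ) (M : ℝ) (D : ℕ) (t : ℝ) : ℝ :=
  ∫ ω, poissonTail D (V ω / M * t) ∂μ

lemma exceed_nonneg (D z : Fin k → ℕ) : 0 ≤ exceed D z := by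
  unfold exceed; split_ifs <;> norm_num

lemma exceed_le_one (D z : Fin k → ℕ) : exceed D z ≤ 1 := by
  unfold exceed; split_ifs <;> norm_num

lemma IsWRT.degTail_eq (hT : IsWRT μ W parent) {a : Fin k → ℕ} (ha : ∀ i, 1 ≤ a i)
    (hinj : Function.Injective a) {N : ℕ} (hN : 1 ≤ N) (D : Fin k → ℕ) :
    degTail μ parent N D a = ∫ ω, evol (attachProb W a ω) N (exceed D) 0 ∂μ := by
  have h := hT.integral_degrees ha hinj hN (G := fun z _ => exceed D z)
    (fun z => measurable_const) (C := 1) (Eventually.of_forall fun ω z => by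
      rw [abs_of_nonneg (exceed_nonneg D z)]; exact exceed_le_one D z)
  rw [← h, degTail]
  have hm : MeasurableSet {ω | ∀ i, D i ≤ inDegree parent N (a i) ω} := by
    have : Measurable (degrees parent a N) :=
      (measurable_degrees_history (W := W) a N).mono (hT.history_le N) le_rfl
    exact this (show MeasurableSet {z : Fin k → ℕ | ∀ i, D i ≤ z i} from .of_discrete)
  rw [← integral_indicator_one hm]
  refine integral_congr_ae (Eventually.of_forall fun ω => ?_)
  by_cases hω : ∀ i, D i ≤ inDegree parent N (a i) ω
  · have h2 : exceed D (degrees parent a N ω) = 1 := if_pos hω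
    simp only [h2]
    rw [Set.indicator_of_mem (by exact hω)]; rfl
  · have h2 : exceed D (degrees parent a N ω) = 0 := if_neg hω
    simp only [h2]
    rw [Set.indicator_of_notMem (by exact hω)]

lemma evol_exceed_mem {p : ℕ → Fin k → ℝ} (h0 : ∀ m i, 0 ≤ p m i) (h1 : ∀ m, ∑ i, p m i ≤ 1)
    (N : ℕ) (D : Fin k → ℕ) : evol p N (exceed D) 0 ∈ Set.Icc (0 : ℝ) 1 := by
  have hc : ∀ c : ℝ, evol p N (fun _ => c) 0 = c := by
    intro c
    induction N with
    | zero => rfl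
    | succ n ih =>
      have : step (p n) (fun _ => c) = fun _ => c := by ext z; simp [step]
      rw [evol, this]; exact ih
  constructor
  · rw [← hc 0]; exact evol_mono (fun m _ => h0 m) (fun m _ => h1 m) (exceed_nonneg D) 0
  · conv_rhs => rw [← hc 1]
    exact evol_mono (fun m _ => h0 m) (fun m _ => h1 m) (exceed_le_one D) 0

lemma IsWRT.integrable_evol (hT : IsWRT μ W parent) {a : Fin k → ℕ} (ha : ∀ i, 1 ≤ a i)
    (hinj : Function.Injective a) (N : ℕ) (D : Fin k → ℕ) :
    Integrable (fun ω => evol (attachProb W a ω) N (exceed D) 0) μ := by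
  refine Integrable.of_bound (C := 1) ((measurable_evol ha N (G := fun z _ => exceed D z)
    (fun z => measurable_const) 0).mono hT.weightAlg_le le_rfl).aestronglyMeasurable ?_
  filter_upwards [hT.ae_weight_pos] with ω h
  have := evol_exceed_mem (attachProb_nonneg h ha) (sum_attachProb_le_one h ha hinj) N D
  rw [Real.norm_eq_abs, abs_of_nonneg this.1]
  exact this.2

lemma ae_forall_weight {P : ℝ → Prop} (hb : ∀ i, 1 ≤ i → ∀ᵐ ω ∂μ, P (W i ω)) :
    ∀ᵐ ω ∂μ, ∀ i, 1 ≤ i → P (W i ω) := by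
  rw [ae_all_iff]
  intro i
  by_cases hi : 1 ≤ i
  · filter_upwards [hb i hi] with ω h _ using h
  · exact Eventually.of_forall fun ω h => absurd h hi

/-- Distinct vertices carry i.i.d. weights, so the expectation factorises. The shift by one matches
the indexing of `indep_weight`. -/
lemma IsWRT.integral_prod_poissonTail (hT : IsWRT μ W parent) {a : Fin k → ℕ} (ha : ∀ i, 1 ≤ a i)
    (hinj : Function.Injective a) (D : Fin k → ℕ) (t : Fin k → ℝ) :
    ∫ ω, ∏ i, poissonTail (D i) (W (a i) ω / M * t i) ∂μ =
      ∏ i, poissonMix μ (W 1) M (D i) (t i) := by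
  have hinj' : Function.Injective (fun i => a i - 1) := by
    intro i j h
    have := ha i; have := ha j
    exact hinj (by simp only at h; omega)
  have h1 : iIndepFun (fun i : Fin k => W (a i)) μ := by
    have := hT.indep_weight.precomp hinj'
    have e : ∀ i, a i - 1 + 1 = a i := fun i => Nat.sub_add_cancel (ha i)
    simpa only [Function.comp_def, e] using this
  have hc : ∀ i, Measurable fun x => poissonTail (D i) (x / M * t i) := fun i =>
    ((continuous_poissonTail (D i)).measurable).comp (by fun_prop)
  rw [h1.integral_fun_prod_comp (f := fun i x => poissonTail (D i) (x / M * t i))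
    (fun i => (hT.measurable_weight _ (ha i)).aemeasurable)
    (fun i => (hc i).aestronglyMeasurable)]
  refine Finset.prod_congr rfl fun i _ => ?_
  exact ((hT.identDistrib_weight (a i) (ha i)).comp (hc i)).integral_eq

lemma integral_le_add_badEvent {f : Ω → ℝ} {K : ℝ} (hf : Integrable f μ) {B : Set Ω}
    (hB : MeasurableSet B) (hK : 0 ≤ K) (h1 : ∀ᵐ ω ∂μ, f ω ≤ 1)
    (h : ∀ᵐ ω ∂μ, ω ∉ B → f ω ≤ K) : ∫ ω, f ω ∂μ ≤ K + μ.real B := by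
  have hi : Integrable (fun ω => K + B.indicator (fun _ => (1 : ℝ)) ω) μ :=
    (integrable_const K).add ((integrable_const 1).indicator hB)
  refine (integral_mono_ae hf hi ?_).trans (le_of_eq ?_)
  · filter_upwards [h1, h] with ω h1 h2
    by_cases hω : ω ∈ B
    · simp [hω]; linarith
    · simpa [hω] using h2 hω
  · rw [integral_add (integrable_const K) ((integrable_const 1).indicator hB),
      integral_indicator_const _ hB]
    simp

lemma approxConst_nonneg (hw : 0 < w) (hM : 0 < M) : 0 ≤ approxConst k w M := by
  have := zetaConst_nonneg
  have := rateConst_nonneg hw hM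
  unfold approxConst
  positivity

/-- Joint degree tails of late vertices approximately factorise. -/
lemma IsWRT.abs_degTail_sub_le (hT : IsWRT μ W parent) (hw : 0 < w) (hM : 0 < M)
    (hb : ∀ i, 1 ≤ i → ∀ᵐ ω ∂μ, W i ω ∈ Set.Icc w 1) {A N : ℕ} (hA : 1 ≤ A) (hAN : A ≤ N)
    {a : Fin k → ℕ} (ha : ∀ i, A ≤ a i) (haN : ∀ i, a i ≤ N) (hinj : Function.Injective a)
    (D : Fin k → ℕ) :
    |degTail μ parent N D a - ∏ i, poissonMix μ (W 1) M (D i) (Real.log (N / a i))| ≤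
      approxConst k w M * (A : ℝ) ^ (-(1 / 8) : ℝ) * (∏ i, (((1 + M) ^ D i)⁻¹ * (N / a i))) +
        μ.real (badEvent W M A N) := by
  have ha1 : ∀ i, 1 ≤ a i := fun i => hA.trans (ha i)
  rw [hT.degTail_eq ha1 hinj (hA.trans hAN), ← hT.integral_prod_poissonTail ha1 hinj]
  have hlog : ∀ i, 0 ≤ Real.log (N / a i) := fun i => by
    refine Real.log_nonneg ?_
    rw [one_le_div (by exact_mod_cast ha1 i)]
    exact_mod_cast haN i
  have hmem : ∀ᵐ ω ∂μ, ∏ i, poissonTail (D i) (W (a i) ω / M * Real.log (N / a i)) ∈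
      Set.Icc (0 : ℝ) 1 := by
    filter_upwards [hT.ae_weight_pos] with ω h
    have h0 : ∀ i, 0 ≤ W (a i) ω / M * Real.log (N / a i) := fun i =>
      mul_nonneg (div_nonneg (h _ (ha1 i)).le hM.le) (hlog i)
    exact ⟨Finset.prod_nonneg fun i _ => poissonTail_nonneg _ (h0 i),
      Finset.prod_le_one (fun i _ => poissonTail_nonneg _ (h0 i))
        fun i _ => poissonTail_le_one _ (h0 i)⟩
  have hint2 : Integrable
      (fun ω => ∏ i, poissonTail (D i) (W (a i) ω / M * Real.log (N / a i))) μ := by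
    refine Integrable.of_bound (C := 1) ?_ ?_
    · refine (Finset.measurable_fun_prod _ fun i _ => ?_).aestronglyMeasurable
      exact (continuous_poissonTail (D i)).measurable.comp
        (((hT.measurable_weight _ (ha1 i)).div_const M).mul_const _)
    · filter_upwards [hmem] with ω h
      rw [Real.norm_eq_abs, abs_of_nonneg h.1]; exact h.2
  have hint1 := hT.integrable_evol ha1 hinj N D
  rw [← integral_sub hint1 hint2]
  refine (abs_integral_le_integral_abs).trans ?_
  refine integral_le_add_badEvent (hint1.sub hint2).abs (hT.measurableSet_badEvent A N) ?_ ?_ ?_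
  · have := approxConst_nonneg (k := k) hw hM
    have h2 : 0 ≤ ∏ i, (((1 + M) ^ D i)⁻¹ * ((N : ℝ) / a i)) :=
      Finset.prod_nonneg fun i _ => by positivity
    positivity
  · filter_upwards [hmem, hT.ae_weight_pos] with ω h1 h2
    have h3 := evol_exceed_mem (attachProb_nonneg h2 ha1) (sum_attachProb_le_one h2 ha1 hinj) N D
    rw [Pi.sub_apply, abs_le]
    constructor <;> linarith [h1.1, h1.2, h3.1, h3.2]
  · filter_upwards [hT.ae_weight_pos, ae_forall_weight hb] with ω h1 h2 hω
    exact (goodEnv_of_notMem h2 hw hω ha1).abs_evol_sub_le hw hM hA ha haN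
      (attachProb_nonneg h1 ha1) (sum_attachProb_le_one h1 ha1 hinj) D

lemma degBound_nonneg {σ : ℝ} (hM : 0 < M) (hσ0 : 0 ≤ σ) (A N D b : ℕ) :
    0 ≤ degBound w M σ A N D b := by
  have : 0 < boundConst w M := Real.exp_pos _
  have : 0 ≤ M * σ := by positivity
  unfold degBound
  split_ifs <;> positivity

/-- Upper bound for joint degree tails. -/
lemma IsWRT.degTail_le (hT : IsWRT μ W parent) (hw : 0 < w) (hM : 0 < M) {σ : ℝ} (hσ0 : 0 ≤ σ)
    (hσ1 : σ ≤ 1) (hb : ∀ i, 1 ≤ i → ∀ᵐ ω ∂μ, W i ω ∈ Set.Icc w 1) {A N : ℕ} (hA : 1 ≤ A)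
    (hAN : A ≤ N) {a : Fin k → ℕ} (ha1 : ∀ i, 1 ≤ a i) (haN : ∀ i, a i ≤ N)
    (hinj : Function.Injective a) (D : Fin k → ℕ) :
    degTail μ parent N D a ≤
      (∏ i, degBound w M σ A N (D i) (a i)) + μ.real (badEvent W M A N) := by
  rw [hT.degTail_eq ha1 hinj (hA.trans hAN)]
  refine integral_le_add_badEvent (hT.integrable_evol ha1 hinj N D)
    (hT.measurableSet_badEvent A N) ?_ ?_ ?_
  · exact Finset.prod_nonneg fun i _ => degBound_nonneg hM hσ0 _ _ _ _
  · filter_upwards [hT.ae_weight_pos] with ω h2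
    exact (evol_exceed_mem (attachProb_nonneg h2 ha1) (sum_attachProb_le_one h2 ha1 hinj) N D).2
  · filter_upwards [hT.ae_weight_pos, ae_forall_weight hb] with ω h1 h2 hω
    exact (goodEnv_of_notMem h2 hw hω ha1).evol_le hw hM hσ0 hσ1 hA hAN ha1 haN
      (attachProb_nonneg h1 ha1) (sum_attachProb_le_one h1 ha1 hinj) D

lemma poissonMix_nonneg {V : Ω → ℝ} (hV : ∀ᵐ ω ∂μ, 0 ≤ V ω) (hM : 0 < M) (D : ℕ) {t : ℝ}
    (ht : 0 ≤ t) : 0 ≤ poissonMix μ V M D t := by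
  refine integral_nonneg_of_ae ?_
  filter_upwards [hV] with ω h
  exact poissonTail_nonneg _ (mul_nonneg (div_nonneg h hM.le) ht)

lemma integrable_poissonTail {V : Ω → ℝ} (hVm : Measurable V) (hV : ∀ᵐ ω ∂μ, 0 ≤ V ω)
    (hM : 0 < M) (D : ℕ) {t : ℝ} (ht : 0 ≤ t) :
    Integrable (fun ω => poissonTail D (V ω / M * t)) μ := by
  refine Integrable.of_bound (C := 1) ((continuous_poissonTail D).measurable.comp
    ((hVm.div_const M).mul_const t)).aestronglyMeasurable ?_
  filter_upwards [hV] with ω h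
  have h0 : 0 ≤ V ω / M * t := mul_nonneg (div_nonneg h hM.le) ht
  rw [Real.norm_eq_abs, abs_of_nonneg (poissonTail_nonneg _ h0)]
  exact poissonTail_le_one _ h0

/-- Chernoff's bound at 1 + M σ together with V ≤ 1. The case σ = 1 gives the natural scale, while σ
< 1 gives integrability against exp (-t). -/
lemma poissonMix_le {V : Ω → ℝ} (hVm : Measurable V) (hV : ∀ᵐ ω ∂μ, V ω ∈ Set.Icc 0 1)
    (hM : 0 < M) {σ : ℝ} (hσ : 0 ≤ σ) (D : ℕ) {t : ℝ} (ht : 0 ≤ t) :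
    poissonMix μ V M D t ≤ ((1 + M * σ) ^ D)⁻¹ * Real.exp (σ * t) := by
  have hMσ : 0 ≤ M * σ := by positivity
  refine (integral_mono_ae (integrable_poissonTail hVm (hV.mono fun _ h => h.1) hM D ht)
    (integrable_const (((1 + M * σ) ^ D)⁻¹ * Real.exp (σ * t))) ?_).trans (by simp)
  filter_upwards [hV] with ω h
  refine (poissonTail_le D (s := 1 + M * σ) (by linarith)
    (mul_nonneg (div_nonneg h.1 hM.le) ht)).trans ?_
  refine mul_le_mul_of_nonneg_left (Real.exp_le_exp.2 ?_) (by positivity)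
  have : (1 + M * σ - 1) * (V ω / M * t) = V ω * (σ * t) := by field_simp; ring
  rw [this]
  exact mul_le_of_le_one_left (by positivity) h.2

end Tuples

end WRT

end

/-! ### Sums over injective tuples versus products of sums. -/

noncomputable section

namespace WRT

section FiniteSums

variable {k : ℕ}

lemma sum_piFinset_prod_le {s : Finset ℕ} {f : Fin k → ℕ → ℝ} {y : Fin k → ℝ}
    (hf : ∀ i b, 0 ≤ f i b) (hy : ∀ i, ∑ b ∈ s, f i b ≤ y i) :
    ∑ a ∈ Fintype.piFinset (fun _ : Fin k => s), ∏ i, f i (a i) ≤ ∏ i, y i := by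
  rw [← Finset.prod_univ_sum]
  exact Finset.prod_le_prod (fun i _ => Finset.sum_nonneg fun b _ => hf i b) fun i _ => hy i

/-- Once the common value `c` of the two coordinates is fixed, the constraint factorises over
coordinates: `i` contributes 1 and `j` contributes `B j c`. Summing over `c` restores the full sum
of `B j`. -/
lemma sum_piFinset_coincide_le {s : Finset ℕ} {B : Fin k → ℕ → ℝ} {y : Fin k → ℝ}
    (hB : ∀ i b, 0 ≤ B i b) (hy : ∀ i, ∑ b ∈ s, B i b ≤ y i) {i j : Fin k} (hij : j ≠ i) :
    ∑ a ∈ Fintype.piFinset (fun _ : Fin k => s),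
      (if a i = a j then ∏ l ∈ Finset.univ.erase i, B l (a l) else 0) ≤
        ∏ l ∈ Finset.univ.erase i, y l := by
  have hy0 : ∀ l, 0 ≤ y l := fun l => (Finset.sum_nonneg fun b _ => hB l b).trans (hy l)
  let f : ℕ → Fin k → ℕ → ℝ := fun c l b =>
    if l = i then (if b = c then 1 else 0) else
      if l = j then (if b = c then B l b else 0) else B l b
  have hf : ∀ c l b, 0 ≤ f c l b := by
    intro c l b
    simp only [f]
    split_ifs <;> first | exact hB _ _ | norm_num
  have hij' : j ∈ Finset.univ.erase i := Finset.mem_erase.2 ⟨hij, Finset.mem_univ _⟩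
  have step1 : ∀ a ∈ Fintype.piFinset (fun _ : Fin k => s),
      (if a i = a j then ∏ l ∈ Finset.univ.erase i, B l (a l) else 0) ≤
        ∑ c ∈ s, ∏ l, f c l (a l) := by
    intro a ha
    have has := Fintype.mem_piFinset.1 ha
    split_ifs with h
    · refine le_trans (le_of_eq ?_) (Finset.single_le_sum
        (f := fun c => ∏ l, f c l (a l)) (fun c _ => Finset.prod_nonneg fun l _ => hf c l _)
        (has j))
      rw [← Finset.mul_prod_erase _ _ (Finset.mem_univ i)]
      have : f (a j) i (a i) = 1 := by simp [f, h]
      rw [this, one_mul]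
      refine Finset.prod_congr rfl fun l hl => ?_
      have hl' := Finset.ne_of_mem_erase hl
      by_cases hlj : l = j
      · simp [f, hlj, hij]
      · simp [f, hl', hlj]
    · exact Finset.sum_nonneg fun c _ => Finset.prod_nonneg fun l _ => hf c l _
  refine (Finset.sum_le_sum step1).trans ?_
  rw [Finset.sum_comm]
  have step2 : ∀ c ∈ s, ∑ a ∈ Fintype.piFinset (fun _ : Fin k => s), ∏ l, f c l (a l) ≤
      B j c * ∏ l ∈ (Finset.univ.erase i).erase j, y l := by
    intro c hc
    refine (sum_piFinset_prod_le (hf c)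
      (y := fun l => if l = i then 1 else if l = j then B j c else y l) ?_).trans (le_of_eq ?_)
    · intro l
      by_cases hl : l = i
      · simp [f, hl, hc]
      · by_cases hlj : l = j
        · simp [f, hlj, hij, hc]
        · simpa [f, hl, hlj] using hy l
    · rw [← Finset.mul_prod_erase _ _ (Finset.mem_univ i), ← Finset.mul_prod_erase _ _ hij']
      simp only [if_true, one_mul, if_neg hij]
      congr 1
      refine Finset.prod_congr rfl fun l hl => ?_
      have h1 := Finset.ne_of_mem_erase hl
      have h2 := Finset.ne_of_mem_erase (Finset.mem_of_mem_erase hl)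
      simp [h1, h2]
  refine (Finset.sum_le_sum step2).trans ?_
  rw [← Finset.sum_mul, ← Finset.mul_prod_erase _ y hij']
  exact mul_le_mul_of_nonneg_right (hy j) (Finset.prod_nonneg fun l _ => hy0 l)

/-- A sum over injective tuples is close to a product of sums if the summand nearly factorises. -/
lemma norm_sum_injective_sub_prod_le {s l : Finset ℕ} (hl : l ⊆ s) {F : (Fin k → ℕ) → ℝ}
    {Q B : Fin k → ℕ → ℝ} {φ : Fin k → ℕ → ℂ} {x : Fin k → ℝ} {L τ η : ℝ} (hL : 1 ≤ L)
    (hτ : 0 ≤ τ) (hη : 0 ≤ η) (hx : ∀ i, 0 ≤ x i) (hφ : ∀ i b, ‖φ i b‖ ≤ 1)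
    (hB : ∀ i b, 0 ≤ B i b)
    (h1 : ∀ a, Function.Injective a → (∀ i, a i ∈ l) →
      |F a - ∏ i, Q i (a i)| ≤ τ * ∏ i, B i (a i) + η)
    (h2 : ∀ a, Function.Injective a → (∀ i, a i ∈ s) → |F a| ≤ ∏ i, B i (a i) + η)
    (h3 : ∀ i, ∀ b ∈ l, |Q i b| ≤ B i b) (h4 : ∀ i, ∀ b ∈ l, B i b ≤ τ * x i)
    (h5 : ∀ i, ∑ b ∈ s, B i b ≤ L * x i) (h6 : ∀ i, ∑ b ∈ s \ l, B i b ≤ τ * x i) :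
    ‖∑ a ∈ (Fintype.piFinset (fun _ : Fin k => s)).filter Function.Injective,
        (∏ i, φ i (a i)) * (F a : ℂ) - ∏ i, ∑ b ∈ l, φ i b * (Q i b : ℂ)‖ ≤
      (1 + k + k * k) * (τ * L ^ k) * (∏ i, x i) + (s.card : ℝ) ^ k * η := by
  classical
  have hφp : ∀ a : Fin k → ℕ, ‖∏ i, φ i (a i)‖ ≤ 1 := fun a => by
    rw [norm_prod]
    exact Finset.prod_le_one (fun i _ => norm_nonneg _) fun i _ => hφ i _
  have hBp : ∀ a : Fin k → ℕ, 0 ≤ ∏ i, B i (a i) := fun a => Finset.prod_nonneg fun i _ => hB i _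
  have hQp : ∀ a : Fin k → ℕ, (∀ i, a i ∈ l) → |∏ i, Q i (a i)| ≤ ∏ i, B i (a i) := fun a ha => by
    rw [Finset.abs_prod]
    exact Finset.prod_le_prod (fun i _ => abs_nonneg _) fun i _ => h3 i _ (ha i)
  have hx0 : 0 ≤ ∏ i, x i := Finset.prod_nonneg fun i _ => hx i
  set P := Fintype.piFinset (fun _ : Fin k => s) with hP
  have hprod : ∏ i, ∑ b ∈ l, φ i b * (Q i b : ℂ) =
      ∑ a ∈ P, if ∀ i, a i ∈ l then (∏ i, φ i (a i)) * ((∏ i, Q i (a i) : ℝ) : ℂ) else 0 := by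
    rw [Finset.prod_univ_sum, ← Finset.sum_filter]
    refine Finset.sum_congr ?_ fun a _ => ?_
    · ext a
      simp only [hP, Fintype.mem_piFinset, Finset.mem_filter]
      exact ⟨fun h => ⟨fun i => hl (h i), h⟩, fun h => h.2⟩
    · rw [Finset.prod_mul_distrib]; push_cast; rfl
  rw [hprod, Finset.sum_filter, ← Finset.sum_sub_distrib]
  -- Three kinds of error: failure of factorisation on late injective tuples, tuples with an early
  -- coordinate, and tuples with a coincidence, which occur in the product of sums but not in the
  -- sum over injective tuples.
  set E : (Fin k → ℕ) → ℝ := fun a => (τ * ∏ i, B i (a i) + η) +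
    (∑ j, (if a j ∉ l then ∏ i, B i (a i) else 0)) +
    ∑ i, ∑ j, (if j ≠ i ∧ a i = a j ∧ a i ∈ l then ∏ i, B i (a i) else 0) with hE
  have hE1 : ∀ a : Fin k → ℕ, 0 ≤ ∑ j, (if a j ∉ l then ∏ i, B i (a i) else 0) := fun a =>
    Finset.sum_nonneg fun j _ => by split_ifs <;> first | exact hBp a | exact le_rfl
  have hE2 : ∀ a : Fin k → ℕ, 0 ≤ ∑ i, ∑ j, (if j ≠ i ∧ a i = a j ∧ a i ∈ l then ∏ i, B i (a i) else 0) :=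
    fun a => Finset.sum_nonneg fun i _ => Finset.sum_nonneg fun j _ => by
      split_ifs <;> first | exact hBp a | exact le_rfl
  have hE0 : ∀ a : Fin k → ℕ, 0 ≤ τ * ∏ i, B i (a i) := fun a => mul_nonneg hτ (hBp a)
  have hpt : ∀ a ∈ P, ‖(if Function.Injective a then (∏ i, φ i (a i)) * (F a : ℂ) else 0) -
      (if ∀ i, a i ∈ l then (∏ i, φ i (a i)) * ((∏ i, Q i (a i) : ℝ) : ℂ) else 0)‖ ≤ E a := by
    intro a ha
    have has := Fintype.mem_piFinset.1 ha
    by_cases hinj : Function.Injective a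
    · by_cases hal : ∀ i, a i ∈ l
      · rw [if_pos hinj, if_pos hal, ← mul_sub, norm_mul, ← Complex.ofReal_sub,
          Complex.norm_real]
        refine (mul_le_of_le_one_left (norm_nonneg _) (hφp a)).trans ?_
        refine (h1 a hinj hal).trans ?_
        simp only [hE]; linarith [hE1 a, hE2 a]
      · rw [if_pos hinj, if_neg hal, sub_zero, norm_mul, Complex.norm_real]
        refine (mul_le_of_le_one_left (norm_nonneg _) (hφp a)).trans ?_
        refine (h2 a hinj has).trans ?_
        push Not at hal
        obtain ⟨j, hj⟩ := hal
        have := Finset.single_le_sum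
          (f := fun j => if a j ∉ l then ∏ i, B i (a i) else 0)
          (fun j _ => by split_ifs <;> first | exact hBp a | exact le_rfl) (Finset.mem_univ j)
        simp only [if_pos hj] at this
        simp only [hE]; linarith [hE2 a, hE0 a]
    · by_cases hal : ∀ i, a i ∈ l
      · rw [if_neg hinj, if_pos hal, zero_sub, norm_neg, norm_mul, Complex.norm_real]
        refine (mul_le_of_le_one_left (norm_nonneg _) (hφp a)).trans ?_
        refine (hQp a hal).trans ?_
        rw [Function.not_injective_iff] at hinj
        obtain ⟨i, j, hij, hne⟩ := hinj
        have t1 := Finset.single_le_sum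
          (f := fun j => if j ≠ i ∧ a i = a j ∧ a i ∈ l then ∏ i, B i (a i) else 0)
          (fun j _ => by split_ifs <;> first | exact hBp a | exact le_rfl) (Finset.mem_univ j)
        have t2 := Finset.single_le_sum
          (f := fun i => ∑ j, if j ≠ i ∧ a i = a j ∧ a i ∈ l then ∏ i, B i (a i) else 0)
          (fun i _ => Finset.sum_nonneg fun j _ => by
            split_ifs <;> first | exact hBp a | exact le_rfl) (Finset.mem_univ i)
        simp only [if_pos (show j ≠ i ∧ a i = a j ∧ a i ∈ l from ⟨hne.symm, hij, hal i⟩)] at t1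
        simp only [hE]; linarith [hE1 a, hE0 a]
      · rw [if_neg hinj, if_neg hal, sub_zero, norm_zero]
        simp only [hE]; linarith [hE1 a, hE0 a, hE2 a]
  refine (norm_sum_le _ _).trans ((Finset.sum_le_sum hpt).trans ?_)
  have hLx : ∀ i, 0 ≤ L * x i := fun i => mul_nonneg (by linarith) (hx i)
  have hprodL : ∏ i, L * x i = L ^ k * ∏ i, x i := by
    rw [Finset.prod_mul_distrib]; simp
  have hS0 : ∑ a ∈ P, ∏ i, B i (a i) ≤ L ^ k * ∏ i, x i := by
    rw [← hprodL]; exact sum_piFinset_prod_le hB h5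
  -- In the last two kinds one coordinate gains the small factor τ, by smallness of the early sum or
  -- of a single late term, while every other coordinate costs at most `L`.
  have herase : ∀ j, τ * x j * ∏ i ∈ Finset.univ.erase j, L * x i ≤
      τ * L ^ k * ∏ i, x i := by
    intro j
    rw [mul_assoc τ (L ^ k), ← hprodL, ← Finset.mul_prod_erase _ _ (Finset.mem_univ j), mul_assoc]
    refine mul_le_mul_of_nonneg_left (mul_le_mul_of_nonneg_right ?_ ?_) hτ
    · exact le_mul_of_one_le_left (hx j) hL
    · exact Finset.prod_nonneg fun i _ => hLx i
  have hS1 : ∀ j, ∑ a ∈ P, (if a j ∉ l then ∏ i, B i (a i) else 0) ≤ τ * L ^ k * ∏ i, x i := by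
    intro j
    refine le_trans ?_ (herase j)
    let f : Fin k → ℕ → ℝ := fun i b => if i = j then (if b ∉ l then B i b else 0) else B i b
    have hf : ∀ i b, 0 ≤ f i b := by
      intro i b; simp only [f]; split_ifs <;> first | exact hB _ _ | norm_num
    have e1 : ∑ a ∈ P, (if a j ∉ l then ∏ i, B i (a i) else 0) = ∑ a ∈ P, ∏ i, f i (a i) := by
      refine Finset.sum_congr rfl fun a _ => ?_
      rw [← Finset.mul_prod_erase _ (fun i => f i (a i)) (Finset.mem_univ j),
        ← Finset.mul_prod_erase _ (fun i => B i (a i)) (Finset.mem_univ j)]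
      have : ∏ i ∈ Finset.univ.erase j, f i (a i) = ∏ i ∈ Finset.univ.erase j, B i (a i) :=
        Finset.prod_congr rfl fun i hi => by simp [f, Finset.ne_of_mem_erase hi]
      rw [this]
      by_cases h : a j ∈ l <;> simp [f, h]
    rw [e1]
    refine (sum_piFinset_prod_le hf
      (y := fun i => if i = j then τ * x j else L * x i) ?_).trans (le_of_eq ?_)
    · intro i
      by_cases hi : i = j
      · subst hi
        simp only [f, if_true]
        refine le_trans (le_of_eq ?_) (h6 i)
        rw [← Finset.sum_filter]
        congr 1
        ext b; simp
      · simpa [f, hi] using h5 i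
    · rw [← Finset.mul_prod_erase _ _ (Finset.mem_univ j), if_pos rfl]
      congr 1
      exact Finset.prod_congr rfl fun i hi => if_neg (Finset.ne_of_mem_erase hi)
  have hS2 : ∀ i j, ∑ a ∈ P, (if j ≠ i ∧ a i = a j ∧ a i ∈ l then ∏ i, B i (a i) else 0) ≤
      τ * L ^ k * ∏ i, x i := by
    intro i j
    by_cases hji : j ≠ i
    · refine le_trans ?_ (herase i)
      refine le_trans ?_ (mul_le_mul_of_nonneg_left (sum_piFinset_coincide_le hB h5 hji)
        (mul_nonneg hτ (hx i)))
      rw [Finset.mul_sum]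
      refine Finset.sum_le_sum fun a _ => ?_
      by_cases h : a i = a j
      · by_cases h' : a i ∈ l
        · rw [if_pos ⟨hji, h, h'⟩, if_pos h, ← Finset.mul_prod_erase _ _ (Finset.mem_univ i)]
          exact mul_le_mul_of_nonneg_right (h4 i _ h') (Finset.prod_nonneg fun l _ => hB l _)
        · rw [if_neg (fun hh => h' hh.2.2), if_pos h]
          exact mul_nonneg (mul_nonneg hτ (hx i)) (Finset.prod_nonneg fun l _ => hB l _)
      · rw [if_neg (fun hh => h hh.2.1), if_neg h, mul_zero]
    · have hL0 : 0 ≤ L ^ k := by positivity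
      simp only [hji, false_and, if_false, Finset.sum_const_zero]
      positivity
  have hcard : (P.card : ℝ) = (s.card : ℝ) ^ k := by
    rw [hP, Fintype.card_piFinset]; simp
  simp only [hE, Finset.sum_add_distrib, ← Finset.mul_sum, Finset.sum_const, nsmul_eq_mul]
  rw [hcard]
  have t0 : τ * ∑ a ∈ P, ∏ i, B i (a i) ≤ τ * L ^ k * ∏ i, x i := by
    rw [mul_assoc]; exact mul_le_mul_of_nonneg_left hS0 hτ
  have t1 : ∑ a ∈ P, ∑ j, (if a j ∉ l then ∏ i, B i (a i) else 0) ≤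
      k * (τ * L ^ k * ∏ i, x i) := by
    rw [Finset.sum_comm]
    refine (Finset.sum_le_sum fun j _ => hS1 j).trans (le_of_eq ?_)
    simp
  have t2 : ∑ a ∈ P, ∑ i, ∑ j, (if j ≠ i ∧ a i = a j ∧ a i ∈ l then ∏ i, B i (a i) else 0) ≤
      k * (k * (τ * L ^ k * ∏ i, x i)) := by
    rw [Finset.sum_comm]
    refine (Finset.sum_le_sum (g := fun _ => k * (τ * L ^ k * ∏ i, x i)) fun i _ => ?_).trans
      (le_of_eq (by simp))
    rw [Finset.sum_comm]
    exact (Finset.sum_le_sum fun j _ => hS2 i j).trans (le_of_eq (by simp))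
  linarith

end FiniteSums

end WRT

end

/-! ### Laplace transforms of mixed Poisson tails and their Riemann sums. -/

noncomputable section

namespace WRT

section Laplace

set_option linter.unusedSectionVars false

lemma integrableOn_exp_mul_poissonTail {z : ℂ} {l : ℝ} (hz : 0 < z.re) (hl : 0 ≤ l) (D : ℕ) :
    IntegrableOn (fun t : ℝ => Complex.exp (-z * t) * ((poissonTail D (l * t) : ℝ) : ℂ))
      (Set.Ioi 0) := by
  have h1 : IntegrableOn (fun t : ℝ => Real.exp (-z.re * t)) (Set.Ioi 0) :=
    exp_neg_integrableOn_Ioi 0 hz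
  refine Integrable.mono' h1 ?_ ?_
  · refine Continuous.aestronglyMeasurable ?_
    have := continuous_poissonTail D
    fun_prop
  · refine (ae_restrict_mem measurableSet_Ioi).mono fun t ht => ?_
    have ht' : 0 ≤ l * t := mul_nonneg hl (le_of_lt ht)
    rw [norm_mul, Complex.norm_exp, Complex.norm_real, Real.norm_eq_abs,
      abs_of_nonneg (poissonTail_nonneg D ht')]
    have : (-z * (t : ℂ)).re = -z.re * t := by simp
    rw [this]
    exact mul_le_of_le_one_right (Real.exp_pos _).le (poissonTail_le_one D ht')

/-- The `D`-th point of a Poisson process of rate `l` is a sum of `D` exponential variables, whence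
the power. In the induction, integrating the derivative of exp (-z t) times the tail at `D + 1`
shows that raising `D` by one multiplies the integral by l / (l + z). -/
lemma integral_exp_mul_poissonTail {z : ℂ} {l : ℝ} (hz : 0 < z.re) (hl : 0 ≤ l) (D : ℕ) :
    ∫ t in Set.Ioi (0 : ℝ), Complex.exp (-z * t) * ((poissonTail D (l * t) : ℝ) : ℂ) =
      1 / z * (l / (l + z)) ^ D := by
  have hz0 : z ≠ 0 := fun h0 => by rw [h0] at hz; simp at hz
  have hr : 0 < ((l : ℂ) + z).re := by simp; linarith
  have hne : (l : ℂ) + z ≠ 0 := fun h0 => by rw [h0] at hr; simp at hr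
  induction D with
  | zero =>
    simp only [poissonTail_zero, Complex.ofReal_one, mul_one, pow_zero]
    have := integral_exp_mul_complex_Ioi (a := -z) (by simpa using hz) 0
    rw [this]; simp
  | succ D ih =>
    have hi1 := integrableOn_exp_mul_poissonTail hz hl D
    have hi2 := integrableOn_exp_mul_poissonTail hz hl (D + 1)
    have hd : ∀ t : ℝ, HasDerivAt
        (fun t : ℝ => Complex.exp (-z * t) * ((poissonTail (D + 1) (l * t) : ℝ) : ℂ))
        (l * (Complex.exp (-z * t) * ((poissonTail D (l * t) : ℝ) : ℂ)) -
          (l + z) * (Complex.exp (-z * t) * ((poissonTail (D + 1) (l * t) : ℝ) : ℂ))) t := by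
      intro t
      have h1 : HasDerivAt (fun t : ℝ => Complex.exp (-z * t)) (Complex.exp (-z * t) * (-z)) t := by
        have := ((hasDerivAt_id (t : ℂ)).const_mul (-z)).cexp.comp_ofReal
        simpa using this
      have h2 := hasDerivAt_poissonTail_line (D + 1) 0 l t
      simp only [zero_add, mul_comm _ l, Nat.add_sub_cancel] at h2
      refine HasDerivAt.congr_deriv (h1.mul h2.ofReal_comp) ?_
      push_cast
      ring
    have hlim : Tendsto
        (fun t : ℝ => Complex.exp (-z * t) * ((poissonTail (D + 1) (l * t) : ℝ) : ℂ)) atTop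
        (𝓝 0) := by
      refine squeeze_zero_norm' (a := fun t => Real.exp (-(z.re * t))) ?_ ?_
      · filter_upwards [eventually_ge_atTop 0] with t ht
        have ht' : 0 ≤ l * t := mul_nonneg hl ht
        rw [norm_mul, Complex.norm_exp, Complex.norm_real, Real.norm_eq_abs,
          abs_of_nonneg (poissonTail_nonneg _ ht')]
        have : (-z * (t : ℂ)).re = -(z.re * t) := by simp
        rw [this]
        exact mul_le_of_le_one_right (Real.exp_pos _).le (poissonTail_le_one _ ht')
      · exact Real.tendsto_exp_neg_atTop_nhds_zero.comp (tendsto_id.const_mul_atTop hz)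
    have h := integral_Ioi_of_hasDerivAt_of_tendsto' (a := 0) (fun t _ => hd t)
      ((hi1.const_mul (l : ℂ)).sub (hi2.const_mul ((l : ℂ) + z))) hlim
    rw [integral_sub (hi1.const_mul (l : ℂ)) (hi2.const_mul ((l : ℂ) + z)), integral_const_mul,
      integral_const_mul, ih] at h
    simp only [mul_zero, poissonTail_at_zero, Nat.add_one_ne_zero, if_false,
      Complex.ofReal_zero, sub_zero] at h
    rw [sub_eq_zero] at h
    rw [pow_succ]
    field_simp
    field_simp at h
    rw [h]
    ring

variable {Ω : Type*} [mΩ : MeasurableSpace Ω] {μ : Measure Ω} [IsProbabilityMeasure μ]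
  {V : Ω → ℝ} {M : ℝ}

lemma integrable_prod_poissonTail (hVm : Measurable V) (hV : ∀ᵐ ω ∂μ, 0 ≤ V ω) (hM : 0 < M)
    (D : ℕ) {z : ℂ} (hz : 0 < z.re) :
    Integrable (fun q : Ω × ℝ =>
      Complex.exp (-z * q.2) * ((poissonTail D (V q.1 / M * q.2) : ℝ) : ℂ))
      (μ.prod (volume.restrict (Set.Ioi 0))) := by
  have h1 : Integrable (fun t : ℝ => Real.exp (-z.re * t)) (volume.restrict (Set.Ioi 0)) :=
    exp_neg_integrableOn_Ioi 0 hz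
  have h2 : Integrable (fun q : Ω × ℝ => (1 : ℝ) * Real.exp (-z.re * q.2))
      (μ.prod (volume.restrict (Set.Ioi 0))) := (integrable_const (1 : ℝ)).mul_prod h1
  refine Integrable.mono' h2 ?_ ?_
  · refine Measurable.aestronglyMeasurable ?_
    have hp : Measurable fun q : Ω × ℝ => poissonTail D (V q.1 / M * q.2) :=
      (continuous_poissonTail D).measurable.comp (by fun_prop)
    fun_prop
  · have h3 : ∀ᵐ q ∂(μ.prod (volume.restrict (Set.Ioi (0 : ℝ)))), 0 ≤ V q.1 :=
      Measure.quasiMeasurePreserving_fst.ae hV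
    have h4 : ∀ᵐ q ∂(μ.prod (volume.restrict (Set.Ioi (0 : ℝ)))), q.2 ∈ Set.Ioi (0 : ℝ) :=
      Measure.quasiMeasurePreserving_snd.ae (ae_restrict_mem measurableSet_Ioi)
    filter_upwards [h3, h4] with q h3 h4
    have h5 : 0 ≤ V q.1 / M * q.2 := mul_nonneg (div_nonneg h3 hM.le) (le_of_lt h4)
    rw [norm_mul, Complex.norm_exp, Complex.norm_real, Real.norm_eq_abs,
      abs_of_nonneg (poissonTail_nonneg D h5)]
    have : (-z * (q.2 : ℂ)).re = -z.re * q.2 := by simp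
    rw [this, one_mul]
    exact mul_le_of_le_one_right (Real.exp_pos _).le (poissonTail_le_one D h5)

lemma integral_exp_mul_poissonTail_ofReal (D : ℕ) (z : ℂ) (t : ℝ) :
    ∫ ω, Complex.exp (-z * t) * ((poissonTail D (V ω / M * t) : ℝ) : ℂ) ∂μ =
      Complex.exp (-z * t) * (poissonMix μ V M D t : ℂ) := by
  rw [integral_const_mul, poissonMix]
  congr 1
  exact integral_ofReal

lemma integrableOn_exp_mul_poissonMix (hVm : Measurable V) (hV : ∀ᵐ ω ∂μ, 0 ≤ V ω) (hM : 0 < M)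
    (D : ℕ) {z : ℂ} (hz : 0 < z.re) :
    IntegrableOn (fun t : ℝ => Complex.exp (-z * t) * (poissonMix μ V M D t : ℂ))
      (Set.Ioi 0) := by
  have := (integrable_prod_poissonTail hVm hV hM D hz).integral_prod_right
  simp only [integral_exp_mul_poissonTail_ofReal] at this
  exact this

/-- The Laplace transform of the mixed Poisson tail. -/
lemma integral_exp_mul_poissonMix (hVm : Measurable V) (hV : ∀ᵐ ω ∂μ, 0 ≤ V ω) (hM : 0 < M)
    (D : ℕ) {z : ℂ} (hz : 0 < z.re) :
    ∫ t in Set.Ioi (0 : ℝ), Complex.exp (-z * t) * (poissonMix μ V M D t : ℂ) =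
      1 / z * ∫ ω, (V ω / (V ω + M * z)) ^ D ∂μ := by
  have h := integral_integral_swap (f := fun (ω : Ω) (t : ℝ) =>
    Complex.exp (-z * t) * ((poissonTail D (V ω / M * t) : ℝ) : ℂ)) (integrable_prod_poissonTail hVm hV hM D hz)
  simp only [integral_exp_mul_poissonTail_ofReal] at h
  rw [← h, ← integral_const_mul]
  refine integral_congr_ae ?_
  filter_upwards [hV] with ω hω
  rw [integral_exp_mul_poissonTail hz (div_nonneg hω hM.le)]
  congr 2
  have hM' : (M : ℂ) ≠ 0 := by exact_mod_cast hM.ne'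
  have hr : 0 < ((V ω : ℂ) + M * z).re := by
    simp; positivity
  have hne : (V ω : ℂ) + M * z ≠ 0 := fun h0 => by rw [h0] at hr; simp at hr
  have hne' : (V ω : ℂ) / M + z ≠ 0 := by
    intro h0
    apply hne
    field_simp at h0
    simpa using h0
  push_cast
  field_simp

/-- The derivative is `l` times a difference of two tails, both controlled by Chernoff at 1 + M. The
Lipschitz constant therefore keeps the factor `(1 + M) ^ D` in the denominator, as a relative error
estimate requires. -/
lemma abs_poissonTail_sub_le {D : ℕ} {l t t' : ℝ} (hl : 0 ≤ l) (hM : 0 < M) (hlM : l * M ≤ 1)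
    (ht : 0 ≤ t) (htt : t ≤ t') :
    |poissonTail D (l * t') - poissonTail D (l * t)| ≤
      (1 + M) / M * (((1 + M) ^ D)⁻¹ * Real.exp t') * (t' - t) := by
  have hd : ∀ x ∈ Set.Icc t t', HasDerivWithinAt (fun x => poissonTail D (l * x))
      (l * (poissonTail (D - 1) (l * x) - poissonTail D (l * x))) (Set.Icc t t') x := by
    intro x _
    have := hasDerivAt_poissonTail_line D 0 l x
    simp only [zero_add, mul_comm _ l] at this
    exact this.hasDerivWithinAt
  have hbd : ∀ x ∈ Set.Icc t t',
      ‖l * (poissonTail (D - 1) (l * x) - poissonTail D (l * x))‖ ≤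
        (1 + M) / M * (((1 + M) ^ D)⁻¹ * Real.exp t') := by
    intro x hx
    have hx0 : 0 ≤ l * x := mul_nonneg hl (ht.trans hx.1)
    have hb : ∀ d, D ≤ d + 1 → poissonTail d (l * x) ≤ (1 + M) * (((1 + M) ^ D)⁻¹ * Real.exp t') := by
      intro d hd
      refine (poissonTail_le d (s := 1 + M) (by linarith) hx0).trans ?_
      rw [← mul_assoc (1 + M)]
      refine mul_le_mul ?_ (Real.exp_le_exp.2 ?_) (Real.exp_pos _).le (by positivity)
      · rw [← div_eq_mul_inv, le_div_iff₀ (by positivity), inv_mul_le_iff₀ (by positivity),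
          ← pow_succ]
        exact pow_le_pow_right₀ (by linarith) hd
      · have h0 : 0 ≤ x := ht.trans hx.1
        calc (1 + M - 1) * (l * x) = (l * M) * x := by ring
          _ ≤ 1 * x := mul_le_mul_of_nonneg_right hlM h0
          _ ≤ t' := by linarith [hx.2]
    have h1 := hb (D - 1) (by omega)
    have h2 := hb D (by omega)
    have h3 := poissonTail_nonneg (D - 1) hx0
    have h4 := poissonTail_nonneg D hx0
    rw [norm_mul, Real.norm_eq_abs, Real.norm_eq_abs, abs_of_nonneg hl]
    have h5 : |poissonTail (D - 1) (l * x) - poissonTail D (l * x)| ≤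
        (1 + M) * (((1 + M) ^ D)⁻¹ * Real.exp t') := by
      rw [abs_le]; constructor <;> linarith
    have h6 : l ≤ 1 / M := by rwa [le_div_iff₀ hM]
    refine (mul_le_mul h6 h5 (abs_nonneg _) (by positivity)).trans (le_of_eq ?_)
    ring
  have := (convex_Icc t t').norm_image_sub_le_of_norm_hasDerivWithin_le hd hbd
    (Set.left_mem_Icc.2 htt) (Set.right_mem_Icc.2 htt)
  rw [Real.norm_eq_abs, Real.norm_eq_abs, abs_of_nonneg (sub_nonneg.2 htt)] at this
  exact this

lemma abs_poissonMix_sub_le (hVm : Measurable V) (hV : ∀ᵐ ω ∂μ, V ω ∈ Set.Icc 0 1) (hM : 0 < M)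
    (D : ℕ) {t t' : ℝ} (ht : 0 ≤ t) (htt : t ≤ t') :
    |poissonMix μ V M D t' - poissonMix μ V M D t| ≤
      (1 + M) / M * (((1 + M) ^ D)⁻¹ * Real.exp t') * (t' - t) := by
  have hV0 : ∀ᵐ ω ∂μ, 0 ≤ V ω := hV.mono fun _ h => h.1
  unfold poissonMix
  rw [← integral_sub (integrable_poissonTail hVm hV0 hM D (ht.trans htt))
    (integrable_poissonTail hVm hV0 hM D ht)]
  rw [← Real.norm_eq_abs]
  refine (norm_integral_le_of_norm_le_const (C := (1 + M) / M * (((1 + M) ^ D)⁻¹ * Real.exp t') *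
    (t' - t)) ?_).trans_eq (by rw [probReal_univ, mul_one])
  filter_upwards [hV] with ω h
  refine abs_poissonTail_sub_le (div_nonneg h.1 hM.le) hM ?_ ht htt
  rw [div_mul_cancel₀ _ hM.ne']
  exact h.2

lemma norm_exp_mul_poissonMix_sub_le (hVm : Measurable V) (hV : ∀ᵐ ω ∂μ, V ω ∈ Set.Icc 0 1)
    (hM : 0 < M) (D : ℕ) (ξ : ℝ) {t t' : ℝ} (ht : 0 ≤ t) (htt : t ≤ t') :
    ‖Complex.exp (ξ * t' * Complex.I) * (poissonMix μ V M D t' : ℂ) -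
      Complex.exp (ξ * t * Complex.I) * (poissonMix μ V M D t : ℂ)‖ ≤
      (|ξ| + (1 + M) / M) * (((1 + M) ^ D)⁻¹ * Real.exp t') * (t' - t) := by
  have hV0 : ∀ᵐ ω ∂μ, 0 ≤ V ω := hV.mono fun _ h => h.1
  have ht' := ht.trans htt
  have e : Complex.exp (ξ * t' * Complex.I) * (poissonMix μ V M D t' : ℂ) -
      Complex.exp (ξ * t * Complex.I) * (poissonMix μ V M D t : ℂ) =
      (Complex.exp (ξ * t' * Complex.I) - Complex.exp (ξ * t * Complex.I)) *
        (poissonMix μ V M D t' : ℂ) +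
      Complex.exp (ξ * t * Complex.I) *
        ((poissonMix μ V M D t' - poissonMix μ V M D t : ℝ) : ℂ) := by
    push_cast; ring
  rw [e]
  refine (norm_add_le _ _).trans ?_
  rw [norm_mul, norm_mul, Complex.norm_real, Complex.norm_real]
  have h1 : ‖Complex.exp (ξ * t * Complex.I)‖ = 1 := by
    rw [← Complex.ofReal_mul]; exact Complex.norm_exp_ofReal_mul_I _
  have h2 : ‖Complex.exp (ξ * t' * Complex.I) - Complex.exp (ξ * t * Complex.I)‖ ≤
      |ξ| * (t' - t) := by
    have : Complex.exp (ξ * t' * Complex.I) - Complex.exp (ξ * t * Complex.I) =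
        Complex.exp (ξ * t * Complex.I) *
          (Complex.exp (Complex.I * ((ξ * (t' - t) : ℝ) : ℂ)) - 1) := by
      rw [mul_sub, ← Complex.exp_add, mul_one]
      congr 2; push_cast; ring
    rw [this, norm_mul, h1, one_mul]
    refine (Real.norm_exp_I_mul_ofReal_sub_one_le).trans (le_of_eq ?_)
    rw [norm_mul, Real.norm_eq_abs, Real.norm_eq_abs, abs_of_nonneg (sub_nonneg.2 htt)]
  have h3 := poissonMix_le hVm hV hM zero_le_one D ht'
  simp only [mul_one, one_mul] at h3
  have h4 := poissonMix_nonneg hV0 hM D ht'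
  have h5 := abs_poissonMix_sub_le hVm hV hM D ht htt
  rw [h1, one_mul, Real.norm_eq_abs, Real.norm_eq_abs, abs_of_nonneg h4]
  have h6 := mul_le_mul h2 h3 h4 (mul_nonneg (abs_nonneg _) (sub_nonneg.2 htt))
  linarith

/-- The sum `N⁻¹ ∑ b, exp (i ξ log (N / b)) f (log (N / b))` over the late vertices. -/
def charSum (μ : Measure Ω) (V : Ω → ℝ) (M : ℝ) (D A N : ℕ) (ξ : ℝ) : ℂ :=
  1 / N * ∑ b ∈ Finset.Icc A N, Complex.exp (ξ * Real.log (N / b) * Complex.I) *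
    (poissonMix μ V M D (Real.log (N / b)) : ℂ)

/-- The integral which `charSum` approximates. -/
def charInt (μ : Measure Ω) (V : Ω → ℝ) (M : ℝ) (D : ℕ) (ξ : ℝ) : ℂ :=
  1 / (1 - ξ * Complex.I) * ∫ ω, (V ω / (V ω + M * (1 - ξ * Complex.I))) ^ D ∂μ

/-- In the variable t = log (N / b), the cell between b = m + 1 and b = m has mass exactly 1 / N for
exp (-t) dt. The summand is thus the integral over the cell with the remaining factor frozen at its
lower end. The cell length 1 / m and the Lipschitz constant, which carries N / m, combine to an
error of order m ^ (-2). -/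
lemma norm_sub_cell_le (hVm : Measurable V) (hV : ∀ᵐ ω ∂μ, V ω ∈ Set.Icc 0 1) (hM : 0 < M)
    (D : ℕ) (ξ : ℝ) {m N : ℕ} (hm : 1 ≤ m) (hmN : m < N) :
    ‖(1 / N : ℂ) * (Complex.exp (ξ * Real.log (N / (m + 1 : ℕ)) * Complex.I) *
      (poissonMix μ V M D (Real.log (N / (m + 1 : ℕ))) : ℂ)) -
      ∫ t in (Real.log (N / (m + 1 : ℕ)))..(Real.log (N / m)),
        Complex.exp (-(1 - ξ * Complex.I) * t) * (poissonMix μ V M D t : ℂ)‖ ≤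
      (|ξ| + (1 + M) / M) * ((1 + M) ^ D)⁻¹ * (m : ℝ) ^ (-(5 / 4) : ℝ) := by
  have hm0 : (0 : ℝ) < m := by exact_mod_cast hm
  have hm1 : (1 : ℝ) ≤ m := by exact_mod_cast hm
  have hN0 : (0 : ℝ) < N := by exact_mod_cast (hm.trans hmN.le)
  set t₀ := Real.log (N / (m + 1 : ℕ)) with ht₀
  set t₁ := Real.log ((N : ℝ) / m) with ht₁
  have h0 : 0 ≤ t₀ := by
    refine Real.log_nonneg ?_
    rw [one_le_div (by positivity)]
    exact_mod_cast hmN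
  have hsub : t₁ - t₀ ≤ 1 / m := by
    rw [ht₀, ht₁, Real.log_div hN0.ne' hm0.ne', Real.log_div hN0.ne' (by positivity)]
    have := (log_succ_sub_log_bounds hm).2.1
    linarith
  have h01 : t₀ ≤ t₁ := by
    rw [ht₀, ht₁, Real.log_div hN0.ne' hm0.ne', Real.log_div hN0.ne' (by positivity)]
    have := (log_succ_sub_log_bounds hm).1
    linarith
  have he1 : Real.exp t₁ = N / m := Real.exp_log (by positivity)
  have hint : ∫ t in t₀..t₁, Real.exp (-t) = 1 / N := by
    have : ∀ x ∈ Set.uIcc t₀ t₁, HasDerivAt (fun t => -Real.exp (-t)) (Real.exp (-x)) x := by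
      intro x _
      exact HasDerivAt.congr_deriv ((hasDerivAt_neg x).exp).neg (by ring)
    rw [intervalIntegral.integral_eq_sub_of_hasDerivAt this
      (Continuous.intervalIntegrable (by fun_prop) _ _)]
    rw [Real.exp_neg, Real.exp_neg, he1, ht₀, Real.exp_log (by positivity)]
    push_cast
    field_simp
    ring
  set H : ℝ → ℂ := fun t => Complex.exp (ξ * t * Complex.I) * (poissonMix μ V M D t : ℂ) with hH
  have hsplit : ∀ t : ℝ, Complex.exp (-(1 - ξ * Complex.I) * t) * (poissonMix μ V M D t : ℂ) =
      ((Real.exp (-t) : ℝ) : ℂ) * H t := by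
    intro t
    simp only [hH, ← mul_assoc]
    congr 1
    push_cast
    rw [← Complex.exp_add]; congr 1; ring
  have hii : IntervalIntegrable
      (fun t : ℝ => Complex.exp (-(1 - ξ * Complex.I) * t) * (poissonMix μ V M D t : ℂ))
      volume t₀ t₁ := by
    rw [intervalIntegrable_iff_integrableOn_Ioc_of_le h01]
    refine (integrableOn_exp_mul_poissonMix hVm (hV.mono fun _ h => h.1) hM D
      (z := 1 - ξ * Complex.I) (by simp)).mono_set ?_
    exact fun t ht => lt_of_le_of_lt h0 ht.1
  have hi2 : IntervalIntegrable (fun t : ℝ => ((Real.exp (-t) : ℝ) : ℂ) * H t₀) volume t₀ t₁ :=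
    Continuous.intervalIntegrable (by fun_prop) _ _
  have hconst : (1 / N : ℂ) * H t₀ = ∫ t in t₀..t₁, ((Real.exp (-t) : ℝ) : ℂ) * H t₀ := by
    rw [intervalIntegral.integral_mul_const, intervalIntegral.integral_ofReal, hint]
    push_cast; rfl
  change ‖(1 / N : ℂ) * H t₀ - _‖ ≤ _
  rw [hconst, ← intervalIntegral.integral_sub hi2 hii]
  set C := (|ξ| + (1 + M) / M) * (((1 + M) ^ D)⁻¹ * Real.exp t₁) * (t₁ - t₀) with hC
  have hbd : ∀ t ∈ Set.Ioc t₀ t₁, ‖((Real.exp (-t) : ℝ) : ℂ) * H t₀ -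
      Complex.exp (-(1 - ξ * Complex.I) * t) * (poissonMix μ V M D t : ℂ)‖ ≤
      Real.exp (-t) * C := by
    intro t ht
    rw [hsplit, ← mul_sub, norm_mul, Complex.norm_real, Real.norm_eq_abs,
      abs_of_pos (Real.exp_pos _), norm_sub_rev]
    refine mul_le_mul_of_nonneg_left ?_ (Real.exp_pos _).le
    refine (norm_exp_mul_poissonMix_sub_le hVm hV hM D ξ h0 ht.1.le).trans ?_
    rw [hC]
    have a1 : Real.exp t ≤ Real.exp t₁ := Real.exp_le_exp.2 ht.2
    have a2 : 0 ≤ t - t₀ := by linarith [ht.1]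
    have a3 : t - t₀ ≤ t₁ - t₀ := by linarith [ht.2]
    gcongr
  refine (intervalIntegral.norm_integral_le_of_norm_le h01 (Eventually.of_forall hbd)
    (Continuous.intervalIntegrable (by fun_prop) _ _)).trans ?_
  rw [intervalIntegral.integral_mul_const, hint, hC, he1]
  have hfin : 1 / (N : ℝ) * ((|ξ| + (1 + M) / M) * (((1 + M) ^ D)⁻¹ * (N / m)) * (t₁ - t₀)) =
      (|ξ| + (1 + M) / M) * ((1 + M) ^ D)⁻¹ * ((1 / m) * (t₁ - t₀)) := by
    field_simp
  rw [hfin]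
  refine mul_le_mul_of_nonneg_left ?_ (by positivity)
  calc 1 / (m : ℝ) * (t₁ - t₀) ≤ 1 / m * (1 / m) :=
        mul_le_mul_of_nonneg_left hsub (by positivity)
    _ = 1 / (m : ℝ) ^ 2 := by ring
    _ ≤ _ := by
        rw [one_div, ← Real.rpow_natCast, ← Real.rpow_neg hm0.le]
        exact Real.rpow_le_rpow_of_exponent_le hm1 (by norm_num)

/-- The cells fill [0, log (N / A)]; what remains is the single term b = A and the integral beyond
log (N / A). For the latter the bound with σ = 1 would not be integrable, hence the assumption σ <
1. -/
lemma norm_charSum_sub_charInt_le (hVm : Measurable V) (hV : ∀ᵐ ω ∂μ, V ω ∈ Set.Icc 0 1)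
    (hM : 0 < M) (D : ℕ) (ξ : ℝ) {σ : ℝ} (hσ0 : 0 ≤ σ) (hσ1 : σ < 1) {A N : ℕ} (hA : 1 ≤ A)
    (hAN : A ≤ N) :
    ‖charSum μ V M D A N ξ - charInt μ V M D ξ‖ ≤
      ((1 + M) ^ D)⁻¹ * ((|ξ| + (1 + M) / M) * zetaConst * (A : ℝ) ^ (-(1 / 8) : ℝ) + 1 / A) +
      ((1 + M * σ) ^ D)⁻¹ * (((A : ℝ) / N) ^ (1 - σ) / (1 - σ)) := by
  have hA0 : (0 : ℝ) < A := by exact_mod_cast hA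
  have hN0 : (0 : ℝ) < N := by exact_mod_cast (hA.trans hAN)
  have hV0 : ∀ᵐ ω ∂μ, 0 ≤ V ω := hV.mono fun _ h => h.1
  have hMσ : 0 ≤ M * σ := by positivity
  set H : ℝ → ℂ := fun t => Complex.exp (ξ * t * Complex.I) * (poissonMix μ V M D t : ℂ) with hH
  set G : ℝ → ℂ := fun t =>
    Complex.exp (-(1 - ξ * Complex.I) * t) * (poissonMix μ V M D t : ℂ) with hG
  have hGi : IntegrableOn G (Set.Ioi 0) :=
    integrableOn_exp_mul_poissonMix hVm hV0 hM D (z := 1 - ξ * Complex.I) (by simp)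
  set T := Real.log ((N : ℝ) / A) with hT
  have hT0 : 0 ≤ T := Real.log_nonneg (by rw [one_le_div hA0]; exact_mod_cast hAN)
  have hJ : charInt μ V M D ξ = (∫ t in (0 : ℝ)..T, G t) + ∫ t in Set.Ioi T, G t := by
    have h1 := integral_exp_mul_poissonMix hVm hV0 hM D (z := 1 - ξ * Complex.I) (by simp)
    rw [charInt, ← h1, intervalIntegral.integral_of_le hT0,
      ← setIntegral_union (Set.Ioc_disjoint_Ioi le_rfl) measurableSet_Ioi
        (hGi.mono_set Set.Ioc_subset_Ioi_self) (hGi.mono_set (Set.Ioi_subset_Ioi hT0)),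
      Set.Ioc_union_Ioi_eq_Ioi hT0]
  have hsum : charSum μ V M D A N ξ = 1 / N * H T + ∑ m ∈ Finset.Ico A N,
      (1 / N : ℂ) * H (Real.log (N / (m + 1 : ℕ))) := by
    rw [charSum, ← Finset.mul_sum, ← mul_add]
    congr 1
    rw [← Finset.Ico_succ_right_eq_Icc, Order.succ_eq_add_one,
      Finset.sum_eq_sum_Ico_succ_bot (by omega)]
    rw [← Finset.sum_Ico_add' (fun b : ℕ => Complex.exp (ξ * Real.log (N / b) * Complex.I) *
      (poissonMix μ V M D (Real.log (N / b)) : ℂ)) A N 1]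
  have hcells : ∑ m ∈ Finset.Ico A N,
      ∫ t in (Real.log (N / (m + 1 : ℕ)))..(Real.log (N / m)), G t = ∫ t in (0 : ℝ)..T, G t := by
    have h := intervalIntegral.sum_integral_adjacent_intervals_Ico (f := G) (μ := volume)
      (a := fun m : ℕ => Real.log (N / m)) hAN ?_
    · have hNN : Real.log ((N : ℝ) / N) = 0 := by rw [div_self hN0.ne', Real.log_one]
      rw [hNN] at h
      rw [intervalIntegral.integral_symm T 0, ← hT] at *
      rw [← h, ← Finset.sum_neg_distrib]
      exact Finset.sum_congr rfl fun m _ => intervalIntegral.integral_symm _ _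
    · intro m hm
      have hm1 : 1 ≤ m := hA.trans hm.1
      have hm0 : (0 : ℝ) < m := by exact_mod_cast hm1
      have hge : ∀ j : ℕ, 1 ≤ j → j ≤ N → 0 ≤ Real.log ((N : ℝ) / j) := fun j h1 h2 => by
        refine Real.log_nonneg ?_
        rw [one_le_div (by exact_mod_cast h1)]
        exact_mod_cast h2
      rw [intervalIntegrable_iff]
      refine hGi.mono_set fun t ht => ?_
      rw [Set.uIoc, Set.mem_Ioc] at ht
      exact lt_of_le_of_lt (le_min (hge m hm1 hm.2.le) (hge (m + 1) (by omega) hm.2)) ht.1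
  have htail : ‖∫ t in Set.Ioi T, G t‖ ≤
      ((1 + M * σ) ^ D)⁻¹ * (((A : ℝ) / N) ^ (1 - σ) / (1 - σ)) := by
    have hi : IntegrableOn (fun t : ℝ => ((1 + M * σ) ^ D)⁻¹ * Real.exp (-(1 - σ) * t))
        (Set.Ioi T) := (exp_neg_integrableOn_Ioi T (by linarith)).const_mul _
    refine (norm_integral_le_of_norm_le hi ?_).trans (le_of_eq ?_)
    · refine (ae_restrict_mem measurableSet_Ioi).mono fun t ht => ?_
      have ht0 : 0 ≤ t := hT0.trans (le_of_lt ht)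
      rw [hG, norm_mul, Complex.norm_exp, Complex.norm_real, Real.norm_eq_abs,
        abs_of_nonneg (poissonMix_nonneg hV0 hM D ht0)]
      have hre : (-(1 - ξ * Complex.I) * (t : ℂ)).re = -t := by simp
      rw [hre]
      refine (mul_le_mul_of_nonneg_left (poissonMix_le hVm hV hM hσ0 D ht0)
        (Real.exp_pos _).le).trans (le_of_eq ?_)
      rw [mul_left_comm, ← Real.exp_add]
      congr 2; ring
    · rw [integral_const_mul, integral_exp_mul_Ioi (by linarith) T]
      congr 1
      rw [Real.rpow_def_of_pos (by positivity)]
      have : Real.log ((A : ℝ) / N) = -T := by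
        rw [hT, Real.log_div hA0.ne' hN0.ne', Real.log_div hN0.ne' hA0.ne']; ring
      rw [this, neg_div, neg_mul, div_neg, neg_neg]
      congr 2; ring
  have hfirst : ‖(1 / N : ℂ) * H T‖ ≤ ((1 + M) ^ D)⁻¹ * (1 / A) := by
    have h3 := poissonMix_le hVm hV hM zero_le_one D hT0
    simp only [mul_one, one_mul] at h3
    have h1 : ‖Complex.exp (ξ * T * Complex.I)‖ = 1 := by
      rw [← Complex.ofReal_mul]; exact Complex.norm_exp_ofReal_mul_I _
    rw [hH, norm_mul, norm_mul, h1, one_mul, Complex.norm_real, Real.norm_eq_abs,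
      abs_of_nonneg (poissonMix_nonneg hV0 hM D hT0)]
    have h2 : ‖(1 / N : ℂ)‖ = 1 / N := by simp
    rw [h2]
    refine (mul_le_mul_of_nonneg_left h3 (by positivity)).trans (le_of_eq ?_)
    rw [hT, Real.exp_log (by positivity)]
    field_simp
  have hmid : ‖∑ m ∈ Finset.Ico A N, ((1 / N : ℂ) * H (Real.log (N / (m + 1 : ℕ))) -
      ∫ t in (Real.log (N / (m + 1 : ℕ)))..(Real.log (N / m)), G t)‖ ≤
      (|ξ| + (1 + M) / M) * ((1 + M) ^ D)⁻¹ * (zetaConst * (A : ℝ) ^ (-(1 / 8) : ℝ)) := by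
    refine (norm_sum_le _ _).trans ?_
    have hK : 0 ≤ (|ξ| + (1 + M) / M) * ((1 + M) ^ D)⁻¹ := by positivity
    refine le_trans ?_ (mul_le_mul_of_nonneg_left (sum_Ico_rpow_le hA N) hK)
    rw [Finset.mul_sum]
    refine Finset.sum_le_sum fun m hm => ?_
    have hm' := Finset.mem_Ico.1 hm
    exact norm_sub_cell_le hVm hV hM D ξ (hA.trans hm'.1) hm'.2
  have hdec : charSum μ V M D A N ξ - charInt μ V M D ξ = (1 / N : ℂ) * H T +
      (∑ m ∈ Finset.Ico A N, ((1 / N : ℂ) * H (Real.log (N / (m + 1 : ℕ))) -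
        ∫ t in (Real.log (N / (m + 1 : ℕ)))..(Real.log (N / m)), G t)) -
      ∫ t in Set.Ioi T, G t := by
    rw [Finset.sum_sub_distrib, hcells, hsum, hJ]; ring
  rw [hdec]
  refine (norm_sub_le _ _).trans (add_le_add ((norm_add_le _ _).trans
    ((add_le_add hfirst hmid).trans (le_of_eq ?_))) htail)
  ring

end Laplace

end WRT

end

/-! ### The fraction-of-gamma law near its right endpoint. -/

noncomputable section

namespace WRT

section Tilt

set_option linter.unusedSectionVars false

/-- The normalising constant of the tail in terms of the variable `1 / (1 - x)`. -/
def tailConst (b c₁ w : ℝ) : ℝ :=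
  ((1 - w) ^ (-b) * Real.exp (-w / (c₁ * (1 - w))))⁻¹

lemma tailConst_pos {b c₁ w : ℝ} (hw : w < 1) : 0 < tailConst b c₁ w := by
  have : 0 < 1 - w := by linarith
  unfold tailConst
  positivity

/-- In the variable τ = 1 / (1 - x) the tail is exponential of rate 1 / c₁, up to a power of τ. -/
lemma gammaFractionTail_one_sub_inv (b w : ℝ) {c₁ τ : ℝ} (hc₁ : 0 < c₁) (hτ : 0 < τ) :
    gammaFractionTail b c₁ w (1 - 1 / τ) =
      tailConst b c₁ w * (τ ^ b * Real.exp (-(τ - 1) / c₁)) := by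
  unfold gammaFractionTail tailConst
  have h1 : 1 - (1 - 1 / τ) = τ⁻¹ := by rw [sub_sub_cancel, one_div]
  have h2 : -(1 - 1 / τ) / (c₁ * τ⁻¹) = -(τ - 1) / c₁ := by field_simp
  have h3 : τ⁻¹ ^ (-b) = τ ^ b := by
    rw [Real.inv_rpow hτ.le, Real.rpow_neg hτ.le, inv_inv]
  rw [h1, h2, h3]

lemma summable_tail (b : ℝ) {r : ℝ} (hr : 0 < r) :
    Summable fun n : ℕ => (n : ℝ) ^ b * Real.exp (-r * n) := by
  refine Summable.of_norm_bounded_eventually_nat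
    (Real.summable_pow_mul_exp_neg_nat_mul ⌈b⌉₊ hr) ?_
  filter_upwards [eventually_ge_atTop 1] with n hn
  have hn1 : (1 : ℝ) ≤ n := by exact_mod_cast hn
  rw [Real.norm_eq_abs, abs_of_nonneg (by positivity), ← Real.rpow_natCast]
  exact mul_le_mul_of_nonneg_right (Real.rpow_le_rpow_of_exponent_le hn1 (Nat.le_ceil b))
    (Real.exp_pos _).le

variable {Ω : Type*} [mΩ : MeasurableSpace Ω] {μ : Measure Ω} [IsProbabilityMeasure μ]
  {V : Ω → ℝ} {M b c₁ w : ℝ}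

lemma measure_one_sub_inv_le (hc₁ : 0 < c₁) (hw : w ∈ Set.Ioo (0 : ℝ) 1)
    (hV : ∀ x ∈ Set.Ico w 1, μ.real {ω | x ≤ V ω} = gammaFractionTail b c₁ w x) {τ : ℝ}
    (hτ : 1 / (1 - w) ≤ τ) :
    μ.real {ω | 1 - 1 / τ ≤ V ω} = tailConst b c₁ w * (τ ^ b * Real.exp (-(τ - 1) / c₁)) := by
  have hw1 : 0 < 1 - w := by linarith [hw.2]
  have hτ0 : 0 < τ := lt_of_lt_of_le (by positivity) hτ
  rw [hV _ ⟨?_, ?_⟩, gammaFractionTail_one_sub_inv b w hc₁ hτ0]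
  · have : 1 / τ ≤ 1 - w := by
      rw [div_le_iff₀ hτ0]; rw [div_le_iff₀ hw1] at hτ; linarith
    linarith
  · have : 0 < 1 / τ := by positivity
    linarith

/-- The lower bound is the normalisation at `w`. For the upper one, {V ≥ 1} lies in every {V ≥ 1 - 1
/ n}, and these probabilities tend to zero. -/
lemma ae_mem_Ico (hVm : Measurable V) (hc₁ : 0 < c₁) (hw : w ∈ Set.Ioo (0 : ℝ) 1)
    (hV : ∀ x ∈ Set.Ico w 1, μ.real {ω | x ≤ V ω} = gammaFractionTail b c₁ w x) :
    ∀ᵐ ω ∂μ, V ω ∈ Set.Ico w 1 := by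
  have hw1 : 0 < 1 - w := by linarith [hw.2]
  have h1 : ∀ᵐ ω ∂μ, w ≤ V ω := by
    have := hV w ⟨le_rfl, hw.2⟩
    have e : gammaFractionTail b c₁ w w = 1 := by
      unfold gammaFractionTail
      exact inv_mul_cancel₀ (by positivity)
    rw [e, measureReal_def, ENNReal.toReal_eq_one_iff] at this
    exact (prob_compl_eq_zero_iff (measurableSet_le measurable_const hVm)).2 this
  have h2 : μ.real {ω | 1 ≤ V ω} = 0 := by
    refine le_antisymm ?_ measureReal_nonneg
    have hlim := ((summable_tail b (r := 1 / c₁) (by positivity)).tendsto_atTop_zero.const_mul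
      (tailConst b c₁ w * Real.exp (1 / c₁)))
    rw [mul_zero] at hlim
    refine ge_of_tendsto hlim ?_
    filter_upwards [eventually_ge_atTop (max 1 ⌈1 / (1 - w)⌉₊)] with n hn
    have hn1 : 1 ≤ n := (le_max_left _ _).trans hn
    have hn0 : (0 : ℝ) < n := by exact_mod_cast hn1
    have hn2 : 1 / (1 - w) ≤ n := (Nat.le_ceil _).trans (by exact_mod_cast (le_max_right _ _).trans hn)
    have h3 := measure_one_sub_inv_le hc₁ hw hV hn2
    have h4 : μ.real {ω | 1 ≤ V ω} ≤ μ.real {ω | 1 - 1 / (n : ℝ) ≤ V ω} := by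
      refine measureReal_mono fun ω hω => ?_
      rw [Set.mem_ofPred_eq] at hω ⊢
      have : 0 < 1 / (n : ℝ) := by positivity
      linarith
    rw [h3] at h4
    refine h4.trans (le_of_eq ?_)
    have : Real.exp (-((n : ℝ) - 1) / c₁) = Real.exp (1 / c₁) * Real.exp (-(1 / c₁) * n) := by
      rw [← Real.exp_add]; congr 1; field_simp; ring
    rw [this]; ring
  have h3 : ∀ᵐ ω ∂μ, V ω < 1 := by
    rw [measureReal_eq_zero_iff] at h2
    filter_upwards [measure_eq_zero_iff_ae_notMem.1 h2] with ω hω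
    exact not_le.1 hω
  filter_upwards [h1, h3] with ω a1 a2 using ⟨a1, a2⟩

/-- Since 1 / (1 - V) has an exponential tail of rate 1 / c₁ up to powers, its exponential moments
below that rate are finite; the proof sums over the integer part of 1 / (1 - V). -/
lemma integrable_exp_div (hVm : Measurable V) (hc₁ : 0 < c₁) (hw : w ∈ Set.Ioo (0 : ℝ) 1)
    (hV : ∀ x ∈ Set.Ico w 1, μ.real {ω | x ≤ V ω} = gammaFractionTail b c₁ w x) {ρ : ℝ}
    (hρ0 : 0 ≤ ρ) (hρ : ρ < 1 / c₁) :
    Integrable (fun ω => Real.exp (ρ / (1 - V ω))) μ := by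
  have hae := ae_mem_Ico hVm hc₁ hw hV
  have hm : Measurable fun ω => Real.exp (ρ / (1 - V ω)) := by fun_prop
  refine ⟨hm.aestronglyMeasurable, ?_⟩
  rw [hasFiniteIntegral_iff_ofReal (Eventually.of_forall fun ω => (Real.exp_pos _).le)]
  let f : ℕ → Ω → ENNReal := fun n => Set.indicator {ω | (n : ℝ) ≤ 1 / (1 - V ω)}
    (fun _ => ENNReal.ofReal (Real.exp (ρ * (n + 1))))
  have hS : ∀ n : ℕ, MeasurableSet {ω | (n : ℝ) ≤ 1 / (1 - V ω)} := fun n =>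
    measurableSet_le measurable_const (by fun_prop)
  have hle : ∫⁻ ω, ENNReal.ofReal (Real.exp (ρ / (1 - V ω))) ∂μ ≤ ∫⁻ ω, ∑' n, f n ω ∂μ := by
    refine lintegral_mono_ae ?_
    filter_upwards [hae] with ω hω
    have h1 : 0 < 1 - V ω := by linarith [hω.2]
    have h2 : 0 ≤ 1 / (1 - V ω) := by positivity
    refine le_trans ?_ (ENNReal.le_tsum ⌊1 / (1 - V ω)⌋₊)
    simp only [f]
    rw [Set.indicator_of_mem (by rw [Set.mem_ofPred_eq]; exact Nat.floor_le h2)]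
    refine ENNReal.ofReal_le_ofReal (Real.exp_le_exp.2 ?_)
    rw [← mul_one_div]
    exact mul_le_mul_of_nonneg_left (Nat.lt_floor_add_one _).le hρ0
  refine hle.trans_lt ?_
  rw [lintegral_tsum fun n => (measurable_const.indicator (hS n)).aemeasurable]
  have hf : ∀ n, ∫⁻ ω, f n ω ∂μ = ENNReal.ofReal
      (Real.exp (ρ * (n + 1)) * μ.real {ω | (n : ℝ) ≤ 1 / (1 - V ω)}) := by
    intro n
    rw [lintegral_indicator_const (hS n), ENNReal.ofReal_mul (Real.exp_pos _).le, measureReal_def,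
      ENNReal.ofReal_toReal (measure_ne_top _ _)]
  rw [tsum_congr hf]
  have hsum : Summable fun n : ℕ =>
      Real.exp (ρ * (n + 1)) * μ.real {ω | (n : ℝ) ≤ 1 / (1 - V ω)} := by
    refine Summable.of_norm_bounded_eventually_nat
      ((summable_tail b (r := 1 / c₁ - ρ) (by linarith)).mul_left
        (Real.exp ρ * (tailConst b c₁ w * Real.exp (1 / c₁)))) ?_
    filter_upwards [eventually_ge_atTop (max 1 ⌈1 / (1 - w)⌉₊)] with n hn
    have hn1 : 1 ≤ n := (le_max_left _ _).trans hn
    have hn0 : (0 : ℝ) < n := by exact_mod_cast hn1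
    have hn2 : 1 / (1 - w) ≤ n := (Nat.le_ceil _).trans (by exact_mod_cast (le_max_right _ _).trans hn)
    have h3 := measure_one_sub_inv_le hc₁ hw hV hn2
    have h4 : μ.real {ω | (n : ℝ) ≤ 1 / (1 - V ω)} ≤ μ.real {ω | 1 - 1 / (n : ℝ) ≤ V ω} := by
      refine ENNReal.toReal_mono (measure_ne_top _ _) (measure_mono_ae ?_)
      filter_upwards [hae] with ω hω h5
      have h5' : (n : ℝ) ≤ 1 / (1 - V ω) := h5
      have h1 : 0 < 1 - V ω := by linarith [hω.2]
      have : 1 - V ω ≤ 1 / n := by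
        rw [le_div_iff₀ h1] at h5'; rw [le_div_iff₀ hn0]; linarith
      have h6 : 1 - 1 / (n : ℝ) ≤ V ω := by linarith
      exact h6
    rw [Real.norm_eq_abs, abs_of_nonneg (mul_nonneg (Real.exp_pos _).le measureReal_nonneg)]
    refine (mul_le_mul_of_nonneg_left (h4.trans_eq h3) (Real.exp_pos _).le).trans (le_of_eq ?_)
    have e1 : Real.exp (-((n : ℝ) - 1) / c₁) = Real.exp (1 / c₁) * Real.exp (-(1 / c₁) * n) := by
      rw [← Real.exp_add]; congr 1; field_simp; ring
    have e2 : Real.exp (-(1 / c₁ - ρ) * n) = Real.exp (ρ * n) * Real.exp (-(1 / c₁) * n) := by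
      rw [← Real.exp_add]; congr 1; ring
    rw [e1, e2, mul_add, mul_one, Real.exp_add]
    ring
  rw [← ENNReal.ofReal_tsum_of_nonneg
    (fun n => mul_nonneg (Real.exp_pos _).le measureReal_nonneg) hsum]
  exact ENNReal.ofReal_lt_top

/-- The total mass `𝔼[(V / (V + M)) ^ D]`. -/
def tiltMass (μ : Measure Ω) (V : Ω → ℝ) (M : ℝ) (D : ℕ) : ℝ := ∫ ω, (V ω / (V ω + M)) ^ D ∂μ

lemma scaled_ratio_eq {x : ℝ} (hM : 0 < M) (hx : x < 1) :
    (1 + M) * ((1 - x) / (1 - x + M)) = 1 - M * x / (1 + M - x) := by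
  have h1 : 1 - x + M ≠ 0 := by linarith
  have h2 : 1 + M - x ≠ 0 := by linarith
  field_simp
  ring

lemma scaled_ratio_le {x : ℝ} (hM : 0 < M) (hx0 : 0 ≤ x) (hx : x < 1) :
    (1 + M) * ((1 - x) / (1 - x + M)) ≤ Real.exp (-(M / (1 + M) * x)) := by
  rw [scaled_ratio_eq hM hx]
  have h : M / (1 + M) * x ≤ M * x / (1 + M - x) := by
    rw [div_mul_eq_mul_div]
    exact div_le_div_of_nonneg_left (by positivity) (by linarith) (by linarith)
  linarith [Real.add_one_le_exp (-(M / (1 + M) * x))]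

lemma exp_neg_sub_sq_le {t : ℝ} (h0 : 0 ≤ t) (h1 : t ≤ 1 / 2) :
    Real.exp (-t - t ^ 2) ≤ 1 - t := by
  have h2 : 1 / (1 - t) ≤ Real.exp (t + t ^ 2) := by
    have h3 := Real.add_one_le_exp (t + t ^ 2)
    have h4 := Real.quadratic_le_exp_of_nonneg (show 0 ≤ t + t ^ 2 by positivity)
    refine le_trans ?_ h4
    rw [div_le_iff₀ (by linarith)]
    nlinarith [mul_nonneg h0 h0, mul_nonneg (mul_nonneg h0 h0) h0, mul_nonneg (mul_nonneg h0 h0)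
      (sub_nonneg.2 h1), pow_nonneg h0 4, mul_nonneg (pow_nonneg h0 3) (sub_nonneg.2 h1),
      mul_nonneg (pow_nonneg h0 4) (sub_nonneg.2 h1)]
  have h5 : Real.exp (-t - t ^ 2) = (Real.exp (t + t ^ 2))⁻¹ := by
    rw [← Real.exp_neg]; congr 1; ring
  rw [h5, inv_le_comm₀ (Real.exp_pos _) (by linarith)]
  simpa using h2

end Tilt

end WRT

end

/-! ### Size of the tilted mass and concentration of the tilted weight. -/

noncomputable section

namespace WRT

section Concentration

set_option linter.unusedSectionVars false

variable {Ω : Type*} [mΩ : MeasurableSpace Ω] {μ : Measure Ω} [IsProbabilityMeasure μ]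
  {V : Ω → ℝ} {M b c₁ w : ℝ}

/-- The tilted law of `√D * (1 - V)` concentrates at this value. -/
def tiltCenter (c₁ M : ℝ) : ℝ := √((1 + M) / (c₁ * M))

lemma tiltCenter_pos (hc₁ : 0 < c₁) (hM : 0 < M) : 0 < tiltCenter c₁ M :=
  Real.sqrt_pos.2 (by positivity)

/-- With α = M / (1 + M) and 1 - V = y / √D, the tilt costs α y √D and the tail costs √D / (c₁ y).
By this identity the sum is minimal at y = κ, the centre, with value 2 α κ √D. -/
lemma tiltCenter_sq (hc₁ : 0 < c₁) (hM : 0 < M) :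
    M / (1 + M) * tiltCenter c₁ M ^ 2 = 1 / c₁ := by
  rw [tiltCenter, Real.sq_sqrt (by positivity)]
  field_simp

lemma ratio_mem (hM : 0 < M) {x : ℝ} (hx : 0 ≤ x) : x / (x + M) ∈ Set.Icc (0 : ℝ) 1 :=
  ⟨by positivity, (div_le_one (by positivity)).2 (by linarith)⟩

lemma integrable_ratio_pow (hVm : Measurable V) (hV0 : ∀ᵐ ω ∂μ, 0 ≤ V ω) (hM : 0 < M) (D : ℕ) :
    Integrable (fun ω => (V ω / (V ω + M)) ^ D) μ := by
  refine Integrable.of_bound (C := 1)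
    ((hVm.div (hVm.add_const M)).pow_const D).aestronglyMeasurable ?_
  filter_upwards [hV0] with ω h
  have := ratio_mem hM h
  rw [Real.norm_eq_abs, abs_of_nonneg (pow_nonneg this.1 _)]
  exact pow_le_one₀ this.1 this.2

/-- At distance x = κ / √D from 1, the terms of second order contribute a multiple of D x² = κ² to
the exponent, hence only a constant factor. The lower bound on `D` ensures x ≤ 1/2. -/
lemma scaled_ratio_pow_ge (hM : 0 < M) {κ v : ℝ} (hκ : 0 < κ) {D : ℕ} (hD : (2 * κ) ^ 2 ≤ D)
    (hD0 : 0 < D) (hv : 1 - κ / √D ≤ v) (hv1 : v ≤ 1) :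
    Real.exp (-(M / (1 + M) * κ) * √D - (M / (1 + M) * κ ^ 2 / M + κ ^ 2)) ≤
      (1 + M) ^ D * (v / (v + M)) ^ D := by
  have hD' : (0 : ℝ) < D := by exact_mod_cast hD0
  have hs : 0 < √(D : ℝ) := Real.sqrt_pos.2 hD'
  have hss : √(D : ℝ) * √(D : ℝ) = D := Real.mul_self_sqrt hD'.le
  have h2κ : 2 * κ ≤ √(D : ℝ) := Real.le_sqrt_of_sq_le hD
  set x := κ / √(D : ℝ) with hx
  have hx0 : 0 < x := by positivity
  have hx2 : x ≤ 1 / 2 := by rw [hx, div_le_iff₀ hs]; linarith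
  set t := M * x / (1 + M - x) with ht
  have hden : M ≤ 1 + M - x := by linarith
  have hden0 : 0 < 1 + M - x := by linarith
  have ht0 : 0 ≤ t := by positivity
  have htx : t ≤ x := by
    rw [ht, div_le_iff₀ hden0]; nlinarith
  have hte : t = M / (1 + M) * x + M / (1 + M) * x ^ 2 / (1 + M - x) := by
    rw [ht]; field_simp; ring
  have ht' : t ≤ M / (1 + M) * x + M / (1 + M) * x ^ 2 / M := by
    rw [hte]
    gcongr
  have hbase : 1 - t ≤ (1 + M) * (v / (v + M)) := by
    have h1 := scaled_ratio_eq hM (show x < 1 by linarith)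
    rw [ht, ← h1]
    refine mul_le_mul_of_nonneg_left ?_ (by linarith)
    rw [div_le_div_iff₀ (by linarith) (by linarith)]
    nlinarith
  have hxs : D * x = κ * √(D : ℝ) := by
    rw [hx, mul_div_left_comm]
    congr 1
    rw [div_eq_iff hs.ne', hss]
  have hxs2 : D * x ^ 2 = κ ^ 2 := by rw [hx, div_pow, Real.sq_sqrt hD'.le]; field_simp
  rw [← mul_pow]
  calc _ ≤ Real.exp (D * (-t - t ^ 2)) := by
        refine Real.exp_le_exp.2 ?_
        have h1 : D * t ≤ M / (1 + M) * κ * √(D : ℝ) + M / (1 + M) * κ ^ 2 / M := by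
          calc D * t ≤ D * (M / (1 + M) * x + M / (1 + M) * x ^ 2 / M) :=
                mul_le_mul_of_nonneg_left ht' hD'.le
            _ = M / (1 + M) * (D * x) + M / (1 + M) * (D * x ^ 2) / M := by ring
            _ = _ := by rw [hxs, hxs2]; ring
        have h2 : D * t ^ 2 ≤ κ ^ 2 := by
          rw [← hxs2]
          exact mul_le_mul_of_nonneg_left (pow_le_pow_left₀ ht0 htx 2) hD'.le
        linarith
    _ = Real.exp (-t - t ^ 2) ^ D := by rw [← Real.exp_nat_mul]
    _ ≤ _ := pow_le_pow_left₀ (Real.exp_pos _).le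
        ((exp_neg_sub_sq_le ht0 (by linarith)).trans hbase) D

/-- Only the event 1 - V ≤ κ / √D is kept. At the balance point the tilt and the probability of this
event contribute the same exponential, which explains the factor 2. -/
lemma tiltMass_lower (hVm : Measurable V) (hc₁ : 0 < c₁) (hw : w ∈ Set.Ioo (0 : ℝ) 1)
    (hV : ∀ x ∈ Set.Ico w 1, μ.real {ω | x ≤ V ω} = gammaFractionTail b c₁ w x) (hM : 0 < M) :
    ∃ K : ℝ, 0 < K ∧ ∀ᶠ D : ℕ in atTop,
      K * (√D ^ b * Real.exp (-(2 * (M / (1 + M)) * tiltCenter c₁ M) * √D)) ≤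
        (1 + M) ^ D * tiltMass μ V M D := by
  have hae := ae_mem_Ico hVm hc₁ hw hV
  have hV0 : ∀ᵐ ω ∂μ, 0 ≤ V ω := hae.mono fun ω h => hw.1.le.trans h.1
  have hw1 : 0 < 1 - w := by linarith [hw.2]
  set κ := tiltCenter c₁ M with hκdef
  have hκ : 0 < κ := tiltCenter_pos hc₁ hM
  have hκsq := tiltCenter_sq hc₁ hM
  rw [← hκdef] at hκsq
  set C := M / (1 + M) * κ ^ 2 / M + κ ^ 2 with hC
  have hT := tailConst_pos (b := b) (c₁ := c₁) hw.2
  refine ⟨Real.exp (-C) * (tailConst b c₁ w * (κ⁻¹ ^ b * Real.exp (1 / c₁))), by positivity, ?_⟩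
  filter_upwards [eventually_ge_atTop 1, eventually_ge_atTop ⌈(2 * κ) ^ 2⌉₊,
    eventually_ge_atTop ⌈(κ / (1 - w)) ^ 2⌉₊] with D h1 h2 h3
  have hD : (0 : ℝ) < D := by exact_mod_cast h1
  have hs : 0 < √(D : ℝ) := Real.sqrt_pos.2 hD
  have h2' : (2 * κ) ^ 2 ≤ D := (Nat.le_ceil _).trans (by exact_mod_cast h2)
  have h3' : κ / (1 - w) ≤ √D :=
    Real.le_sqrt_of_sq_le ((Nat.le_ceil _).trans (by exact_mod_cast h3))
  have hτ : 1 / (1 - w) ≤ √D / κ := by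
    rw [le_div_iff₀ hκ]; rw [one_div, inv_mul_eq_div]; exact h3'
  have hP := measure_one_sub_inv_le hc₁ hw hV hτ
  rw [one_div_div] at hP
  set S := {ω | 1 - κ / √(D : ℝ) ≤ V ω} with hS
  have hSm : MeasurableSet S := measurableSet_le measurable_const hVm
  have hint := (integrable_ratio_pow hVm hV0 hM D).const_mul ((1 + M) ^ D)
  have hlow : Real.exp (-(M / (1 + M) * κ) * √D - C) * μ.real S ≤
      (1 + M) ^ D * tiltMass μ V M D := by
    rw [tiltMass, ← integral_const_mul]
    have e : Real.exp (-(M / (1 + M) * κ) * √D - C) * μ.real S =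
        ∫ ω, S.indicator (fun _ => Real.exp (-(M / (1 + M) * κ) * √D - C)) ω ∂μ := by
      rw [integral_indicator_const _ hSm, smul_eq_mul, mul_comm]
    rw [e]
    refine integral_mono_ae ((integrable_const _).indicator hSm) hint ?_
    filter_upwards [hae] with ω hω
    have hv := ratio_mem hM (hw.1.le.trans hω.1)
    by_cases hωS : ω ∈ S
    · rw [Set.indicator_of_mem hωS]
      exact scaled_ratio_pow_ge hM hκ h2' h1 hωS hω.2.le
    · rw [Set.indicator_of_notMem hωS]
      exact mul_nonneg (by positivity) (pow_nonneg hv.1 _)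
  refine le_trans (le_of_eq ?_) hlow
  rw [hP, div_eq_mul_inv (√(D : ℝ)), Real.mul_rpow hs.le (by positivity)]
  have e1 : Real.exp (-(√(D : ℝ) * κ⁻¹ - 1) / c₁) =
      Real.exp (1 / c₁) * Real.exp (-(M / (1 + M) * κ) * √D) := by
    rw [← Real.exp_add]
    congr 1
    have : -(√(D : ℝ) * κ⁻¹ - 1) / c₁ = (1 / c₁) - √(D : ℝ) * κ⁻¹ * (1 / c₁) := by ring
    rw [this, ← hκsq]
    field_simp
    ring
  have e2 : Real.exp (-(2 * (M / (1 + M)) * κ) * √D) =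
      Real.exp (-(M / (1 + M) * κ) * √D) * Real.exp (-(M / (1 + M) * κ) * √D) := by
    rw [← Real.exp_add]; congr 1; ring
  rw [e1, e2, sub_eq_add_neg, Real.exp_add]
  ring

lemma tiltMass_ge (hVm : Measurable V) (hc₁ : 0 < c₁) (hw : w ∈ Set.Ioo (0 : ℝ) 1)
    (hV : ∀ x ∈ Set.Ico w 1, μ.real {ω | x ≤ V ω} = gammaFractionTail b c₁ w x) (hM : 0 < M)
    {ε : ℝ} (hε : 0 < ε) :
    ∀ᶠ D : ℕ in atTop,
      Real.exp (-(2 * (M / (1 + M)) * tiltCenter c₁ M + ε) * √D) ≤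
        (1 + M) ^ D * tiltMass μ V M D := by
  obtain ⟨K, hK, hev⟩ := tiltMass_lower hVm hc₁ hw hV hM
  have hsqrt : Tendsto (fun D : ℕ => √(D : ℝ)) atTop atTop :=
    Real.tendsto_sqrt_atTop.comp tendsto_natCast_atTop_atTop
  have hlim := (tendsto_rpow_mul_exp_neg_mul_atTop_nhds_zero (-b) ε hε).comp hsqrt
  filter_upwards [hev, hlim.eventually (gt_mem_nhds hK), eventually_ge_atTop 1] with D h1 h2 h3
  have hD : (0 : ℝ) < D := by exact_mod_cast h3
  have hs : 0 < √(D : ℝ) := Real.sqrt_pos.2 hD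
  refine le_trans ?_ h1
  have e : Real.exp (-(2 * (M / (1 + M)) * tiltCenter c₁ M + ε) * √D) =
      Real.exp (-ε * √D) * Real.exp (-(2 * (M / (1 + M)) * tiltCenter c₁ M) * √D) := by
    rw [← Real.exp_add]; congr 1; ring
  rw [e, ← mul_assoc]
  refine mul_le_mul_of_nonneg_right ?_ (Real.exp_pos _).le
  simp only [Function.comp] at h2
  rw [Real.rpow_neg hs.le, inv_mul_eq_div, div_lt_iff₀ (by positivity)] at h2
  exact h2.le

/-- A quantitative form of α y + α κ² / y = 2 α κ + α (y - κ)² / y. Exponential moments of 1 / (1 -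
V) are used strictly below 1 / c₁ = α κ², so half of the gain from |y - κ| ≥ δ is given up to lower
the coefficient of 1 / y. -/
lemma tilt_exponent_ge {α κ δ y : ℝ} (hα : 0 < α) (hκ : 0 < κ) (hδ : 0 < δ) (hy : 0 < y)
    (hyδ : δ ≤ |y - κ|) :
    2 * α * κ + 2 * (α * δ ^ 2 / (4 * (κ + δ))) ≤ α * y + (α * κ ^ 2 - α * δ ^ 2 / 2) / y := by
  set t := |y - κ| with ht
  have hyt : y ≤ κ + t := by linarith [le_abs_self (y - κ)]
  have ht2 : t ^ 2 = (y - κ) ^ 2 := sq_abs _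
  have e : α * y + (α * κ ^ 2 - α * δ ^ 2 / 2) / y =
      2 * α * κ + α * (t ^ 2 - δ ^ 2 / 2) / y := by
    rw [ht2]; field_simp; ring
  rw [e]
  have h1 : δ ^ 2 / (2 * (κ + δ)) ≤ (t ^ 2 - δ ^ 2 / 2) / y := by
    rw [div_le_div_iff₀ (by positivity) hy]
    have h2 : δ ^ 2 ≤ t ^ 2 := pow_le_pow_left₀ hδ.le hyδ 2
    have h3 : δ ^ 2 * y ≤ t ^ 2 * (κ + δ) := by
      calc δ ^ 2 * y ≤ δ ^ 2 * (κ + t) := mul_le_mul_of_nonneg_left hyt (by positivity)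
        _ ≤ t ^ 2 * (κ + δ) := by
          have h4 : δ ^ 2 * κ ≤ t ^ 2 * κ := mul_le_mul_of_nonneg_right h2 hκ.le
          have h5 : δ * t * δ ≤ δ * t * t := mul_le_mul_of_nonneg_left hyδ (by positivity)
          nlinarith
    have h6 : 0 ≤ (t ^ 2 - δ ^ 2) * (κ + δ) := mul_nonneg (by linarith) (by positivity)
    linarith
  have h7 : 2 * (α * δ ^ 2 / (4 * (κ + δ))) = α * (δ ^ 2 / (2 * (κ + δ))) := by
    field_simp; ring
  rw [h7, mul_div_assoc]
  linarith [mul_le_mul_of_nonneg_left h1 hα.le]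

/-- Under the tilted law, `√D * (1 - V)` converges in probability to a constant. -/
lemma tendsto_tilt_ratio (hVm : Measurable V) (hc₁ : 0 < c₁) (hw : w ∈ Set.Ioo (0 : ℝ) 1)
    (hV : ∀ x ∈ Set.Ico w 1, μ.real {ω | x ≤ V ω} = gammaFractionTail b c₁ w x) (hM : 0 < M)
    {δ : ℝ} (hδ : 0 < δ) :
    Tendsto (fun D : ℕ => (∫ ω in {ω | δ ≤ |√D * (1 - V ω) - tiltCenter c₁ M|},
      (V ω / (V ω + M)) ^ D ∂μ) / tiltMass μ V M D) atTop (𝓝 0) := by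
  have hae := ae_mem_Ico hVm hc₁ hw hV
  have hV0 : ∀ᵐ ω ∂μ, 0 ≤ V ω := hae.mono fun ω h => hw.1.le.trans h.1
  set κ := tiltCenter c₁ M with hκdef
  have hκ : 0 < κ := tiltCenter_pos hc₁ hM
  have hκsq := tiltCenter_sq hc₁ hM
  rw [← hκdef] at hκsq
  set α := M / (1 + M) with hα
  have hα0 : 0 < α := by positivity
  -- The moment exponent of `integrable_exp_div`; the maximum with 0 covers large δ, where the
  -- lowered coefficient is negative.
  set ρ := max 0 (α * κ ^ 2 - α * δ ^ 2 / 2) with hρ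
  have hρ1 : ρ < 1 / c₁ := by
    rw [hρ, ← hκsq]
    refine max_lt (by positivity) ?_
    have : 0 < α * δ ^ 2 / 2 := by positivity
    linarith
  have hI := integrable_exp_div hVm hc₁ hw hV (le_max_left _ _) hρ1
  -- The upper bound off the centre gains 2ε in the exponent and the lower bound for the mass loses
  -- ε, so exp (-ε √D) remains.
  set ε := α * δ ^ 2 / (4 * (κ + δ)) with hε
  have hε0 : 0 < ε := by positivity
  set K := ∫ ω, Real.exp (ρ / (1 - V ω)) ∂μ with hK
  have hlow := tiltMass_ge hVm hc₁ hw hV hM hε0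
  rw [← hκdef, ← hα] at hlow
  have hsqrt : Tendsto (fun D : ℕ => √(D : ℝ)) atTop atTop :=
    Real.tendsto_sqrt_atTop.comp tendsto_natCast_atTop_atTop
  have hlim : Tendsto (fun D : ℕ => K * Real.exp (-(ε * √(D : ℝ)))) atTop (𝓝 0) := by
    have := (Real.tendsto_exp_neg_atTop_nhds_zero.comp (hsqrt.const_mul_atTop hε0)).const_mul K
    simpa using this
  refine squeeze_zero' ?_ ?_ hlim
  · filter_upwards with D
    refine div_nonneg ?_ ?_
    · refine integral_nonneg_of_ae (ae_restrict_of_ae ?_)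
      filter_upwards [hV0] with ω h using pow_nonneg (ratio_mem hM h).1 _
    · refine integral_nonneg_of_ae ?_
      filter_upwards [hV0] with ω h using pow_nonneg (ratio_mem hM h).1 _
  · filter_upwards [hlow, eventually_ge_atTop 1] with D h1 h2
    have hD : (0 : ℝ) < D := by exact_mod_cast h2
    have hs : 0 < √(D : ℝ) := Real.sqrt_pos.2 hD
    have hss : √(D : ℝ) * √(D : ℝ) = D := Real.mul_self_sqrt hD.le
    set S := {ω | δ ≤ |√(D : ℝ) * (1 - V ω) - κ|} with hS
    have hSm : MeasurableSet S := measurableSet_le measurable_const (by fun_prop)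
    have hθ : 0 < (1 + M) ^ D := by positivity
    have hmass : 0 < tiltMass μ V M D := by
      have := (Real.exp_pos _).trans_le h1
      exact (mul_pos_iff_of_pos_left hθ).1 this
    have hup : (1 + M) ^ D * ∫ ω in S, (V ω / (V ω + M)) ^ D ∂μ ≤
        K * Real.exp (-(2 * α * κ + 2 * ε) * √D) := by
      rw [← integral_const_mul, hK, ← integral_mul_const, ← integral_indicator hSm]
      refine integral_mono_ae (((integrable_ratio_pow hVm hV0 hM D).const_mul _).indicator hSm)
        (hI.mul_const _) ?_
      filter_upwards [hae] with ω hω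
      have hx : 0 < 1 - V ω := by linarith [hω.2]
      by_cases hωS : ω ∈ S
      · rw [Set.indicator_of_mem hωS]
        have hy : 0 < √(D : ℝ) * (1 - V ω) := by positivity
        have hexp := tilt_exponent_ge hα0 hκ hδ hy hωS
        have hr := scaled_ratio_le hM hx.le (x := 1 - V ω) (by linarith [hw.1, hω.1])
        rw [sub_sub_cancel] at hr
        have hr0 : 0 ≤ (1 + M) * (V ω / (V ω + M)) :=
          mul_nonneg (by linarith) (ratio_mem hM (hw.1.le.trans hω.1)).1
        rw [← mul_pow]
        calc ((1 + M) * (V ω / (V ω + M))) ^ D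
            ≤ Real.exp (-(M / (1 + M) * (1 - V ω))) ^ D := pow_le_pow_left₀ hr0 hr D
          _ = Real.exp (-(α * (√(D : ℝ) * (1 - V ω))) * √D) := by
              rw [← Real.exp_nat_mul, ← hα]
              congr 1
              nth_rewrite 1 [← hss]; ring
          _ ≤ Real.exp (ρ / (1 - V ω) + -(2 * α * κ + 2 * ε) * √D) := by
              refine Real.exp_le_exp.2 ?_
              have h3 := mul_le_mul_of_nonneg_right hexp hs.le
              have h4 : (α * κ ^ 2 - α * δ ^ 2 / 2) / (√(D : ℝ) * (1 - V ω)) * √D ≤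
                  ρ / (1 - V ω) := by
                have : (α * κ ^ 2 - α * δ ^ 2 / 2) / (√(D : ℝ) * (1 - V ω)) * √D =
                    (α * κ ^ 2 - α * δ ^ 2 / 2) / (1 - V ω) := by field_simp
                rw [this]
                exact div_le_div_of_nonneg_right (le_max_right _ _) hx.le
              rw [add_mul] at h3
              linarith
          _ = _ := Real.exp_add _ _
      · rw [Set.indicator_of_notMem hωS]
        positivity
    rw [div_le_iff₀ hmass]
    have h5 : (1 + M) ^ D * ∫ ω in S, (V ω / (V ω + M)) ^ D ∂μ ≤
        (1 + M) ^ D * (K * Real.exp (-(ε * √D)) * tiltMass μ V M D) := by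
      refine hup.trans ?_
      have hK0 : 0 ≤ K := integral_nonneg fun ω => (Real.exp_pos _).le
      have e : Real.exp (-(2 * α * κ + 2 * ε) * √D) =
          Real.exp (-(ε * √D)) * Real.exp (-(2 * α * κ + ε) * √D) := by
        rw [← Real.exp_add]; congr 1; ring
      rw [e]
      calc K * (Real.exp (-(ε * √D)) * Real.exp (-(2 * α * κ + ε) * √D))
          = K * Real.exp (-(ε * √D)) * Real.exp (-(2 * α * κ + ε) * √D) := by ring
        _ ≤ K * Real.exp (-(ε * √D)) * ((1 + M) ^ D * tiltMass μ V M D) :=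
            mul_le_mul_of_nonneg_left h1 (mul_nonneg hK0 (Real.exp_pos _).le)
        _ = _ := by ring
    exact le_of_mul_le_mul_left h5 hθ

end Concentration

end WRT

end

/-! ### The limiting characteristic function under the tilted law. -/

noncomputable section

namespace WRT

section CharLimit

set_option linter.unusedSectionVars false

lemma norm_log_one_add_sub_quadratic_le {x : ℂ} (hx : ‖x‖ ≤ 1 / 2) :
    ‖Complex.log (1 + x) - (x - x ^ 2 / 2)‖ ≤ ‖x‖ ^ 3 := by
  have h := Complex.norm_log_sub_logTaylor_le 2 (z := x) (by linarith)
  have e : Complex.logTaylor (2 + 1) x = x - x ^ 2 / 2 := by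
    simp [Complex.logTaylor, Finset.sum_range_succ]; ring
  rw [e] at h
  refine h.trans ?_
  have h1 : (1 - ‖x‖)⁻¹ ≤ 2 := by
    rw [inv_le_comm₀ (by linarith) (by norm_num)]; linarith
  have h2 : 0 ≤ ‖x‖ ^ 3 := by positivity
  have h3 : ‖x‖ ^ (2 + 1) * (1 - ‖x‖)⁻¹ ≤ ‖x‖ ^ 3 * 2 := mul_le_mul_of_nonneg_left h1 h2
  push_cast
  linarith

lemma tendsto_sqrt_prod (κ : ℝ) :
    Tendsto (fun p : ℕ × ℝ => (√(p.1 : ℝ))⁻¹) (atTop ×ˢ 𝓝 κ) (𝓝 0) :=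
  (tendsto_inv_atTop_zero.comp (Real.tendsto_sqrt_atTop.comp tendsto_natCast_atTop_atTop)).comp
    tendsto_fst

/-- The factor by which `1 + i s u / √D` depends on the rescaled weight. -/
def tiltFactor (θ : ℝ) (p : ℕ × ℝ) : ℝ := θ / (θ - p.2 * (√(p.1 : ℝ))⁻¹)

lemma tendsto_tiltFactor {θ : ℝ} (hθ : 0 < θ) (κ : ℝ) :
    Tendsto (tiltFactor θ) (atTop ×ˢ 𝓝 κ) (𝓝 1) := by
  have h1 : Tendsto (fun p : ℕ × ℝ => θ - p.2 * (√(p.1 : ℝ))⁻¹) (atTop ×ˢ 𝓝 κ) (𝓝 (θ - κ * 0)) :=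
    tendsto_const_nhds.sub (tendsto_snd.mul (tendsto_sqrt_prod κ))
  rw [mul_zero, sub_zero] at h1
  have := (tendsto_const_nhds (x := θ)).div h1 hθ.ne'
  rwa [div_self hθ.ne'] at this

/-- Expand the logarithm at x = i s u / √D, with u the tilt factor at rescaled weight y. The linear
term cancels i s √D up to i s √D (1 - u), which tends to -i s κ / θ and produces the mean. The
quadratic term gives the variance, and the cubic remainder is O(D ^ (-1/2)). The product filter
makes all this uniform for y near κ. -/
lemma tendsto_tilt_exponent {θ : ℝ} (hθ : 0 < θ) (κ s : ℝ) :
    Tendsto (fun p : ℕ × ℝ => (s * √(p.1 : ℝ) : ℝ) * Complex.I -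
      p.1 * Complex.log (1 + (s * tiltFactor θ p * (√(p.1 : ℝ))⁻¹ : ℝ) * Complex.I))
      (atTop ×ˢ 𝓝 κ) (𝓝 ((-(s * (κ / θ)) : ℝ) * Complex.I - ((s ^ 2 / 2 : ℝ) : ℂ))) := by
  set x : ℕ × ℝ → ℂ := fun p =>
    ((s * tiltFactor θ p * (√(p.1 : ℝ))⁻¹ : ℝ) : ℂ) * Complex.I with hx
  have hu := tendsto_tiltFactor hθ κ
  have hs := tendsto_sqrt_prod κ
  have hpos : ∀ᶠ p : ℕ × ℝ in atTop ×ˢ 𝓝 κ, 0 < √(p.1 : ℝ) := by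
    have h1 : ∀ᶠ n : ℕ in atTop, 0 < √(n : ℝ) := by
      filter_upwards [eventually_ge_atTop 1] with n hn
      exact Real.sqrt_pos.2 (by exact_mod_cast hn)
    exact h1.prod_inl _
  have hden : ∀ᶠ p : ℕ × ℝ in atTop ×ˢ 𝓝 κ, θ - p.2 * (√(p.1 : ℝ))⁻¹ ≠ 0 := by
    have h1 : Tendsto (fun p : ℕ × ℝ => θ - p.2 * (√(p.1 : ℝ))⁻¹) (atTop ×ˢ 𝓝 κ)
        (𝓝 (θ - κ * 0)) := tendsto_const_nhds.sub (tendsto_snd.mul hs)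
    rw [mul_zero, sub_zero] at h1
    exact h1.eventually_ne hθ.ne'
  have hxnorm : ∀ p, ‖x p‖ = |s * tiltFactor θ p| * |(√(p.1 : ℝ))⁻¹| := by
    intro p
    simp only [hx]
    rw [norm_mul, Complex.norm_I, mul_one, Complex.norm_real, Real.norm_eq_abs, abs_mul]
  have hxlim : Tendsto (fun p => ‖x p‖) (atTop ×ˢ 𝓝 κ) (𝓝 0) := by
    have := ((hu.const_mul s).abs).mul hs.abs
    simp only [abs_zero, mul_zero] at this
    simpa only [hxnorm] using this
  have hrem : Tendsto (fun p => (p.1 : ℂ) * (Complex.log (1 + x p) - (x p - x p ^ 2 / 2)))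
      (atTop ×ˢ 𝓝 κ) (𝓝 0) := by
    have hlim : Tendsto (fun p : ℕ × ℝ => |s * tiltFactor θ p| ^ 3 * (√(p.1 : ℝ))⁻¹)
        (atTop ×ˢ 𝓝 κ) (𝓝 0) := by
      have := (((hu.const_mul s).abs).pow 3).mul hs
      simpa using this
    refine squeeze_zero_norm' ?_ hlim
    filter_upwards [hxlim.eventually (ge_mem_nhds (show (0 : ℝ) < 1 / 2 by norm_num)), hpos]
      with p h1 h2
    rw [norm_mul, Complex.norm_natCast]
    refine (mul_le_mul_of_nonneg_left (norm_log_one_add_sub_quadratic_le h1)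
      (by positivity)).trans (le_of_eq ?_)
    rw [hxnorm, mul_pow, abs_of_pos (inv_pos.2 h2)]
    have h3 : (p.1 : ℝ) = √(p.1 : ℝ) ^ 2 := (Real.sq_sqrt (by positivity)).symm
    nth_rewrite 1 [h3]
    field_simp
  have hmain : Tendsto (fun p : ℕ × ℝ =>
      ((-(s * (p.2 / (θ - p.2 * (√(p.1 : ℝ))⁻¹))) : ℝ) : ℂ) * Complex.I -
        ((s ^ 2 * tiltFactor θ p ^ 2 / 2 : ℝ) : ℂ)) (atTop ×ˢ 𝓝 κ)
      (𝓝 ((-(s * (κ / θ)) : ℝ) * Complex.I - ((s ^ 2 / 2 : ℝ) : ℂ))) := by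
    have h1 : Tendsto (fun p : ℕ × ℝ => θ - p.2 * (√(p.1 : ℝ))⁻¹) (atTop ×ˢ 𝓝 κ)
        (𝓝 (θ - κ * 0)) := tendsto_const_nhds.sub (tendsto_snd.mul hs)
    rw [mul_zero, sub_zero] at h1
    have h2 : Tendsto (fun p : ℕ × ℝ => p.2 / (θ - p.2 * (√(p.1 : ℝ))⁻¹)) (atTop ×ˢ 𝓝 κ)
        (𝓝 (κ / θ)) := tendsto_snd.div h1 hθ.ne'
    have h3 : Tendsto (fun p : ℕ × ℝ => s ^ 2 * tiltFactor θ p ^ 2 / 2) (atTop ×ˢ 𝓝 κ)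
        (𝓝 (s ^ 2 / 2)) := by
      have := ((hu.pow 2).const_mul (s ^ 2)).div_const 2
      simpa using this
    exact (((Complex.continuous_ofReal.tendsto _).comp (h2.const_mul s).neg).mul_const _).sub
      ((Complex.continuous_ofReal.tendsto _).comp h3)
  have hsum := hmain.sub hrem
  rw [sub_zero] at hsum
  refine hsum.congr' ?_
  filter_upwards [hpos, hden] with p h1 h2
  have hDs : (p.1 : ℂ) = ((√(p.1 : ℝ) : ℝ) : ℂ) * ((√(p.1 : ℝ) : ℝ) : ℂ) := by
    rw [← Complex.ofReal_mul, Real.mul_self_sqrt (by positivity)]; simp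
  have e1 : (p.1 : ℂ) * x p = ((s * tiltFactor θ p * √(p.1 : ℝ) : ℝ) : ℂ) * Complex.I := by
    simp only [hx]
    rw [hDs, ← mul_assoc, ← Complex.ofReal_mul, ← Complex.ofReal_mul]
    congr 2
    field_simp
  have e2 : (p.1 : ℂ) * x p ^ 2 = -((s ^ 2 * tiltFactor θ p ^ 2 : ℝ) : ℂ) := by
    simp only [hx]
    rw [mul_pow, Complex.I_sq, hDs, ← Complex.ofReal_pow, ← mul_assoc, ← Complex.ofReal_mul,
      ← Complex.ofReal_mul, mul_neg_one]
    congr 2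
    field_simp
  have e3 : s * √(p.1 : ℝ) - s * tiltFactor θ p * √(p.1 : ℝ) =
      -(s * (p.2 / (θ - p.2 * (√(p.1 : ℝ))⁻¹))) := by
    unfold tiltFactor
    have h4 : √(p.1 : ℝ) * (√(p.1 : ℝ))⁻¹ = 1 := mul_inv_cancel₀ h1.ne'
    generalize (√(p.1 : ℝ))⁻¹ = r at *
    generalize √(p.1 : ℝ) = q at *
    rw [← sub_eq_zero]
    field_simp
    linear_combination (-s * p.2) * h4
  have expand : (p.1 : ℂ) * (Complex.log (1 + x p) - (x p - x p ^ 2 / 2)) =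
      p.1 * Complex.log (1 + x p) - p.1 * x p + (p.1 * x p ^ 2) / 2 := by ring
  rw [expand, e1, e2, ← e3]
  change _ = _ - _ * Complex.log (1 + x p)
  push_cast
  ring

variable {Ω : Type*} [mΩ : MeasurableSpace Ω] {μ : Measure Ω} [IsProbabilityMeasure μ]
  {V : Ω → ℝ} {M b c₁ w : ℝ}

lemma charInt_zero (D : ℕ) : charInt μ V M D 0 = (tiltMass μ V M D : ℂ) := by
  have h : (∫ ω, ((V ω : ℂ) / (V ω + M)) ^ D ∂μ) = ((∫ ω, (V ω / (V ω + M)) ^ D ∂μ : ℝ) : ℂ) := by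
    rw [← integral_complex_ofReal]
    push_cast
    rfl
  simp only [charInt, Complex.ofReal_zero, zero_mul, sub_zero, div_one, one_mul, mul_one, h,
    tiltMass]

/-- The frequency at which the labels are tested. -/
def freq (M s : ℝ) (D : ℕ) : ℝ := -(s * ((1 + M) / M) * (√(D : ℝ))⁻¹)

lemma tendsto_freq (M s : ℝ) : Tendsto (freq M s) atTop (𝓝 0) := by
  have h1 : Tendsto (fun D : ℕ => (√(D : ℝ))⁻¹) atTop (𝓝 0) :=
    tendsto_inv_atTop_zero.comp (Real.tendsto_sqrt_atTop.comp tendsto_natCast_atTop_atTop)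
  have := (h1.const_mul (s * ((1 + M) / M))).neg
  rw [mul_zero, neg_zero] at this
  exact this

lemma one_le_norm_one_add_mul_I (r : ℝ) : 1 ≤ ‖(1 : ℂ) + r * Complex.I‖ := by
  have := Complex.abs_re_le_norm ((1 : ℂ) + r * Complex.I)
  simpa using this

/-- The complex denominator factors as `v + M` times a number of the form 1 + i r. The complex
integrand is thus the tilting density times a bounded oscillating factor. -/
lemma complex_ratio_eq (hM : 0 < M) {v : ℝ} (hv : 0 < v) (s : ℝ) {D : ℕ} (hD : 0 < D) :
    ((v : ℂ) / (v + M * (1 - freq M s D * Complex.I))) =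
      ((v / (v + M) : ℝ) : ℂ) *
      (1 + (s * tiltFactor (1 + M) (D, √(D : ℝ) * (1 - v)) * (√(D : ℝ))⁻¹ : ℝ) * Complex.I)⁻¹ := by
  have hs : 0 < √(D : ℝ) := Real.sqrt_pos.2 (by exact_mod_cast hD)
  have hu : tiltFactor (1 + M) (D, √(D : ℝ) * (1 - v)) = (1 + M) / (v + M) := by
    unfold tiltFactor
    simp only
    congr 1
    field_simp
    ring
  rw [hu]
  have hvM : v + M ≠ 0 := by positivity
  have hvM' : (v : ℂ) + M ≠ 0 := by exact_mod_cast hvM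
  set r := s * ((1 + M) / (v + M)) * (√(D : ℝ))⁻¹ with hr
  have h1 := one_le_norm_one_add_mul_I r
  have hne : (1 : ℂ) + r * Complex.I ≠ 0 := by
    intro h; rw [h, norm_zero] at h1; linarith
  have key : (v : ℂ) + M * (1 - freq M s D * Complex.I) = (v + M) * (1 + r * Complex.I) := by
    have : -(M * freq M s D) = (v + M) * r := by
      rw [freq, hr]; field_simp
    have h2 : -((M : ℂ) * freq M s D) = (v + M) * r := by exact_mod_cast this
    linear_combination Complex.I * h2
  rw [key]
  push_cast
  field_simp

/-- Limit of the characteristic functions of the rescaled labels. -/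
lemma tendsto_charInt_ratio (hVm : Measurable V) (hc₁ : 0 < c₁) (hw : w ∈ Set.Ioo (0 : ℝ) 1)
    (hV : ∀ x ∈ Set.Ico w 1, μ.real {ω | x ≤ V ω} = gammaFractionTail b c₁ w x) (hM : 0 < M)
    (s : ℝ) :
    Tendsto (fun D : ℕ => Complex.exp ((s * √(D : ℝ) : ℝ) * Complex.I) *
      charInt μ V M D (freq M s D) / (tiltMass μ V M D : ℂ)) atTop
      (𝓝 (Complex.exp ((-(s * (tiltCenter c₁ M / (1 + M))) : ℝ) * Complex.I -
        ((s ^ 2 / 2 : ℝ) : ℂ)))) := by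
  have hae := ae_mem_Ico hVm hc₁ hw hV
  have hV0 : ∀ᵐ ω ∂μ, 0 ≤ V ω := hae.mono fun ω h => hw.1.le.trans h.1
  set κ := tiltCenter c₁ M with hκ
  set L := Complex.exp ((-(s * (κ / (1 + M))) : ℝ) * Complex.I - ((s ^ 2 / 2 : ℝ) : ℂ)) with hL
  -- The oscillating factor as a function of degree and rescaled weight. It has modulus at most 1,
  -- so by concentration only its limit near κ matters.
  let Φ : ℕ × ℝ → ℂ := fun p => Complex.exp ((s * √(p.1 : ℝ) : ℝ) * Complex.I) *
    ((1 + (s * tiltFactor (1 + M) p * (√(p.1 : ℝ))⁻¹ : ℝ) * Complex.I)⁻¹) ^ p.1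
  have hΦnorm : ∀ p, ‖Φ p‖ ≤ 1 := by
    intro p
    simp only [Φ]
    rw [norm_mul, Complex.norm_exp_ofReal_mul_I, one_mul, norm_pow, norm_inv]
    exact pow_le_one₀ (by positivity) (inv_le_one_of_one_le₀ (one_le_norm_one_add_mul_I _))
  have hΦlim : Tendsto Φ (atTop ×ˢ 𝓝 κ) (𝓝 L) := by
    have h := (Complex.continuous_exp.tendsto _).comp
      (tendsto_tilt_exponent (show 0 < 1 + M by linarith) κ s)
    refine h.congr fun p => ?_
    simp only [Function.comp, Φ]
    rw [Complex.exp_sub, div_eq_mul_inv]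
    congr 1
    rw [Complex.exp_nat_mul, Complex.exp_log, inv_pow]
    intro h0
    have h1 := one_le_norm_one_add_mul_I (s * tiltFactor (1 + M) p * (√(p.1 : ℝ))⁻¹)
    rw [h0, norm_zero] at h1
    linarith
  let I : ℕ → ℂ := fun D => ∫ ω, (((V ω / (V ω + M)) ^ D : ℝ) : ℂ) *
    Φ (D, √(D : ℝ) * (1 - V ω)) ∂μ
  have hΦm : ∀ D : ℕ, Measurable fun ω => Φ (D, √(D : ℝ) * (1 - V ω)) := by
    intro D
    simp only [Φ, tiltFactor]
    fun_prop
  have hfact : ∀ᶠ D : ℕ in atTop, Complex.exp ((s * √(D : ℝ) : ℝ) * Complex.I) *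
      charInt μ V M D (freq M s D) / (tiltMass μ V M D : ℂ) =
      1 / (1 - freq M s D * Complex.I) * (I D / (tiltMass μ V M D : ℂ)) := by
    filter_upwards [eventually_ge_atTop 1] with D hD
    rw [charInt, mul_left_comm, mul_div_assoc, ← integral_const_mul]
    congr 2
    refine integral_congr_ae ?_
    filter_upwards [hae] with ω hω
    rw [complex_ratio_eq hM (hw.1.trans_le hω.1) s hD, mul_pow]
    simp only [Φ]
    push_cast
    ring
  have hlim1 : Tendsto (fun D : ℕ => (1 : ℂ) / (1 - freq M s D * Complex.I)) atTop (𝓝 1) := by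
    have h1 : Tendsto (fun D : ℕ => (1 : ℂ) - freq M s D * Complex.I) atTop (𝓝 (1 - 0 * Complex.I)) :=
      tendsto_const_nhds.sub (((Complex.continuous_ofReal.tendsto 0).comp
        (tendsto_freq M s)).mul_const _)
    rw [zero_mul, sub_zero] at h1
    simpa using h1.inv₀ one_ne_zero
  have hmass : ∀ᶠ D : ℕ in atTop, 0 < tiltMass μ V M D := by
    filter_upwards [tiltMass_ge hVm hc₁ hw hV hM one_pos] with D h
    have h1 := (Real.exp_pos _).trans_le h
    exact (mul_pos_iff_of_pos_left (by positivity)).1 h1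
  have hlim2 : Tendsto (fun D : ℕ => I D / (tiltMass μ V M D : ℂ)) atTop (𝓝 L) := by
    rw [Metric.tendsto_atTop']
    intro ε hε
    have hev := hΦlim.eventually (Metric.ball_mem_nhds L (half_pos hε))
    rw [Filter.eventually_prod_iff] at hev
    obtain ⟨pa, hpa, pb, hpb, hab⟩ := hev
    obtain ⟨δ, hδ, hball⟩ := Metric.eventually_nhds_iff.1 hpb
    have hr := tendsto_tilt_ratio hVm hc₁ hw hV hM hδ
    -- Away from κ the integrand differs from its limit by at most 1 + ‖L‖, so this tilted
    -- probability costs less than ε / 2.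
    have hr' := hr.eventually (gt_mem_nhds (show 0 < ε / (2 * (1 + ‖L‖)) by positivity))
    obtain ⟨N, hN⟩ := ((hpa.and hr').and hmass).exists_forall_of_atTop
    refine ⟨N, fun D hD => ?_⟩
    obtain ⟨⟨h1, h2⟩, h3⟩ := hN D hD.le
    set S := {ω | δ ≤ |√(D : ℝ) * (1 - V ω) - κ|} with hS
    have hSm : MeasurableSet S := measurableSet_le measurable_const (by fun_prop)
    have hgi := integrable_ratio_pow hVm hV0 hM D
    have hgic : Integrable (fun ω => (((V ω / (V ω + M)) ^ D : ℝ) : ℂ)) μ := hgi.ofReal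
    have hgΦ : Integrable (fun ω => (((V ω / (V ω + M)) ^ D : ℝ) : ℂ) *
        Φ (D, √(D : ℝ) * (1 - V ω))) μ :=
      hgic.mul_bdd (c := 1) (hΦm D).aestronglyMeasurable (Eventually.of_forall fun ω => hΦnorm _)
    have htm : (tiltMass μ V M D : ℂ) = ∫ ω, (((V ω / (V ω + M)) ^ D : ℝ) : ℂ) ∂μ :=
      integral_complex_ofReal.symm
    have hmne : (tiltMass μ V M D : ℂ) ≠ 0 := by exact_mod_cast h3.ne'
    have hdiff : ‖I D - L * tiltMass μ V M D‖ ≤ ε / 2 * tiltMass μ V M D +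
        (1 + ‖L‖) * ∫ ω in S, (V ω / (V ω + M)) ^ D ∂μ := by
      have e : I D - L * tiltMass μ V M D = ∫ ω, (((V ω / (V ω + M)) ^ D : ℝ) : ℂ) *
          (Φ (D, √(D : ℝ) * (1 - V ω)) - L) ∂μ := by
        rw [htm, ← integral_const_mul, ← integral_sub hgΦ (hgic.const_mul L)]
        congr 1; ext ω; ring
      rw [e]
      have hbi : Integrable (fun ω => ε / 2 * (V ω / (V ω + M)) ^ D +
          (1 + ‖L‖) * S.indicator (fun ω => (V ω / (V ω + M)) ^ D) ω) μ :=
        (hgi.const_mul _).add ((hgi.indicator hSm).const_mul _)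
      refine (norm_integral_le_of_norm_le hbi ?_).trans (le_of_eq ?_)
      · filter_upwards [hV0] with ω hω
        have hg0 : 0 ≤ (V ω / (V ω + M)) ^ D := pow_nonneg (ratio_mem hM hω).1 _
        rw [norm_mul, Complex.norm_real, Real.norm_eq_abs, abs_of_nonneg hg0]
        by_cases hωS : ω ∈ S
        · rw [Set.indicator_of_mem hωS]
          have : ‖Φ (D, √(D : ℝ) * (1 - V ω)) - L‖ ≤ 1 + ‖L‖ :=
            (norm_sub_le _ _).trans (add_le_add_left (hΦnorm _) _)
          have h5 := mul_le_mul_of_nonneg_left this hg0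
          have h6 : 0 ≤ ε / 2 * (V ω / (V ω + M)) ^ D := by positivity
          linarith
        · rw [Set.indicator_of_notMem hωS, mul_zero, add_zero, mul_comm]
          refine mul_le_mul_of_nonneg_right ?_ hg0
          have hωS' : |√(D : ℝ) * (1 - V ω) - κ| < δ := not_le.1 hωS
          have h7 := hab h1 (hball (show dist (√(D : ℝ) * (1 - V ω)) κ < δ from hωS'))
          rw [dist_eq_norm] at h7
          exact h7.le
      · rw [integral_add (hgi.const_mul _) ((hgi.indicator hSm).const_mul _), integral_const_mul,
          integral_const_mul, integral_indicator hSm]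
        rfl
    rw [dist_eq_norm]
    have e2 : I D / (tiltMass μ V M D : ℂ) - L =
        (I D - L * tiltMass μ V M D) / (tiltMass μ V M D : ℂ) := by field_simp
    rw [e2, norm_div, Complex.norm_real, Real.norm_eq_abs, abs_of_pos h3, div_lt_iff₀ h3]
    refine hdiff.trans_lt ?_
    rw [div_lt_iff₀ h3] at h2
    have h8 := mul_lt_mul_of_pos_left h2 (show 0 < 1 + ‖L‖ by positivity)
    have h9 : (1 + ‖L‖) * (ε / (2 * (1 + ‖L‖)) * tiltMass μ V M D) = ε / 2 * tiltMass μ V M D := by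
      field_simp
    rw [h9] at h8
    linarith
  have := hlim1.mul hlim2
  rw [one_mul] at this
  exact this.congr' (hfact.mono fun D h => h.symm)

end CharLimit

end WRT

end

/-! ### Choice of exponents and elementary growth rates. -/

noncomputable section

namespace WRT

section ErrorRates

/-- The exponents that govern the error terms: `1 - σ` is small, `n ^ η` is the cut-off label and
`n ^ (-ε)` is the resulting relative error. -/
lemma exists_exponents {M w c : ℝ} (hM : 0 < M) (hw : 0 < w) (hc : 0 < c)
    (hcM : c * M < 1 + M) :
    ∃ σ η ε : ℝ, 0 ≤ σ ∧ σ < 1 ∧ 0 < η ∧ η < 1 ∧ 0 < ε ∧ ε ≤ η / 8 ∧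
      c * Real.log ((1 + M) / (1 + M * σ)) + η * (1 + M / w) - (1 - σ) ≤ -ε := by
  -- This is 1 - σ. To first order, replacing σ = 1 by 1 - s costs c M s / (1 + M) and gains s;
  -- `hcM` makes the gain larger, and this `s` keeps M s below the gap 1 + M - c M.
  set s : ℝ := (1 + M - c * M) / (2 * (1 + M)) with hs
  have hs0 : 0 < s := by apply div_pos <;> linarith
  have hs1 : s < 1 := by
    rw [hs, div_lt_one (by linarith)]; nlinarith
  have hMs : M * s < 1 + M - c * M := by
    rw [hs, mul_div_assoc', div_lt_iff₀ (by linarith)]; nlinarith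
  have hcM0 : 0 < c * M := by positivity
  have hden : 0 < 1 + M * (1 - s) := by nlinarith
  set δ : ℝ := s - c * (M * s / (1 + M * (1 - s))) with hδ
  have hδ0 : 0 < δ := by
    have : c * (M * s / (1 + M * (1 - s))) < s := by
      rw [mul_div_assoc', div_lt_iff₀ hden]; nlinarith
    linarith
  have hlog : Real.log ((1 + M) / (1 + M * (1 - s))) ≤ M * s / (1 + M * (1 - s)) := by
    refine (Real.log_le_sub_one_of_pos (by positivity)).trans (le_of_eq ?_)
    field_simp; ring
  have hq : 0 < 1 + M / w := by positivity
  -- Half of the surplus δ pays for the powers of the cut-off label, the other half is left for ε.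
  set η : ℝ := min (1 / 2) (δ / (2 * (1 + M / w))) with hη
  have hη0 : 0 < η := by rw [hη]; positivity
  refine ⟨1 - s, η, min (η / 8) (δ / 2), by linarith, by linarith, hη0, ?_, by positivity,
    min_le_left _ _, ?_⟩
  · exact lt_of_le_of_lt (min_le_left _ _) (by norm_num)
  · have h1 : η * (1 + M / w) ≤ δ / 2 := by
      calc η * (1 + M / w) ≤ δ / (2 * (1 + M / w)) * (1 + M / w) := by
            gcongr; exact min_le_right _ _
        _ = δ / 2 := by field_simp
    have h2 : c * Real.log ((1 + M) / (1 + M * (1 - s))) ≤ c * (M * s / (1 + M * (1 - s))) := by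
      gcongr
    have h3 : min (η / 8) (δ / 2) ≤ δ / 2 := min_le_right _ _
    linarith

lemma pow_le_rpow_log {x c n : ℝ} {D : ℕ} (hx : 1 ≤ x) (hn : 0 < n)
    (hD : (D : ℝ) ≤ c * Real.log n) : x ^ D ≤ n ^ (c * Real.log x) := by
  have hx0 : 0 < x := by linarith
  rw [← Real.rpow_natCast, Real.rpow_def_of_pos hx0, Real.rpow_def_of_pos hn, Real.exp_le_exp]
  have := mul_le_mul_of_nonneg_right hD (Real.log_nonneg hx)
  linarith

lemma tendsto_rpow_neg_mul_log_pow {ε : ℝ} (hε : 0 < ε) (a b : ℝ) (k : ℕ) :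
    Tendsto (fun n : ℕ => (n : ℝ) ^ (-ε) * (a + b * Real.log n) ^ k) atTop (𝓝 0) := by
  have h1 : (fun x : ℝ => a + b * Real.log x) =O[atTop] Real.log := by
    refine Asymptotics.IsBigO.add ?_ (Asymptotics.isBigO_const_mul_self b _ _)
    exact (Real.isLittleO_const_log_atTop (c := a)).isBigO
  have h2 : (fun x : ℝ => (a + b * Real.log x) ^ k) =O[atTop] fun x => Real.log x ^ (k : ℝ) := by
    simpa using h1.pow k
  have h3 := h2.trans_isLittleO (isLittleO_log_rpow_rpow_atTop (k : ℝ) hε)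
  have h4 : Tendsto (fun x : ℝ => x ^ (-ε) * (a + b * Real.log x) ^ k) atTop (𝓝 0) := by
    refine h3.tendsto_div_nhds_zero.congr' ?_
    filter_upwards [eventually_gt_atTop 0] with x hx
    rw [Real.rpow_neg hx.le, div_eq_inv_mul]
  exact h4.comp tendsto_natCast_atTop_atTop

lemma tendsto_rpow_mul_exp_neg_rpow {η : ℝ} (hη : 0 < η) (p : ℝ) :
    Tendsto (fun n : ℕ => (n : ℝ) ^ p * Real.exp (-(n : ℝ) ^ η)) atTop (𝓝 0) := by
  have h1 := (tendsto_rpow_mul_exp_neg_mul_atTop_nhds_zero (p / η) 1 one_pos).comp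
    (tendsto_rpow_atTop hη)
  have h2 : Tendsto (fun x : ℝ => x ^ p * Real.exp (-x ^ η)) atTop (𝓝 0) := by
    refine h1.congr' ?_
    filter_upwards [eventually_gt_atTop 0] with x hx
    simp only [Function.comp_apply]
    rw [← Real.rpow_mul hx.le, mul_div_cancel₀ _ hη.ne']; ring_nf
  exact h2.comp tendsto_natCast_atTop_atTop

/-- For x = O(log n) the square root of x is o(log n), so the factors exp (-C √D) in the tilted mass
are beaten by any power of n. -/
lemma eventually_rpow_neg_le_exp_sqrt_log (C : ℝ) {c δ : ℝ} (hδ : 0 < δ) :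
    ∀ᶠ n : ℕ in atTop, ∀ x : ℝ, 0 ≤ x → x ≤ c * Real.log n →
      (n : ℝ) ^ (-δ) ≤ Real.exp (-C * √x) := by
  have hl : Tendsto (fun n : ℕ => Real.log n) atTop atTop :=
    Real.tendsto_log_atTop.comp tendsto_natCast_atTop_atTop
  filter_upwards [hl.eventually_ge_atTop (C ^ 2 * |c| / δ ^ 2), eventually_gt_atTop 1]
    with n hn hn1 x hx0 hx
  have hn0 : (0 : ℝ) < n := by exact_mod_cast (by omega : 0 < n)
  have hlog : 0 ≤ Real.log n := Real.log_natCast_nonneg n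
  rw [Real.rpow_def_of_pos hn0, Real.exp_le_exp]
  have h1 : C * √x ≤ δ * Real.log n := by
    refine le_of_sq_le_sq ?_ (by positivity)
    rw [mul_pow, Real.sq_sqrt hx0, mul_pow]
    rw [div_le_iff₀ (by positivity)] at hn
    calc C ^ 2 * x ≤ C ^ 2 * (|c| * Real.log n) := by
          gcongr; exact hx.trans (by gcongr; exact le_abs_self c)
      _ = (C ^ 2 * |c|) * Real.log n := by ring
      _ ≤ (Real.log n * δ ^ 2) * Real.log n := by gcongr
      _ = δ ^ 2 * Real.log n ^ 2 := by ring
  linarith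

end ErrorRates

end WRT

end

/-! ### Factorisation of the sum over tuples of distinct vertices. -/

noncomputable section

namespace WRT

section TupleSum

set_option linter.unusedSectionVars false

variable {Ω : Type*} [mΩ : MeasurableSpace Ω] {μ : Measure Ω} [IsProbabilityMeasure μ]
  {W : ℕ → Ω → ℝ} {parent : ℕ → Ω → ℕ} {k : ℕ} {w M : ℝ}

/-- The tuples of distinct vertices of the tree on `1, …, N`. -/
def distinctTuples (k N : ℕ) : Finset (Fin k → ℕ) :=
  (Fintype.piFinset (fun _ : Fin k => Finset.Icc 1 N)).filter Function.Injective

/-- The sum of the joint degree tails over all tuples of distinct vertices, with oscillating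
weights. -/
def tupleSum (μ : Measure Ω) (parent : ℕ → Ω → ℕ) (N : ℕ) (D : Fin k → ℕ) (ξ : Fin k → ℝ) : ℂ :=
  ∑ a ∈ distinctTuples k N,
    (∏ i, Complex.exp (ξ i * Real.log (N / a i) * Complex.I)) * (degTail μ parent N D a : ℂ)

lemma one_le_boundConst (hw : 0 < w) (hM : 0 < M) : 1 ≤ boundConst w M := by
  have := rateConst_nonneg hw hM
  exact Real.one_le_exp (by positivity)

lemma degBound_of_le {σ : ℝ} {A b : ℕ} (N D : ℕ) (h : A ≤ b) :
    degBound w M σ A N D b = boundConst w M * (1 / b) * (N * ((1 + M) ^ D)⁻¹) := by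
  rw [degBound, if_pos h]; ring

lemma sum_degBound_late_le (hM : 0 < M) {σ : ℝ} {A N : ℕ} (hA : 1 ≤ A) (hN : 1 ≤ N) (D : ℕ) :
    ∑ b ∈ Finset.Icc A N, degBound w M σ A N D b ≤
      boundConst w M * (2 + Real.log N) * (N * ((1 + M) ^ D)⁻¹) := by
  have hC : 0 ≤ boundConst w M := (Real.exp_pos _).le
  rw [Finset.sum_congr rfl fun b hb => degBound_of_le N D (Finset.mem_Icc.1 hb).1,
    ← Finset.sum_mul, ← Finset.mul_sum]
  have hN0 : (0 : ℝ) < N := by exact_mod_cast hN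
  gcongr
  have e : Finset.Icc A N = Finset.Ico A (N + 1) := by ext; simp
  rw [e]
  refine (sum_Ico_one_div_le hA).trans ?_
  have h1 : Real.log ((N + 1 : ℕ) : ℝ) ≤ Real.log N + 1 := by
    have h2 : ((N + 1 : ℕ) : ℝ) = N * ((N + 1) / N) := by push_cast; field_simp
    rw [h2, Real.log_mul hN0.ne' (by positivity)]
    have h3 : Real.log (((N : ℝ) + 1) / N) ≤ ((N : ℝ) + 1) / N - 1 :=
      Real.log_le_sub_one_of_pos (by positivity)
    have h4 : ((N : ℝ) + 1) / N - 1 = 1 / N := by field_simp; ring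
    have h5 : 1 / (N : ℝ) ≤ 1 := by
      rw [div_le_one hN0]; exact_mod_cast hN
    linarith
  linarith

lemma sum_degBound_early_le (hM : 0 < M) {σ : ℝ} (hσ : 0 ≤ σ) {A N : ℕ} (hN : 1 ≤ N) (D : ℕ) :
    ∑ b ∈ Finset.Icc 1 N \ Finset.Icc A N, degBound w M σ A N D b ≤
      A * (boundConst w M * (((1 + M) / (1 + M * σ)) ^ D * ((N : ℝ) ^ (σ - 1) *
        (A : ℝ) ^ (M / w)))) * (N * ((1 + M) ^ D)⁻¹) := by
  have hC : 0 ≤ boundConst w M := (Real.exp_pos _).le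
  have hN0 : (0 : ℝ) < N := by exact_mod_cast hN
  have hM1 : 0 < 1 + M := by linarith
  have hMσ : 0 < 1 + M * σ := by positivity
  have h1 : ∀ b ∈ Finset.Icc 1 N \ Finset.Icc A N, degBound w M σ A N D b =
      boundConst w M * (((1 + M * σ) ^ D)⁻¹ * ((N : ℝ) ^ σ * (A : ℝ) ^ (M / w))) := by
    intro b hb
    simp only [Finset.mem_sdiff, Finset.mem_Icc] at hb
    rw [degBound, if_neg (by omega)]
  rw [Finset.sum_congr rfl h1, Finset.sum_const, nsmul_eq_mul]
  have h2 : (Finset.Icc 1 N \ Finset.Icc A N).card ≤ A := by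
    have : Finset.Icc 1 N \ Finset.Icc A N ⊆ Finset.Ico 0 A := by
      intro b hb
      simp only [Finset.mem_sdiff, Finset.mem_Icc, Finset.mem_Ico] at hb ⊢
      omega
    simpa using Finset.card_le_card this
  have h3 : ((1 + M * σ) ^ D)⁻¹ * ((N : ℝ) ^ σ * (A : ℝ) ^ (M / w)) =
      ((1 + M) / (1 + M * σ)) ^ D * ((N : ℝ) ^ (σ - 1) * (A : ℝ) ^ (M / w)) *
        (N * ((1 + M) ^ D)⁻¹) := by
    rw [Real.rpow_sub_one hN0.ne', div_pow]
    field_simp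
  rw [h3]
  have h4 : ((Finset.Icc 1 N \ Finset.Icc A N).card : ℝ) ≤ A := by exact_mod_cast h2
  calc _ ≤ (A : ℝ) * (boundConst w M * (((1 + M) / (1 + M * σ)) ^ D * ((N : ℝ) ^ (σ - 1) *
        (A : ℝ) ^ (M / w)) * (N * ((1 + M) ^ D)⁻¹))) := by gcongr
    _ = _ := by ring

/-- The sum over tuples of distinct vertices is close to a product of sums over late vertices. -/
lemma IsWRT.norm_tupleSum_sub_prod_le (hT : IsWRT μ W parent) (hw : 0 < w) (hM : 0 < M)
    (hMe : M = ∫ ω, W 1 ω ∂μ) (hb : ∀ i, 1 ≤ i → ∀ᵐ ω ∂μ, W i ω ∈ Set.Icc w 1) {σ : ℝ}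
    (hσ0 : 0 ≤ σ) (hσ1 : σ ≤ 1) {A N : ℕ} (hA : 1 ≤ A) (hAN : A ≤ N) (D : Fin k → ℕ)
    (ξ : Fin k → ℝ) {τ : ℝ} (hτ1 : approxConst k w M * (A : ℝ) ^ (-(1 / 8) : ℝ) ≤ τ)
    (hτ2 : boundConst w M * (1 / A) ≤ τ)
    (hτ3 : ∀ i, A * (boundConst w M * (((1 + M) / (1 + M * σ)) ^ D i * ((N : ℝ) ^ (σ - 1) *
        (A : ℝ) ^ (M / w)))) ≤ τ) :
    ‖tupleSum μ parent N D ξ - ∏ i, ((N : ℂ) * charSum μ (W 1) M (D i) A N (ξ i))‖ ≤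
      (1 + k + k * k) * (τ * (boundConst w M * (2 + Real.log N) + τ) ^ k) *
        (∏ i, ((N : ℝ) * ((1 + M) ^ D i)⁻¹)) + (N : ℝ) ^ k * (2 * N * Real.exp (-√A)) := by
  have hN : 1 ≤ N := hA.trans hAN
  have hN0 : (0 : ℝ) < N := by exact_mod_cast hN
  have hA0 : (0 : ℝ) < A := by exact_mod_cast hA
  have hM1 : 0 < 1 + M := by linarith
  have hC := one_le_boundConst hw hM
  have hC0 : 0 < boundConst w M := by linarith
  have hlogN : 0 ≤ Real.log N := Real.log_natCast_nonneg N
  have hτ : 0 ≤ τ := le_trans (by positivity) hτ2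
  have hb0 : ∀ i, 1 ≤ i → ∀ᵐ ω ∂μ, W i ω ∈ Set.Icc 0 1 := fun i hi =>
    (hb i hi).mono fun ω h => ⟨hw.le.trans h.1, h.2⟩
  have hbad := hT.measure_badEvent_le hb0 hMe hA N
  have hlog : ∀ b ∈ Finset.Icc A N, 0 ≤ Real.log (N / b) := by
    intro b hb'
    rw [Finset.mem_Icc] at hb'
    have : (0 : ℝ) < b := by exact_mod_cast hA.trans hb'.1
    refine Real.log_nonneg ?_
    rw [one_le_div this]; exact_mod_cast hb'.2
  have hlate : ∀ D' b : ℕ, b ∈ Finset.Icc A N → ((1 + M) ^ D')⁻¹ * (N / b) ≤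
      degBound w M σ A N D' b := by
    intro D' b hb'
    rw [degBound, if_pos (Finset.mem_Icc.1 hb').1]
    exact le_mul_of_one_le_left (by positivity) hC
  -- The scale `x i` is the size of one sum up to logarithms. The harmonic sum over late labels
  -- makes `L` logarithmic, and the summand τ in `L` absorbs the early labels.
  have key := norm_sum_injective_sub_prod_le (k := k) (s := Finset.Icc 1 N) (l := Finset.Icc A N)
    (Finset.Icc_subset_Icc_left hA) (F := degTail μ parent N D)
    (Q := fun i b => poissonMix μ (W 1) M (D i) (Real.log (N / b)))
    (B := fun i b => degBound w M σ A N (D i) b)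
    (φ := fun i b => Complex.exp (ξ i * Real.log (N / b) * Complex.I))
    (x := fun i => (N : ℝ) * ((1 + M) ^ D i)⁻¹)
    (L := boundConst w M * (2 + Real.log N) + τ) (τ := τ) (η := μ.real (badEvent W M A N))
    (by nlinarith) hτ measureReal_nonneg (fun i => by positivity)
    (fun i b => by
      rw [← Complex.ofReal_mul, Complex.norm_exp_ofReal_mul_I])
    (fun i b => degBound_nonneg hM hσ0 A N (D i) b)
    (fun a hinj ha => by
      refine (hT.abs_degTail_sub_le hw hM hb hA hAN (fun i => (Finset.mem_Icc.1 (ha i)).1)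
        (fun i => (Finset.mem_Icc.1 (ha i)).2) hinj D).trans ?_
      gcongr with i
      exact hlate _ _ (ha i))
    (fun a hinj ha => by
      rw [abs_of_nonneg (show 0 ≤ degTail μ parent N D a from measureReal_nonneg)]
      exact hT.degTail_le hw hM hσ0 hσ1 hb hA hAN (fun i => (Finset.mem_Icc.1 (ha i)).1)
        (fun i => (Finset.mem_Icc.1 (ha i)).2) hinj D)
    (fun i b hb' => by
      have hb0' : (0 : ℝ) < b := by exact_mod_cast hA.trans (Finset.mem_Icc.1 hb').1
      rw [abs_of_nonneg (poissonMix_nonneg ((hb0 1 le_rfl).mono fun _ h => h.1) hM _ (hlog b hb'))]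
      refine le_trans ?_ (hlate (D i) b hb')
      have := poissonMix_le (hT.measurable_weight 1 le_rfl) (hb0 1 le_rfl) hM zero_le_one (D i)
        (hlog b hb')
      rwa [mul_one, one_mul, Real.exp_log (by positivity)] at this)
    (fun i b hb' => by
      have hAb : (A : ℝ) ≤ b := by exact_mod_cast (Finset.mem_Icc.1 hb').1
      rw [degBound_of_le _ _ (Finset.mem_Icc.1 hb').1]
      gcongr
      refine le_trans ?_ hτ2
      gcongr)
    (fun i => by
      have h1 := sum_degBound_late_le (w := w) (σ := σ) hM hA hN (D i)
      have h2 := sum_degBound_early_le (w := w) (A := A) hM hσ0 hN (D i)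
      have h3 := mul_le_mul_of_nonneg_right (hτ3 i)
        (show 0 ≤ (N : ℝ) * ((1 + M) ^ D i)⁻¹ by positivity)
      rw [← Finset.sum_sdiff (Finset.Icc_subset_Icc_left hA : Finset.Icc A N ⊆ Finset.Icc 1 N)]
      linarith)
    (fun i => by
      have h2 := sum_degBound_early_le (w := w) (A := A) hM hσ0 hN (D i)
      have h3 := mul_le_mul_of_nonneg_right (hτ3 i)
        (show 0 ≤ (N : ℝ) * ((1 + M) ^ D i)⁻¹ by positivity)
      linarith)
  have e : ∀ i, (N : ℂ) * charSum μ (W 1) M (D i) A N (ξ i) =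
      ∑ b ∈ Finset.Icc A N, Complex.exp (ξ i * Real.log (N / b) * Complex.I) *
        (poissonMix μ (W 1) M (D i) (Real.log (N / b)) : ℂ) := by
    intro i
    have : (N : ℂ) ≠ 0 := by exact_mod_cast (by omega : N ≠ 0)
    rw [charSum, ← mul_assoc, mul_one_div_cancel this, one_mul]
  simp only [e]
  refine key.trans ?_
  rw [Nat.card_Icc, Nat.add_sub_cancel]
  gcongr

end TupleSum

end WRT

end

/-! ### Polynomial smallness of the errors for labels split at n ^ η. -/

noncomputable section

namespace WRT

section TupleSumLimit

set_option linter.unusedSectionVars false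

/-- The label which separates early vertices from late ones. -/
def cutoff (η : ℝ) (n : ℕ) : ℕ := ⌈(n : ℝ) ^ η⌉₊

lemma le_cutoff (η : ℝ) (n : ℕ) : (n : ℝ) ^ η ≤ cutoff η n := Nat.le_ceil _

lemma one_le_cutoff (η : ℝ) {n : ℕ} (hn : 1 ≤ n) : 1 ≤ cutoff η n := by
  have : (0 : ℝ) < n := by exact_mod_cast hn
  exact Nat.ceil_pos.2 (by positivity)

lemma cutoff_le {η : ℝ} (hη : η ≤ 1) {n : ℕ} (hn : 1 ≤ n) : cutoff η n ≤ n := by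
  refine Nat.ceil_le.2 ?_
  have : (1 : ℝ) ≤ n := by exact_mod_cast hn
  simpa using Real.rpow_le_rpow_of_exponent_le this hη

lemma cutoff_le_two_mul {η : ℝ} (hη : 0 ≤ η) {n : ℕ} (hn : 1 ≤ n) :
    (cutoff η n : ℝ) ≤ 2 * (n : ℝ) ^ η := by
  have h1 : (1 : ℝ) ≤ n := by exact_mod_cast hn
  have h2 : 1 ≤ (n : ℝ) ^ η := Real.one_le_rpow h1 hη
  have := Nat.ceil_lt_add_one (show 0 ≤ (n : ℝ) ^ η by positivity)
  unfold cutoff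
  linarith

lemma cutoff_rpow_le {η ε : ℝ} (hε : ε ≤ η / 8) {n : ℕ} (hn : 1 ≤ n) :
    (cutoff η n : ℝ) ^ (-(1 / 8) : ℝ) ≤ (n : ℝ) ^ (-ε) := by
  have h1 : (1 : ℝ) ≤ n := by exact_mod_cast hn
  have h0 : (0 : ℝ) < n := by linarith
  calc (cutoff η n : ℝ) ^ (-(1 / 8) : ℝ) ≤ ((n : ℝ) ^ η) ^ (-(1 / 8) : ℝ) :=
        Real.rpow_le_rpow_of_nonpos (by positivity) (le_cutoff η n) (by norm_num)
    _ = (n : ℝ) ^ (η * -(1 / 8)) := by rw [← Real.rpow_mul h0.le]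
    _ ≤ (n : ℝ) ^ (-ε) := Real.rpow_le_rpow_of_exponent_le h1 (by linarith)

lemma one_div_cutoff_le {η ε : ℝ} (hε : ε ≤ η / 8) {n : ℕ} (hn : 1 ≤ n) :
    1 / (cutoff η n : ℝ) ≤ (n : ℝ) ^ (-ε) := by
  refine le_trans ?_ (cutoff_rpow_le hε hn)
  have h1 : (1 : ℝ) ≤ cutoff η n := by exact_mod_cast one_le_cutoff η hn
  rw [one_div, ← Real.rpow_neg_one]
  exact Real.rpow_le_rpow_of_exponent_le h1 (by norm_num)

variable {w M c σ η ε : ℝ}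

lemma early_rate_le (hM : 0 < M) (hw : 0 < w) (hσ0 : 0 ≤ σ) (hσ1 : σ < 1) (hη : 0 < η)
    (hexp : c * Real.log ((1 + M) / (1 + M * σ)) + η * (1 + M / w) - (1 - σ) ≤ -ε) {n D : ℕ}
    (hn : 1 ≤ n) (hD : (D : ℝ) ≤ c * Real.log n) :
    cutoff η n * (boundConst w M * (((1 + M) / (1 + M * σ)) ^ D * ((n : ℝ) ^ (σ - 1) *
      (cutoff η n : ℝ) ^ (M / w)))) ≤
        boundConst w M * 2 ^ (1 + M / w) * (n : ℝ) ^ (-ε) := by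
  have h1 : (1 : ℝ) ≤ n := by exact_mod_cast hn
  have h0 : (0 : ℝ) < n := by linarith
  have hA0 : (0 : ℝ) < cutoff η n := by exact_mod_cast one_le_cutoff η hn
  have hC : 0 < boundConst w M := Real.exp_pos _
  have hx : 1 ≤ (1 + M) / (1 + M * σ) := by
    rw [one_le_div (by positivity)]; nlinarith
  have hR := pow_le_rpow_log hx h0 hD
  have hA : (cutoff η n : ℝ) * (cutoff η n : ℝ) ^ (M / w) ≤
      2 ^ (1 + M / w) * (n : ℝ) ^ (η * (1 + M / w)) := by
    rw [Real.rpow_mul h0.le, ← Real.mul_rpow (by norm_num) (by positivity),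
      ← Real.rpow_one_add' hA0.le (by positivity)]
    exact Real.rpow_le_rpow hA0.le (cutoff_le_two_mul hη.le hn) (by positivity)
  calc _ = boundConst w M * (((1 + M) / (1 + M * σ)) ^ D * (n : ℝ) ^ (σ - 1) *
        ((cutoff η n : ℝ) * (cutoff η n : ℝ) ^ (M / w))) := by ring
    _ ≤ boundConst w M * ((n : ℝ) ^ (c * Real.log ((1 + M) / (1 + M * σ))) *
        (n : ℝ) ^ (σ - 1) * (2 ^ (1 + M / w) * (n : ℝ) ^ (η * (1 + M / w)))) := by gcongr
    _ = boundConst w M * 2 ^ (1 + M / w) *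
        (n : ℝ) ^ (c * Real.log ((1 + M) / (1 + M * σ)) + (σ - 1) + η * (1 + M / w)) := by
        rw [Real.rpow_add h0, Real.rpow_add h0]; ring
    _ ≤ _ := by
        gcongr
        linarith

/-- The exponent inequality chosen for early vertices leaves room here, because η (1 - σ) is at most
η (1 + M / w). -/
lemma tail_rate_le (hM : 0 < M) (hw : 0 < w) (hσ0 : 0 ≤ σ) (hσ1 : σ < 1) (hη : 0 < η)
    (hexp : c * Real.log ((1 + M) / (1 + M * σ)) + η * (1 + M / w) - (1 - σ) ≤ -ε) {n D : ℕ}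
    (hn : 1 ≤ n) (hD : (D : ℝ) ≤ c * Real.log n) :
    ((1 + M) / (1 + M * σ)) ^ D * (((cutoff η n : ℝ) / n) ^ (1 - σ) / (1 - σ)) ≤
      2 / (1 - σ) * (n : ℝ) ^ (-ε) := by
  have h1 : (1 : ℝ) ≤ n := by exact_mod_cast hn
  have h0 : (0 : ℝ) < n := by linarith
  have hσ : 0 < 1 - σ := by linarith
  have hx : 1 ≤ (1 + M) / (1 + M * σ) := by
    rw [one_le_div (by positivity)]; nlinarith
  have hR := pow_le_rpow_log hx h0 hD
  have hA : ((cutoff η n : ℝ) / n) ^ (1 - σ) ≤ 2 * (n : ℝ) ^ ((η - 1) * (1 - σ)) := by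
    calc ((cutoff η n : ℝ) / n) ^ (1 - σ) ≤ (2 * (n : ℝ) ^ (η - 1)) ^ (1 - σ) := by
          refine Real.rpow_le_rpow (by positivity) ?_ hσ.le
          rw [Real.rpow_sub_one h0.ne', mul_div_assoc']
          gcongr
          exact cutoff_le_two_mul hη.le hn
      _ = 2 ^ (1 - σ) * (n : ℝ) ^ ((η - 1) * (1 - σ)) := by
          rw [Real.mul_rpow (by norm_num) (by positivity), ← Real.rpow_mul h0.le]
      _ ≤ 2 * (n : ℝ) ^ ((η - 1) * (1 - σ)) := by
          gcongr
          calc (2 : ℝ) ^ (1 - σ) ≤ 2 ^ (1 : ℝ) :=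
                Real.rpow_le_rpow_of_exponent_le (by norm_num) (by linarith)
            _ = 2 := by norm_num
  have hq : 0 < η * (M / w) := by positivity
  have hησ : 0 ≤ η * σ := by positivity
  calc _ ≤ (n : ℝ) ^ (c * Real.log ((1 + M) / (1 + M * σ))) *
        (2 * (n : ℝ) ^ ((η - 1) * (1 - σ)) / (1 - σ)) := by gcongr
    _ = 2 / (1 - σ) *
        (n : ℝ) ^ (c * Real.log ((1 + M) / (1 + M * σ)) + (η - 1) * (1 - σ)) := by
        rw [Real.rpow_add h0]; ring
    _ ≤ _ := by
        gcongr
        nlinarith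

variable {Ω : Type*} [mΩ : MeasurableSpace Ω] {μ : Measure Ω} [IsProbabilityMeasure μ]
  {W : ℕ → Ω → ℝ} {parent : ℕ → Ω → ℕ} {V : Ω → ℝ} {k : ℕ} {b c₁ : ℝ}

lemma eventually_rpow_neg_le_tiltMass (hVm : Measurable V) (hc₁ : 0 < c₁)
    (hw : w ∈ Set.Ioo (0 : ℝ) 1)
    (hV : ∀ x ∈ Set.Ico w 1, μ.real {ω | x ≤ V ω} = gammaFractionTail b c₁ w x) (hM : 0 < M)
    {D : ℕ → ℕ} (hD : Tendsto D atTop atTop) (hDc : ∀ᶠ n : ℕ in atTop, (D n : ℝ) ≤ c * Real.log n)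
    {δ : ℝ} (hδ : 0 < δ) :
    ∀ᶠ n : ℕ in atTop, (n : ℝ) ^ (-δ) ≤ (1 + M) ^ D n * tiltMass μ V M (D n) := by
  filter_upwards [hD.eventually (tiltMass_ge hVm hc₁ hw hV hM one_pos), hDc,
    eventually_rpow_neg_le_exp_sqrt_log (2 * (M / (1 + M)) * tiltCenter c₁ M + 1) (c := c) hδ]
    with n h1 h2 h3
  exact (h3 _ (Nat.cast_nonneg _) h2).trans h1

/-- On the scale (1 + M) ^ (-D) the Riemann-sum error is O(n ^ (-ε)) and the mass is at least n ^
(-ε / 2), so the quotient tends to zero. -/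
lemma tendsto_charSum_sub_charInt (hVm : Measurable V) (hc₁ : 0 < c₁)
    (hw : w ∈ Set.Ioo (0 : ℝ) 1)
    (hV : ∀ x ∈ Set.Ico w 1, μ.real {ω | x ≤ V ω} = gammaFractionTail b c₁ w x) (hM : 0 < M)
    (hσ0 : 0 ≤ σ) (hσ1 : σ < 1) (hη : 0 < η) (hη1 : η < 1) (hε : 0 < ε) (hεη : ε ≤ η / 8)
    (hexp : c * Real.log ((1 + M) / (1 + M * σ)) + η * (1 + M / w) - (1 - σ) ≤ -ε)
    {D : ℕ → ℕ} (hD : Tendsto D atTop atTop) (hDc : ∀ᶠ n : ℕ in atTop, (D n : ℝ) ≤ c * Real.log n)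
    {ξ : ℕ → ℝ} (hξ : ∀ᶠ n : ℕ in atTop, |ξ n| ≤ 1) :
    Tendsto (fun n : ℕ => charSum μ V M (D n) (cutoff η n) n (ξ n) / (tiltMass μ V M (D n) : ℂ) -
      charInt μ V M (D n) (ξ n) / (tiltMass μ V M (D n) : ℂ)) atTop (𝓝 0) := by
  have hV01 : ∀ᵐ ω ∂μ, V ω ∈ Set.Icc (0 : ℝ) 1 :=
    (ae_mem_Ico hVm hc₁ hw hV).mono fun ω h => ⟨hw.1.le.trans h.1, h.2.le⟩
  have hζ := zetaConst_nonneg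
  set K : ℝ := (1 + (1 + M) / M) * zetaConst + 1 + 2 / (1 - σ) with hK
  have hlim : Tendsto (fun n : ℕ => K * (n : ℝ) ^ (-(ε / 2))) atTop (𝓝 0) := by
    have := ((tendsto_rpow_neg_atTop (half_pos hε)).comp
      tendsto_natCast_atTop_atTop).const_mul K
    simpa using this
  refine squeeze_zero_norm' ?_ hlim
  filter_upwards [eventually_rpow_neg_le_tiltMass hVm hc₁ hw hV hM hD hDc (half_pos hε), hDc, hξ,
    eventually_ge_atTop 1] with n hr hDn hξn hn
  have h1 : (1 : ℝ) ≤ n := by exact_mod_cast hn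
  have h0 : (0 : ℝ) < n := by linarith
  have hθ : 0 < (1 + M) ^ D n := by positivity
  have hσθ : 0 < (1 + M * σ) ^ D n := by positivity
  have hr0 : 0 < (1 + M) ^ D n * tiltMass μ V M (D n) := lt_of_lt_of_le (by positivity) hr
  have hT0 : 0 < tiltMass μ V M (D n) := by
    by_contra h
    push Not at h
    exact absurd hr0 (not_lt.2 (mul_nonpos_of_nonneg_of_nonpos hθ.le h))
  have hb := norm_charSum_sub_charInt_le hVm hV01 hM (D n) (ξ n) hσ0 hσ1 (one_le_cutoff η hn)
    (cutoff_le hη1.le hn)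
  have e1 := cutoff_rpow_le hεη hn
  have e2 := one_div_cutoff_le hεη hn
  have e3 := tail_rate_le hM hw.1 hσ0 hσ1 hη hexp hn hDn
  have hσ : 0 < 1 - σ := by linarith
  have hx : 0 < (n : ℝ) ^ (-ε) := by positivity
  have e4 : (1 + M) ^ D n * ‖charSum μ V M (D n) (cutoff η n) n (ξ n) -
      charInt μ V M (D n) (ξ n)‖ ≤ K * (n : ℝ) ^ (-ε) := by
    calc _ ≤ (1 + M) ^ D n * (((1 + M) ^ D n)⁻¹ * ((|ξ n| + (1 + M) / M) * zetaConst *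
          (cutoff η n : ℝ) ^ (-(1 / 8) : ℝ) + 1 / (cutoff η n : ℝ)) +
          ((1 + M * σ) ^ D n)⁻¹ * (((cutoff η n : ℝ) / n) ^ (1 - σ) / (1 - σ))) :=
          mul_le_mul_of_nonneg_left hb hθ.le
      _ = ((|ξ n| + (1 + M) / M) * zetaConst *
          (cutoff η n : ℝ) ^ (-(1 / 8) : ℝ) + 1 / (cutoff η n : ℝ)) +
          ((1 + M) / (1 + M * σ)) ^ D n * (((cutoff η n : ℝ) / n) ^ (1 - σ) / (1 - σ)) := by
          rw [mul_add, ← mul_assoc, mul_inv_cancel₀ hθ.ne', one_mul, div_pow]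
          ring
      _ ≤ ((1 + (1 + M) / M) * zetaConst * (n : ℝ) ^ (-ε) + (n : ℝ) ^ (-ε)) +
          2 / (1 - σ) * (n : ℝ) ^ (-ε) := by gcongr
      _ = K * (n : ℝ) ^ (-ε) := by rw [hK]; ring
  rw [← sub_div, norm_div, Complex.norm_real, Real.norm_eq_abs, abs_of_pos hT0]
  have hK0 : 0 < K := by positivity
  calc _ = ((1 + M) ^ D n * ‖charSum μ V M (D n) (cutoff η n) n (ξ n) -
      charInt μ V M (D n) (ξ n)‖) / ((1 + M) ^ D n * tiltMass μ V M (D n)) := by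
        rw [mul_div_mul_left _ _ hθ.ne']
    _ ≤ (K * (n : ℝ) ^ (-ε)) / (n : ℝ) ^ (-(ε / 2)) := by gcongr
    _ = K * (n : ℝ) ^ (-(ε / 2)) := by
        rw [mul_div_assoc, ← Real.rpow_sub h0]; congr 2; ring

end TupleSumLimit

end WRT

end

/-! ### Limit of the normalised tuple sum. -/

noncomputable section

namespace WRT

section TupleSumRatio

variable {Ω : Type*} [mΩ : MeasurableSpace Ω] {μ : Measure Ω} [IsProbabilityMeasure μ]
  {W : ℕ → Ω → ℝ} {parent : ℕ → Ω → ℕ} {k : ℕ} {w M c b c₁ : ℝ}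

/-- The normalisation of `tupleSum`. -/
def tupleNorm (μ : Measure Ω) (V : Ω → ℝ) (M : ℝ) (n : ℕ) (D : Fin k → ℕ) : ℝ :=
  ∏ i, ((n : ℝ) * tiltMass μ V M (D i))

/-- The factorisation error is n ^ (-ε) times a power of log n, against a product of masses of at
least n ^ (-ε / 2). The bad environments contribute a power of n times exp (-n ^ (η / 2)), which no
normalisation by powers of n can spoil. -/
lemma IsWRT.tendsto_tupleSum_sub_prod (hT : IsWRT μ W parent) (hc₁ : 0 < c₁)
    (hw : w ∈ Set.Ioo (0 : ℝ) 1)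
    (hW : ∀ i, 1 ≤ i → ∀ x ∈ Set.Ico w 1, μ.real {ω | x ≤ W i ω} = gammaFractionTail b c₁ w x)
    (hM : 0 < M) (hMe : M = ∫ ω, W 1 ω ∂μ) {σ η ε : ℝ}
    (hσ0 : 0 ≤ σ) (hσ1 : σ < 1) (hη : 0 < η) (hη1 : η < 1) (hε : 0 < ε) (hεη : ε ≤ η / 8)
    (hexp : c * Real.log ((1 + M) / (1 + M * σ)) + η * (1 + M / w) - (1 - σ) ≤ -ε)
    {D : Fin k → ℕ → ℕ} (hD : ∀ i, Tendsto (D i) atTop atTop)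
    (hDc : ∀ i, ∀ᶠ n : ℕ in atTop, (D i n : ℝ) ≤ c * Real.log n) (ξ : Fin k → ℕ → ℝ) :
    Tendsto (fun n : ℕ => (tupleSum μ parent n (fun i => D i n) (fun i => ξ i n) -
      ∏ i, ((n : ℂ) * charSum μ (W 1) M (D i n) (cutoff η n) n (ξ i n))) /
        (tupleNorm μ (W 1) M n (fun i => D i n) : ℂ)) atTop (𝓝 0) := by
  have hVm := hT.measurable_weight 1 le_rfl
  have hV := hW 1 le_rfl
  have hb : ∀ i, 1 ≤ i → ∀ᵐ ω ∂μ, W i ω ∈ Set.Icc w 1 := fun i hi =>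
    (ae_mem_Ico (hT.measurable_weight i hi) hc₁ hw (hW i hi)).mono fun ω h => ⟨h.1, h.2.le⟩
  have hC0 : 0 < boundConst w M := Real.exp_pos _
  have hAC : 0 ≤ approxConst k w M := approxConst_nonneg hw.1 hM
  set K : ℝ := approxConst k w M + boundConst w M + boundConst w M * 2 ^ (1 + M / w) with hK
  have hp : 0 < boundConst w M * 2 ^ (1 + M / w) := by positivity
  have hK0 : 0 < K := by positivity
  -- The powers of n multiplying the bad probability: one from the union bound, then the product of
  -- the (1 + M) ^ D, then the inverse masses. The n ^ k cancels.
  set p : ℝ := 1 + c * Real.log (1 + M) * k + ε / 2 with hpdef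
  have hlim : Tendsto (fun n : ℕ => ((1 + k + k * k : ℝ) * K) * ((n : ℝ) ^ (-(ε / 2)) *
      ((2 * boundConst w M + K) + boundConst w M * Real.log n) ^ k) +
      2 * ((n : ℝ) ^ p * Real.exp (-(n : ℝ) ^ (η / 2)))) atTop (𝓝 0) := by
    simpa using ((tendsto_rpow_neg_mul_log_pow (half_pos hε) (2 * boundConst w M + K)
      (boundConst w M) k).const_mul ((1 + k + k * k : ℝ) * K)).add
      ((tendsto_rpow_mul_exp_neg_rpow (half_pos hη) p).const_mul 2)
  refine squeeze_zero_norm' ?_ hlim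
  -- The `k` factors together may lose at most n ^ (-ε / 2); dividing by `k + 1` also covers `k =
  -- 0`.
  set δ : ℝ := ε / (2 * (k + 1)) with hδ
  have hδ0 : 0 < δ := by positivity
  have hδk : δ * k ≤ ε / 2 := by
    rw [hδ, div_mul_eq_mul_div, div_le_div_iff₀ (by positivity) (by norm_num)]
    nlinarith
  filter_upwards [eventually_all.2 fun i =>
    eventually_rpow_neg_le_tiltMass hVm hc₁ hw hV hM (hD i) (hDc i) hδ0,
    eventually_all.2 hDc, eventually_ge_atTop 1] with n hr hDn hn
  have h1 : (1 : ℝ) ≤ n := by exact_mod_cast hn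
  have h0 : (0 : ℝ) < n := by linarith
  have hx : 0 < (n : ℝ) ^ (-ε) := by positivity
  have hx1 : (n : ℝ) ^ (-ε) ≤ 1 := Real.rpow_le_one_of_one_le_of_nonpos h1 (by linarith)
  have hlogn : 0 ≤ Real.log n := Real.log_nonneg h1
  have hkey := hT.norm_tupleSum_sub_prod_le hw.1 hM hMe hb hσ0 hσ1.le (one_le_cutoff η hn)
    (cutoff_le hη1.le hn) (fun i => D i n) (fun i => ξ i n) (τ := K * (n : ℝ) ^ (-ε))
    (by
      have := mul_le_mul_of_nonneg_left (cutoff_rpow_le hεη hn) hAC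
      refine this.trans ?_
      gcongr
      linarith)
    (by
      have := mul_le_mul_of_nonneg_left (one_div_cutoff_le hεη hn) hC0.le
      refine this.trans ?_
      gcongr
      linarith)
    (fun i => by
      refine (early_rate_le hM hw.1 hσ0 hσ1 hη hexp hn (hDn i)).trans ?_
      gcongr
      linarith)
  set P : ℝ := ∏ i, ((1 + M) ^ D i n * tiltMass μ (W 1) M (D i n)) with hP
  have hPge : (n : ℝ) ^ (-(ε / 2)) ≤ P := by
    calc (n : ℝ) ^ (-(ε / 2)) ≤ (n : ℝ) ^ (-δ * k) :=
          Real.rpow_le_rpow_of_exponent_le h1 (by linarith)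
      _ = ∏ _i : Fin k, (n : ℝ) ^ (-δ) := by
          rw [Real.rpow_mul h0.le, Real.rpow_natCast]; simp
      _ ≤ P := Finset.prod_le_prod (fun i _ => by positivity) fun i _ => hr i
  have hP0 : 0 < P := lt_of_lt_of_le (by positivity) hPge
  have hPinv : P⁻¹ ≤ (n : ℝ) ^ (ε / 2) := by
    rw [inv_le_comm₀ hP0 (by positivity), ← Real.rpow_neg h0.le]; exact hPge
  set Q : ℝ := ∏ i, (1 + M) ^ D i n with hQ
  have hQ0 : 0 < Q := Finset.prod_pos fun i _ => by positivity
  have hQle : Q ≤ (n : ℝ) ^ (c * Real.log (1 + M) * k) := by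
    calc Q ≤ ∏ _i : Fin k, (n : ℝ) ^ (c * Real.log (1 + M)) :=
          Finset.prod_le_prod (fun i _ => by positivity) fun i _ =>
            pow_le_rpow_log (by linarith) h0 (hDn i)
      _ = _ := by
          rw [Finset.prod_const, Finset.card_univ, Fintype.card_fin, Real.rpow_mul h0.le _ (k : ℝ),
            Real.rpow_natCast]
  have hnorm : tupleNorm μ (W 1) M n (fun i => D i n) = (n : ℝ) ^ k * (P / Q) := by
    rw [tupleNorm, Finset.prod_mul_distrib, hP, Finset.prod_mul_distrib, ← hQ,
      mul_div_cancel_left₀ _ hQ0.ne']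
    simp
  have hprod : ∏ i, ((n : ℝ) * ((1 + M) ^ D i n)⁻¹) = (n : ℝ) ^ k * Q⁻¹ := by
    rw [Finset.prod_mul_distrib, hQ, Finset.prod_inv_distrib]; simp
  rw [hprod] at hkey
  have hA : (n : ℝ) ^ (η / 2) ≤ √(cutoff η n) := by
    refine Real.le_sqrt_of_sq_le ?_
    rw [← Real.rpow_natCast, ← Real.rpow_mul h0.le]
    refine le_trans (le_of_eq ?_) (le_cutoff η n)
    congr 1; push_cast; ring
  rw [hnorm, norm_div, Complex.norm_real, Real.norm_eq_abs, abs_of_pos (by positivity)]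
  calc _ ≤ ((1 + k + k * k) * (K * (n : ℝ) ^ (-ε) * (boundConst w M * (2 + Real.log n) +
          K * (n : ℝ) ^ (-ε)) ^ k) * ((n : ℝ) ^ k * Q⁻¹) +
          (n : ℝ) ^ k * (2 * n * Real.exp (-√(cutoff η n)))) / ((n : ℝ) ^ k * (P / Q)) := by
        gcongr
    _ = (1 + k + k * k) * (K * (n : ℝ) ^ (-ε) * (boundConst w M * (2 + Real.log n) +
          K * (n : ℝ) ^ (-ε)) ^ k) * P⁻¹ +
          2 * n * Real.exp (-√(cutoff η n)) * Q * P⁻¹ := by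
        field_simp
    _ ≤ (1 + k + k * k) * (K * (n : ℝ) ^ (-ε) * (boundConst w M * (2 + Real.log n) +
          K * 1) ^ k) * (n : ℝ) ^ (ε / 2) +
          2 * n * Real.exp (-(n : ℝ) ^ (η / 2)) * (n : ℝ) ^ (c * Real.log (1 + M) * k) *
            (n : ℝ) ^ (ε / 2) := by
        gcongr
    _ = _ := by
        have e1 : (n : ℝ) ^ (-(ε / 2)) = (n : ℝ) ^ (-ε) * (n : ℝ) ^ (ε / 2) := by
          rw [← Real.rpow_add h0]; congr 1; ring
        have e2 : (n : ℝ) ^ p = n * (n : ℝ) ^ (c * Real.log (1 + M) * k) * (n : ℝ) ^ (ε / 2) := by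
          rw [hpdef, Real.rpow_add h0, Real.rpow_add h0, Real.rpow_one]
        rw [e1, e2]
        ring

/-- The limit of the normalised sum over tuples, given the limits of the single factors. -/
lemma IsWRT.tendsto_tupleSum_div (hT : IsWRT μ W parent) (hc₁ : 0 < c₁)
    (hw : w ∈ Set.Ioo (0 : ℝ) 1)
    (hW : ∀ i, 1 ≤ i → ∀ x ∈ Set.Ico w 1, μ.real {ω | x ≤ W i ω} = gammaFractionTail b c₁ w x)
    (hM : 0 < M) (hMe : M = ∫ ω, W 1 ω ∂μ) (hc : 0 < c) (hcM : c * M < 1 + M)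
    {D : Fin k → ℕ → ℕ} (hD : ∀ i, Tendsto (D i) atTop atTop)
    (hDc : ∀ i, ∀ᶠ n : ℕ in atTop, (D i n : ℝ) ≤ c * Real.log n) {ξ : Fin k → ℕ → ℝ}
    (hξ : ∀ i, ∀ᶠ n : ℕ in atTop, |ξ i n| ≤ 1) {z : Fin k → ℕ → ℂ} (hz : ∀ i n, ‖z i n‖ = 1)
    {l : Fin k → ℂ}
    (hl : ∀ i, Tendsto (fun n => z i n * charInt μ (W 1) M (D i n) (ξ i n) /
      (tiltMass μ (W 1) M (D i n) : ℂ)) atTop (𝓝 (l i))) :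
    Tendsto (fun n : ℕ => (∏ i, z i n) * tupleSum μ parent n (fun i => D i n) (fun i => ξ i n) /
      (tupleNorm μ (W 1) M n (fun i => D i n) : ℂ)) atTop (𝓝 (∏ i, l i)) := by
  obtain ⟨σ, η, ε, hσ0, hσ1, hη, hη1, hε, hεη, hexp⟩ := exists_exponents hM hw.1 hc hcM
  have hVm := hT.measurable_weight 1 le_rfl
  have hV := hW 1 le_rfl
  have hbdd : ∀ {f g : ℕ → ℂ}, (∀ n, ‖g n‖ = 1) → Tendsto f atTop (𝓝 0) →
      Tendsto (fun n => g n * f n) atTop (𝓝 0) := by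
    intro f g hg hf
    refine squeeze_zero_norm (a := fun n => ‖f n‖) (fun n => ?_) (by simpa using hf.norm)
    rw [norm_mul, hg, one_mul]
  have h1 : ∀ i, Tendsto (fun n : ℕ => z i n * (charSum μ (W 1) M (D i n) (cutoff η n) n (ξ i n) /
      (tiltMass μ (W 1) M (D i n) : ℂ))) atTop (𝓝 (l i)) := by
    intro i
    have h2 := (hl i).add (hbdd (hz i) (tendsto_charSum_sub_charInt hVm hc₁ hw hV hM hσ0 hσ1 hη
      hη1 hε hεη hexp (hD i) (hDc i) (hξ i)))
    rw [add_zero] at h2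
    refine h2.congr fun n => ?_
    ring
  have h3 := tendsto_finsetProd Finset.univ fun i _ => h1 i
  have h4 := hbdd (g := fun n => ∏ i, z i n) (fun n => by rw [norm_prod]; simp [hz])
    (hT.tendsto_tupleSum_sub_prod hc₁ hw hW hM hMe hσ0 hσ1 hη hη1 hε hεη hexp hD hDc ξ)
  have h5 := h3.add h4
  rw [add_zero] at h5
  refine h5.congr' ?_
  filter_upwards [eventually_ge_atTop 1] with n hn
  have hn0 : (n : ℂ) ≠ 0 := by exact_mod_cast (by omega : n ≠ 0)
  have e : ∏ i, z i n * (charSum μ (W 1) M (D i n) (cutoff η n) n (ξ i n) /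
      (tiltMass μ (W 1) M (D i n) : ℂ)) =
      (∏ i, z i n) * ((∏ i, ((n : ℂ) * charSum μ (W 1) M (D i n) (cutoff η n) n (ξ i n))) /
        (tupleNorm μ (W 1) M n (fun i => D i n) : ℂ)) := by
    rw [tupleNorm, Complex.ofReal_prod, ← Finset.prod_div_distrib, ← Finset.prod_mul_distrib]
    refine Finset.prod_congr rfl fun i _ => ?_
    push_cast
    rw [mul_div_mul_left _ _ hn0]
  rw [e]
  ring

end TupleSumRatio

end WRT

end

/-! ### From sampled labels to sums over tuples. -/

noncomputable section

namespace WRT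

section Sampling

set_option linter.unusedSectionVars false

variable {Ω : Type*} [mΩ : MeasurableSpace Ω] {μ : Measure Ω} [IsProbabilityMeasure μ]
  {W : ℕ → Ω → ℝ} {parent : ℕ → Ω → ℕ} {k : ℕ} {v : ℕ → Fin k → Ω → ℕ}

lemma coe_distinctTuples (k n : ℕ) : (distinctTuples k n : Set (Fin k → ℕ)) =
    {a : Fin k → ℕ | Function.Injective a ∧ ∀ i, a i ∈ Finset.Icc 1 n} := by
  ext a
  simp [distinctTuples, and_comm]

lemma IsUniformSample.measurable_tuple (hv : IsUniformSample μ W parent v) {n : ℕ} (hn : k ≤ n) :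
    Measurable fun ω i => v n i ω :=
  measurable_pi_lambda _ fun i => hv.measurable n hn i

lemma IsUniformSample.ae_mem (hv : IsUniformSample μ W parent v) {n : ℕ} (hn : k ≤ n) :
    ∀ᵐ ω ∂μ, (fun i => v n i ω) ∈ distinctTuples k n := by
  have h1 : μ.map (fun ω i => v n i ω) (distinctTuples k n : Set (Fin k → ℕ))ᶜ = 0 := by
    rw [hv.law n hn, ← coe_distinctTuples,
      uniformOn_eq_zero_iff (distinctTuples k n).finite_toSet, Set.inter_compl_self]
  rw [Measure.map_apply (hv.measurable_tuple hn) (Set.to_countable _).measurableSet] at h1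
  exact measure_eq_zero_iff_ae_notMem.1 h1 |>.mono fun ω h => by simpa using h

lemma IsUniformSample.measureReal_eq (hv : IsUniformSample μ W parent v) {n : ℕ} (hn : k ≤ n)
    {a : Fin k → ℕ} (ha : a ∈ distinctTuples k n) :
    μ.real {ω | (fun i => v n i ω) = a} = ((distinctTuples k n).card : ℝ)⁻¹ := by
  classical
  have h1 : μ.map (fun ω i => v n i ω) ({a} : Set (Fin k → ℕ)) =
      ((distinctTuples k n).card : ENNReal)⁻¹ := by
    rw [hv.law n hn, ← coe_distinctTuples, ← Finset.coe_singleton, uniformOn_apply_finset,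
      Finset.inter_singleton_of_mem ha]
    simp
  rw [Measure.map_apply (hv.measurable_tuple hn) (Set.to_countable _).measurableSet] at h1
  change (μ ((fun ω i => v n i ω) ⁻¹' {a})).toReal = _
  rw [h1]; simp

lemma measurableSet_degrees_ge (n : ℕ) (D a : Fin k → ℕ) :
    MeasurableSet {p : (ℕ → ℝ) × (ℕ → ℕ) |
      ∀ i, D i ≤ ((Finset.Icc 2 n).filter fun j => p.2 (j - 2) = a i).card} := by
  rw [Set.ofPred_forall]
  refine MeasurableSet.iInter fun i => measurableSet_le measurable_const ?_
  simp only [Finset.card_filter]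
  refine Finset.measurable_sum _ fun j _ => Measurable.ite ?_ measurable_const measurable_const
  have hj : Measurable fun p : (ℕ → ℝ) × (ℕ → ℕ) => p.2 (j - 2) :=
    (measurable_pi_apply (j - 2)).comp measurable_snd
  exact hj (measurableSet_singleton (a i))

/-- Once the sampled tuple is fixed, the degree event concerns only the tree and is independent of
the sample. The index shift by 2 matches the parent sequence in `IsUniformSample.indep`. -/
lemma IsUniformSample.measureReal_inter (hv : IsUniformSample μ W parent v) {n : ℕ} (hn : k ≤ n)
    {a : Fin k → ℕ} (ha : a ∈ distinctTuples k n) (D : Fin k → ℕ) :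
    μ.real ({ω | (fun i => v n i ω) = a} ∩ {ω | ∀ i, D i ≤ inDegree parent n (v n i ω) ω}) =
      ((distinctTuples k n).card : ℝ)⁻¹ * degTail μ parent n D a := by
  have h1 := (hv.indep n hn).measure_inter_preimage_eq_mul {a} _ (Set.to_countable _).measurableSet
    (measurableSet_degrees_ge n D a)
  have h2 : (fun ω => ((fun i : ℕ => W (i + 1) ω), (fun j : ℕ => parent (j + 2) ω))) ⁻¹'
      {p : (ℕ → ℝ) × (ℕ → ℕ) |
        ∀ i, D i ≤ ((Finset.Icc 2 n).filter fun j => p.2 (j - 2) = a i).card} =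
      {ω | ∀ i, D i ≤ inDegree parent n (a i) ω} := by
    ext ω
    refine forall_congr' fun i => ?_
    have : ((Finset.Icc 2 n).filter fun j => parent (j - 2 + 2) ω = a i) =
        (Finset.Icc 2 n).filter fun j => parent j ω = a i := by
      refine Finset.filter_congr fun j hj => ?_
      rw [Nat.sub_add_cancel (Finset.mem_Icc.1 hj).1]
    rw [inDegree, ← this]
  rw [h2] at h1
  have h3 : {ω | (fun i => v n i ω) = a} ∩ {ω | ∀ i, D i ≤ inDegree parent n (v n i ω) ω} =
      (fun ω i => v n i ω) ⁻¹' {a} ∩ {ω | ∀ i, D i ≤ inDegree parent n (a i) ω} := by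
    ext ω
    refine and_congr_right fun (h : (fun i => v n i ω) = a) => ?_
    refine forall_congr' fun i => ?_
    rw [← congrFun h i]
  rw [h3, measureReal_def, h1, ENNReal.toReal_mul, ← hv.measureReal_eq hn ha]
  rfl

/-- Expectations over the sampled tuple on the event that the sampled degrees are large. -/
lemma IsUniformSample.setIntegral_eq (hv : IsUniformSample μ W parent v) {n : ℕ} (hn : k ≤ n)
    (D : Fin k → ℕ) (f : (Fin k → ℕ) → ℂ) :
    ∫ ω in {ω | ∀ i, D i ≤ inDegree parent n (v n i ω) ω}, f (fun i => v n i ω) ∂μ =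
      ((distinctTuples k n).card : ℂ)⁻¹ *
        ∑ a ∈ distinctTuples k n, f a * (degTail μ parent n D a : ℂ) := by
  classical
  set H := {ω | ∀ i, D i ≤ inDegree parent n (v n i ω) ω} with hH
  have hm : ∀ a : Fin k → ℕ, MeasurableSet {ω | (fun i => v n i ω) = a} := fun a =>
    hv.measurable_tuple hn (Set.to_countable {a}).measurableSet
  have h1 : ∀ᵐ ω ∂μ.restrict H, f (fun i => v n i ω) = ∑ a ∈ distinctTuples k n,
      Set.indicator {ω | (fun i => v n i ω) = a} (fun _ => f a) ω := by
    filter_upwards [ae_restrict_of_ae (hv.ae_mem hn)] with ω hω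
    rw [Finset.sum_eq_single_of_mem _ hω]
    · rw [Set.indicator_of_mem (by rfl)]
    · intro a _ hne
      exact Set.indicator_of_notMem (fun h => hne (Eq.symm h)) _
  rw [integral_congr_ae h1, integral_finsetSum _ fun a _ =>
    (integrable_const (f a)).indicator (hm a), Finset.mul_sum]
  refine Finset.sum_congr rfl fun a ha => ?_
  rw [integral_indicator_const _ (hm a), measureReal_restrict_apply (hm a),
    hv.measureReal_inter hn ha D]
  rw [Complex.real_smul]
  push_cast
  ring

end Sampling

end WRT

end

/-! ### Lévy's theorem and the characteristic function of the rescaled labels. -/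

noncomputable section

namespace WRT

section Convergence

set_option linter.unusedSectionVars false

/-- Lévy's convergence theorem for finite measures on `Fin k → ℝ` that are eventually probability
measures. -/
lemma tendsto_finiteMeasure_of_charFun {k : ℕ} {ν : ℕ → FiniteMeasure (Fin k → ℝ)}
    {ν₀ : FiniteMeasure (Fin k → ℝ)} (h₀ : IsProbabilityMeasure (ν₀ : Measure (Fin k → ℝ)))
    (hν : ∀ᶠ n in atTop, IsProbabilityMeasure (ν n : Measure (Fin k → ℝ)))
    (h : ∀ t : Fin k → ℝ, Tendsto
      (fun n => ∫ x, ∏ i, Complex.exp ((t i * x i : ℝ) * Complex.I) ∂(ν n : Measure (Fin k → ℝ)))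
      atTop (𝓝 (∫ x, ∏ i, Complex.exp ((t i * x i : ℝ) * Complex.I)
        ∂(ν₀ : Measure (Fin k → ℝ))))) :
    Tendsto ν atTop (𝓝 ν₀) := by
  classical
  let P₀ : ProbabilityMeasure (Fin k → ℝ) := ⟨ν₀, h₀⟩
  -- The default value is irrelevant: it is used only for `n` with `ν n` not a probability measure,
  -- hence not eventually.
  let P : ℕ → ProbabilityMeasure (Fin k → ℝ) := fun n =>
    if hn : IsProbabilityMeasure (ν n : Measure (Fin k → ℝ)) then ⟨ν n, hn⟩ else P₀
  have hP : ∀ᶠ n in atTop, (P n : Measure (Fin k → ℝ)) = ν n := by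
    filter_upwards [hν] with n hn
    have hPn : P n = ⟨ν n, hn⟩ := dif_pos hn
    rw [hPn]
    rfl
  have hcf : ∀ (Q : ProbabilityMeasure (Fin k → ℝ)) (t : EuclideanSpace ℝ (Fin k)),
      charFun (Q.map (PiLp.continuous_toLp 2 fun _ : Fin k => ℝ).measurable.aemeasurable :
        Measure (EuclideanSpace ℝ (Fin k))) t =
      ∫ x, ∏ i, Complex.exp ((t i * x i : ℝ) * Complex.I) ∂(Q : Measure (Fin k → ℝ)) := by
    intro Q t
    rw [charFun_apply, ProbabilityMeasure.toMeasure_map,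
      integral_map (PiLp.continuous_toLp 2 fun _ : Fin k => ℝ).measurable.aemeasurable (by fun_prop)]
    refine integral_congr_ae (Eventually.of_forall fun x => ?_)
    simp only [PiLp.inner_apply]
    rw [← Complex.exp_sum, ← Finset.sum_mul]
    congr 2
    push_cast
    refine Finset.sum_congr rfl fun i _ => ?_
    simp
  have h1 : Tendsto (fun n => (P n).map
      (PiLp.continuous_toLp 2 fun _ : Fin k => ℝ).measurable.aemeasurable) atTop
      (𝓝 (P₀.map (PiLp.continuous_toLp 2 fun _ : Fin k => ℝ).measurable.aemeasurable)) := by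
    refine ProbabilityMeasure.tendsto_of_tendsto_charFun fun t => ?_
    simp only [hcf]
    refine (h t).congr' ?_
    filter_upwards [hP] with n hn
    rw [hn]
  have h2 := ProbabilityMeasure.tendsto_map_of_tendsto_of_continuous _ _ h1
    (PiLp.continuous_ofLp 2 fun _ : Fin k => ℝ)
  have hid : ∀ Q : ProbabilityMeasure (Fin k → ℝ),
      (Q.map (PiLp.continuous_toLp 2 fun _ : Fin k => ℝ).measurable.aemeasurable).map
        (PiLp.continuous_ofLp 2 fun _ : Fin k => ℝ).measurable.aemeasurable = Q := by
    intro Q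
    apply Subtype.ext
    change Measure.map _ (Measure.map _ _) = _
    rw [Measure.map_map (PiLp.continuous_ofLp 2 fun _ : Fin k => ℝ).measurable
      (PiLp.continuous_toLp 2 fun _ : Fin k => ℝ).measurable]
    exact Measure.map_id
  simp only [hid] at h2
  have h3 := (ProbabilityMeasure.tendsto_nhds_iff_toFiniteMeasure_tendsto_nhds _).1 h2
  refine h3.congr' ?_
  filter_upwards [hP] with n hn
  exact Subtype.ext hn

lemma integral_iidNormal (k : ℕ) (m : ℝ) (t : Fin k → ℝ) :
    ∫ x, ∏ i, Complex.exp ((t i * x i : ℝ) * Complex.I) ∂(iidNormal k m : Measure (Fin k → ℝ)) =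
      ∏ i, Complex.exp ((t i * m : ℝ) * Complex.I - ((t i ^ 2 / 2 : ℝ) : ℂ)) := by
  change ∫ x, ∏ i, Complex.exp ((t i * x i : ℝ) * Complex.I)
    ∂(Measure.pi fun _ : Fin k => gaussianReal m 1) = _
  rw [integral_fintype_prod_eq_prod (fun i (y : ℝ) => Complex.exp ((t i * y : ℝ) * Complex.I))]
  refine Finset.prod_congr rfl fun i _ => ?_
  have := charFun_gaussianReal (μ := m) (v := 1) (t i)
  rw [charFun_apply_real] at this
  push_cast at this ⊢
  rw [this]
  simp

/-- The rescaled label is affine in log (n / a); its slope is the one built into `freq`, and its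
constant term √D is the phase removed in `tendsto_charInt_ratio`. -/
lemma rescaledLabel_eq {M : ℝ} (hM : 0 < M) {n D a : ℕ} {d : ℤ} (hd : d = D) (hD : 0 < D)
    (hn : 0 < n) (ha : 0 < a) :
    rescaledLabel (1 + M) n d a = √D - (1 + M) / M * (√D)⁻¹ * Real.log (n / a) := by
  have hα : 1 - (1 + M)⁻¹ = M / (1 + M) := by field_simp; ring
  have hD0 : (0 : ℝ) < D := by exact_mod_cast hD
  have hs : √(D : ℝ) * √(D : ℝ) = D := Real.mul_self_sqrt hD0.le
  have hs0 : 0 < √(D : ℝ) := Real.sqrt_pos.2 hD0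
  rw [rescaledLabel, hα, hd, Real.log_div (by positivity) (by positivity), Int.cast_natCast,
    Real.sqrt_mul (by positivity), Real.sqrt_sq (by positivity)]
  field_simp
  rw [Real.sq_sqrt hD0.le]
  ring

lemma exp_rescaledLabel {M : ℝ} (hM : 0 < M) {n D a : ℕ} {d : ℤ} (hd : d = D) (hD : 0 < D)
    (hn : 0 < n) (ha : 0 < a) (s : ℝ) :
    Complex.exp ((s * rescaledLabel (1 + M) n d a : ℝ) * Complex.I) =
      Complex.exp ((s * √(D : ℝ) : ℝ) * Complex.I) *
        Complex.exp (freq M s D * Real.log (n / a) * Complex.I) := by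
  rw [← Complex.exp_add, rescaledLabel_eq hM hd hD hn ha, freq]
  congr 1
  push_cast
  ring

lemma highDegreeEvent_eq {Ω : Type*} (parent : ℕ → Ω → ℕ) {k : ℕ} (v : ℕ → Fin k → Ω → ℕ)
    (d : Fin k → ℕ → ℤ) (n : ℕ) :
    highDegreeEvent parent v d n =
      {ω | ∀ i, (d i n).toNat ≤ inDegree parent n (v n i ω) ω} := by
  ext ω
  exact forall_congr' fun i => Int.toNat_le.symm

variable {Ω : Type*} [mΩ : MeasurableSpace Ω] {μ : Measure Ω} [IsProbabilityMeasure μ]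
  {W : ℕ → Ω → ℝ} {parent : ℕ → Ω → ℕ} {k : ℕ} {v : ℕ → Fin k → Ω → ℕ} {M : ℝ}

lemma IsUniformSample.measureReal_highDegreeEvent (hv : IsUniformSample μ W parent v) {n : ℕ}
    (hn : k ≤ n) (d : Fin k → ℕ → ℤ) :
    (μ.real (highDegreeEvent parent v d n) : ℂ) = ((distinctTuples k n).card : ℂ)⁻¹ *
      tupleSum μ parent n (fun i => (d i n).toNat) (fun _ => 0) := by
  have := hv.setIntegral_eq hn (fun i => (d i n).toNat) (fun _ => 1)
  rw [← highDegreeEvent_eq, integral_const, Complex.real_smul, mul_one,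
    measureReal_restrict_apply_univ] at this
  rw [this, tupleSum]
  simp

lemma IsUniformSample.setIntegral_highDegreeEvent (hv : IsUniformSample μ W parent v)
    (hM : 0 < M) {n : ℕ} (hn : k ≤ n) (hn0 : 0 < n) {d : Fin k → ℕ → ℤ} (hd : ∀ i, 0 < d i n)
    (t : Fin k → ℝ) :
    ∫ ω in highDegreeEvent parent v d n,
      ∏ i, Complex.exp ((t i * rescaledLabel (1 + M) n (d i n) (v n i ω) : ℝ) * Complex.I) ∂μ =
      ((distinctTuples k n).card : ℂ)⁻¹ *
        ((∏ i, Complex.exp ((t i * √((d i n).toNat : ℝ) : ℝ) * Complex.I)) *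
          tupleSum μ parent n (fun i => (d i n).toNat)
            (fun i => freq M (t i) (d i n).toNat)) := by
  rw [highDegreeEvent_eq, hv.setIntegral_eq hn (fun i => (d i n).toNat)
    (fun a => ∏ i, Complex.exp ((t i * rescaledLabel (1 + M) n (d i n) (a i) : ℝ) * Complex.I)),
    tupleSum]
  congr 1
  rw [Finset.mul_sum]
  refine Finset.sum_congr rfl fun a ha => ?_
  rw [← mul_assoc, ← Finset.prod_mul_distrib]
  congr 1
  refine Finset.prod_congr rfl fun i _ => ?_
  have ha' : a ∈ (distinctTuples k n : Set (Fin k → ℕ)) := ha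
  rw [coe_distinctTuples] at ha'
  exact exp_rescaledLabel hM (Int.toNat_of_nonneg (hd i).le).symm (by have := hd i; omega) hn0
    (Finset.mem_Icc.1 (ha'.2 i)).1 (t i)

lemma IsUniformSample.integral_condLabelLaw (hv : IsUniformSample μ W parent v) {θ : ℝ} {n : ℕ}
    (hn : k ≤ n) (d : Fin k → ℕ → ℤ) (t : Fin k → ℝ) :
    ∫ x, ∏ i, Complex.exp ((t i * x i : ℝ) * Complex.I)
        ∂(condLabelLaw μ θ parent v d n : Measure (Fin k → ℝ)) =
      (μ.real (highDegreeEvent parent v d n) : ℂ)⁻¹ * ∫ ω in highDegreeEvent parent v d n,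
        ∏ i, Complex.exp ((t i * rescaledLabel θ n (d i n) (v n i ω) : ℝ) * Complex.I) ∂μ := by
  change ∫ x, _ ∂((μ[|highDegreeEvent parent v d n]).map
    (fun ω i => rescaledLabel θ n (d i n) (v n i ω))) = _
  have hm : Measurable fun ω i => rescaledLabel θ n (d i n) (v n i ω) :=
    measurable_pi_lambda _ fun i =>
      (measurable_of_countable fun a : ℕ => rescaledLabel θ n (d i n) a).comp (hv.measurable n hn i)
  rw [integral_map hm.aemeasurable (Continuous.aestronglyMeasurable (by fun_prop)), ProbabilityTheory.cond, integral_smul_measure,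
    ENNReal.toReal_inv, Complex.real_smul, Complex.ofReal_inv]
  rfl

end Convergence

end WRT

end

/-! ### The zero-frequency sum and the conclusion. -/

noncomputable section

namespace WRT

section MainLimit

variable {Ω : Type*} [mΩ : MeasurableSpace Ω] {μ : Measure Ω} [IsProbabilityMeasure μ]
  {W : ℕ → Ω → ℝ} {parent : ℕ → Ω → ℕ} {k : ℕ} {v : ℕ → Fin k → Ω → ℕ} {w M c b c₁ : ℝ}

lemma tiltCenter_div_eq (hM : 0 < M) (hc₁ : 0 < c₁) :
    -(tiltCenter c₁ M / (1 + M)) = -1 / √(c₁ * (1 + M) * (1 + M - 1)) := by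
  have h1 : 0 < 1 + M := by linarith
  have e : (1 + M) / (c₁ * M) = (1 + M) ^ 2 / (c₁ * (1 + M) * M) := by field_simp
  rw [tiltCenter, add_sub_cancel_left, e, Real.sqrt_div (by positivity), Real.sqrt_sq h1.le]
  field_simp

/-- At frequency zero each factor is the tilted mass divided by itself. This gives the asymptotics
of the probability of the conditioning event. -/
lemma IsWRT.tendsto_tupleSum_zero_div (hT : IsWRT μ W parent) (hc₁ : 0 < c₁)
    (hw : w ∈ Set.Ioo (0 : ℝ) 1)
    (hW : ∀ i, 1 ≤ i → ∀ x ∈ Set.Ico w 1, μ.real {ω | x ≤ W i ω} = gammaFractionTail b c₁ w x)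
    (hM : 0 < M) (hMe : M = ∫ ω, W 1 ω ∂μ) (hc : 0 < c) (hcM : c * M < 1 + M)
    {D : Fin k → ℕ → ℕ} (hD : ∀ i, Tendsto (D i) atTop atTop)
    (hDc : ∀ i, ∀ᶠ n : ℕ in atTop, (D i n : ℝ) ≤ c * Real.log n) :
    Tendsto (fun n : ℕ => tupleSum μ parent n (fun i => D i n) (fun _ => 0) /
      (tupleNorm μ (W 1) M n (fun i => D i n) : ℂ)) atTop (𝓝 1) := by
  have h := hT.tendsto_tupleSum_div hc₁ hw hW hM hMe hc hcM hD hDc (ξ := fun _ _ => 0)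
    (fun i => by simp) (z := fun _ _ => 1) (by simp) (l := fun _ => 1) (fun i => by
      refine tendsto_const_nhds.congr' ?_
      filter_upwards [eventually_rpow_neg_le_tiltMass (hT.measurable_weight 1 le_rfl) hc₁ hw
        (hW 1 le_rfl) hM (hD i) (hDc i) one_pos, eventually_ge_atTop 1] with n hr hn
      have hn0 : (0 : ℝ) < n := by exact_mod_cast hn
      have hr0 := lt_of_lt_of_le (show 0 < (n : ℝ) ^ (-1 : ℝ) by positivity) hr
      have hT0 : (tiltMass μ (W 1) M (D i n) : ℂ) ≠ 0 := by
        rw [Complex.ofReal_ne_zero]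
        rintro h
        rw [h, mul_zero] at hr0
        exact lt_irrefl _ hr0
      rw [charInt_zero, one_mul, div_self hT0])
  simpa using h

end MainLimit

end WRT

end

theorem mainTheorem12 {Ω : Type*} [MeasurableSpace Ω] (μ : Measure Ω) [IsProbabilityMeasure μ]
    (W : ℕ → Ω → ℝ) (parent : ℕ → Ω → ℕ) (hT : WRT.IsWRT μ W parent)
    (b c₁ w : ℝ) (hc₁ : 0 < c₁) (hw : w ∈ Set.Ioo (0 : ℝ) 1)
    (hW : ∀ i, 1 ≤ i → ∀ x ∈ Set.Ico w 1,
      μ.real {ω | x ≤ W i ω} = WRT.gammaFractionTail b c₁ w x)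
    (θ : ℝ) (hθ : θ = 1 + ∫ ω, W 1 ω ∂μ)
    (k : ℕ) (c : ℝ) (hc : c ∈ Set.Ioo 0 (θ / (θ - 1)))
    (d : Fin k → ℕ → ℤ) (hd : ∀ i, Tendsto (d i) atTop atTop)
    (hdc : ∀ i, ∀ᶠ n : ℕ in atTop, (d i n : ℝ) ≤ c * Real.log n)
    (v : ℕ → Fin k → Ω → ℕ) (hv : WRT.IsUniformSample μ W parent v) :
    (∀ᶠ n : ℕ in atTop, μ (WRT.highDegreeEvent parent v d n) ≠ 0) ∧
    Tendsto (fun n => WRT.condLabelLaw μ θ parent v d n) atTop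
      (𝓝 (WRT.iidNormal k (-1 / √(c₁ * θ * (θ - 1))))) ∧
    -1 / √(c₁ * θ * (θ - 1)) < 0 := by
  obtain ⟨M, hMe⟩ : ∃ M, M = ∫ ω, W 1 ω ∂μ := ⟨_, rfl⟩
  rw [← hMe] at hθ
  subst hθ
  have hVm := hT.measurable_weight 1 le_rfl
  have hae := WRT.ae_mem_Ico hVm hc₁ hw (hW 1 le_rfl)
  have hM : 0 < M := by
    have hint : Integrable (W 1) μ :=
      Integrable.of_bound hVm.aestronglyMeasurable 1 (hae.mono fun ω h => by
        rw [Real.norm_eq_abs, abs_of_nonneg (hw.1.le.trans h.1)]; exact h.2.le)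
    have : ∫ _ω : Ω, w ∂μ ≤ ∫ ω, W 1 ω ∂μ :=
      integral_mono_ae (integrable_const w) hint (hae.mono fun ω h => h.1)
    simp only [integral_const, probReal_univ, one_smul] at this
    rw [hMe]
    exact hw.1.trans_le this
  have hcM : c * M < 1 + M := by
    have := hc.2
    rwa [add_sub_cancel_left, lt_div_iff₀ hM] at this
  set D : Fin k → ℕ → ℕ := fun i n => (d i n).toNat with hDdef
  have hdpos : ∀ᶠ n in atTop, ∀ i, 0 < d i n :=
    eventually_all.2 fun i => (hd i).eventually_gt_atTop 0
  have hD : ∀ i, Tendsto (D i) atTop atTop := fun i => by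
    refine tendsto_atTop.2 fun m => ?_
    filter_upwards [(hd i).eventually_ge_atTop (m : ℤ)] with n hn
    simp only [hDdef]
    omega
  have hDc : ∀ i, ∀ᶠ n : ℕ in atTop, (D i n : ℝ) ≤ c * Real.log n := fun i => by
    filter_upwards [hdc i, hdpos] with n hn hpos
    have : ((D i n : ℤ) : ℝ) = (d i n : ℝ) := by
      rw [Int.toNat_of_nonneg (hpos i).le]
    rw [← this] at hn
    exact_mod_cast hn
  have hzero := hT.tendsto_tupleSum_zero_div hc₁ hw hW hM hMe hc.1 hcM hD hDc
  -- A quotient with limit 1 is eventually nonzero, which yields both the positive probability and a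
  -- nonvanishing normalisation.
  have hne : ∀ᶠ n : ℕ in atTop,
      WRT.tupleSum μ parent n (fun i => D i n) (fun _ => 0) ≠ 0 ∧
        (WRT.tupleNorm μ (W 1) M n (fun i => D i n) : ℂ) ≠ 0 := by
    filter_upwards [hzero.eventually_ne one_ne_zero] with n hn
    exact div_ne_zero_iff.1 hn
  have hcard : ∀ᶠ n : ℕ in atTop, ((WRT.distinctTuples k n).card : ℂ) ≠ 0 := by
    filter_upwards [hne] with n hn h
    rw [Nat.cast_eq_zero, Finset.card_eq_zero] at h
    exact hn.1 (by rw [WRT.tupleSum, h, Finset.sum_empty])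
  have hpos : ∀ᶠ n : ℕ in atTop, μ (WRT.highDegreeEvent parent v d n) ≠ 0 := by
    filter_upwards [hne, hcard, eventually_ge_atTop k] with n h1 h2 hn h3
    have h4 := hv.measureReal_highDegreeEvent hn d
    rw [measureReal_def, h3, ENNReal.toReal_zero, Complex.ofReal_zero] at h4
    exact mul_ne_zero (inv_ne_zero h2) h1.1 h4.symm
  refine ⟨hpos, ?_, ?_⟩
  · refine WRT.tendsto_finiteMeasure_of_charFun ?_ ?_ ?_
    · change IsProbabilityMeasure (Measure.pi fun _ => gaussianReal _ 1)
      infer_instance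
    · filter_upwards [hpos, eventually_ge_atTop k] with n hn hkn
      change IsProbabilityMeasure ((μ[|WRT.highDegreeEvent parent v d n]).map _)
      have := cond_isProbabilityMeasure (μ := μ) hn
      refine Measure.isProbabilityMeasure_map (Measurable.aemeasurable ?_)
      exact measurable_pi_lambda _ fun i => (measurable_of_countable fun a : ℕ =>
        WRT.rescaledLabel (1 + M) n (d i n) a).comp (hv.measurable n hkn i)
    · intro t
      have hnum := hT.tendsto_tupleSum_div hc₁ hw hW hM hMe hc.1 hcM hD hDc
        (ξ := fun i n => WRT.freq M (t i) (D i n))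
        (fun i => by
          have h1 := ((WRT.tendsto_freq M (t i)).comp (hD i)).abs
          rw [abs_zero] at h1
          exact (h1.eventually_lt_const one_pos).mono fun n hn => hn.le)
        (z := fun i n => Complex.exp ((t i * √(D i n : ℝ) : ℝ) * Complex.I))
        (fun i n => Complex.norm_exp_ofReal_mul_I _)
        (fun i => (WRT.tendsto_charInt_ratio hVm hc₁ hw (hW 1 le_rfl) hM (t i)).comp (hD i))
      -- The conditional characteristic function is the quotient of the oscillating sum by the
      -- zero-frequency sum; `tupleNorm` and the number of tuples cancel.
      have hlim := hnum.div hzero one_ne_zero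
      rw [WRT.integral_iidNormal, ← WRT.tiltCenter_div_eq hM hc₁]
      have e : ∀ i, t i * -(WRT.tiltCenter c₁ M / (1 + M)) =
          -(t i * (WRT.tiltCenter c₁ M / (1 + M))) := fun i => by ring
      simp only [e]
      rw [div_one] at hlim
      refine hlim.congr' ?_
      filter_upwards [hne, hcard, hdpos, eventually_ge_atTop k, eventually_gt_atTop 0]
        with n h1 h2 h3 hkn hn0
      rw [hv.integral_condLabelLaw hkn, hv.setIntegral_highDegreeEvent hM hkn hn0 h3,
        hv.measureReal_highDegreeEvent hkn]
      have h4 := h1.1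
      have h5 := h1.2
      simp only [Pi.div_apply]
      simp only [hDdef] at h4 h5 ⊢
      rw [div_div_div_cancel_right₀ h5, mul_inv, inv_inv, mul_mul_mul_comm, mul_inv_cancel₀ h2,
        one_mul, div_eq_inv_mul]
  · have : 0 < c₁ * (1 + M) * (1 + M - 1) := by
      rw [add_sub_cancel_left]; positivity
    exact div_neg_of_neg_of_pos (by norm_num) (Real.sqrt_pos.2 this)
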